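/- Let $p$ be an odd prime, $K$ a finite extension of $\mathbb{Q}_p$ with ring of integers $\mathcal{O}_K$, uniformizer $\varpi$, normalized valuation $v$ and residue field of cardinality $q$. Let $\breve K$ be the completion of the maximal unramified extension of $K$, with ring of integers $\mathcal{O}_{\breve K}$. Put $G=\mathrm{GL}_2(K)$ and $[G]_2=\{g\in G : v(\det g)\in 2\mathbb{Z}\}$. Let $\hat{\mathbb{H}}$ be the standard semistable formal model over $\mathcal{O}_{\breve K}$ of the Drinfeld half plane: it is glued from the affine formal schemes $$\mathrm{Spf}\;\mathcal{O}_{\breve K}\Big\langle X,Y,\tfrac{1}{X^{q-1}-1},\tfrac{1}{Y^{q-1}-1}\Big\rangle/(XY-\varpi),$$ one for each edge of the Bruhat–Tits tree of $\mathrm{PGL}_2(K)$ (for the standard edge $X=z$, $Y=\varpi/z$), and $G$ acts on it. Let $\bar{\mathbb{H}}$ be its special fibre (the locus $\varpi=0$). The irreducible components of $\bar{\mathbb{H}}$ are projective lines $\mathbb{P}_s\cong\mathbb{P}^1$, indexed by the vertices $s$ of the tree, i.e. by the homothety classes of $\mathcal{O}_K$-lattices in $K^2$. Let $s_1=[\mathcal{O}_K\times\mathcal{O}_K]$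 and $s_0=[\mathcal{O}_K\times\varpi\mathcal{O}_K]$; these two vertices are adjacent. Let $X$ be $\hat{\mathbb{H}}$ or $\bar{\mathbb{H}}$. For a subgroup $H\subseteq G$, an $H$-equivariant line bundle on $X$ is a line bundle $\mathscr{L}$ on $X$ with, for all $g\in H$ and all open $U$, maps $\rho_g:\mathscr{L}(g^{-1}U)\to\mathscr{L}(U)$ which are additive, compatible with restrictions, semilinear ($\rho_g(fr)=(g\cdot f)\,\rho_g(r)$), and satisfy $\rho_1=\mathrm{id}$, $\rho_{gh}=\rho_g\circ\rho_h$. For a line bundle $\mathscr{L}$ on $X$ and a vertex $s$, the order $\mathrm{ord}_s(\mathscr{L})$ is the integer $k$ such that $\mathscr{L}|_{\mathbb{P}_s}\cong\mathcal{O}_{\mathbb{P}^1}(k)$, and the weight of $\mathscr{L}$ is the rational number $$w(\mathscr{L})=-\frac{\mathrm{ord}_{s_0}(\mathscr{L})+\mathrm{ord}_{s_1}(\mathscr{L})}{q-1}.$$ **Proposition.** Let $\mathscr{L}$ be a line bundle on $\hat{\mathbb{H}}$ or on $\bar{\mathbb{H}}$. 1. If $\mathscr{L}$ is $[G]_2$-equivariant,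 then its weight is an integer: $w(\mathscr{L})\in\mathbb{Z}$, i.e. $\mathrm{ord}_{s_0}(\mathscr{L})+\mathrm{ord}_{s_1}(\mathscr{L})\equiv 0 \pmod{q-1}$. 2. If $\mathscr{L}$ is $G$-equivariant, then its weight is an even integer: $w(\mathscr{L})\in 2\mathbb{Z}$; moreover $\mathrm{ord}_{s_0}(\mathscr{L})\equiv\mathrm{ord}_{s_1}(\mathscr{L})\equiv 0\pmod{q-1}$. -/

import Mathlib

noncomputable section

namespace DrinfeldPlane

open CategoryTheory TopologicalSpace Opposite
open scoped Polynomial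

variable {p : ℕ} [Fact p.Prime]

/-- The ring of integers `𝒪_K` of `K`. -/
def integers (K : IntermediateField ℚ_[p] ℂ_[p]) : ValuationSubring K :=
  (𝓞_ℂ_[p]).comap (algebraMap K ℂ_[p])

/-- A uniformizer of `K`. -/
structure Uniformizer (K : IntermediateField ℚ_[p] ℂ_[p]) where
  val : integers K
  irreducible : Irreducible val

/-- The cardinality `q` of the residue field of `K`. -/
def residueCard (K : IntermediateField ℚ_[p] ℂ_[p]) : ℕ :=
  Nat.card (IsLocalRing.ResidueField (integers K))

/-- The maximal unramified extension of `K` (inside `ℂ_[p]`): it is generated over `K` by the roots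
of unity of order prime to `p`. -/
def maxUnramified (K : IntermediateField ℚ_[p] ℂ_[p]) : Subfield ℂ_[p] :=
  Subfield.closure ((K : Set ℂ_[p]) ∪ {ζ | ∃ n : ℕ, ¬ p ∣ n ∧ ζ ^ n = 1})

/-- `K̆`, the completion of the maximal unramified extension of `K`, i.e. its closure in the
complete field `ℂ_[p]`. -/
def Breve (K : IntermediateField ℚ_[p] ℂ_[p]) : Subfield ℂ_[p] :=
  (maxUnramified K).topologicalClosure

variable (K : IntermediateField ℚ_[p] ℂ_[p])

/-- The inclusion `K → K̆`. -/
def toBreve : K →+* Breve K :=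
  (algebraMap K ℂ_[p]).codRestrict (Breve K) fun x =>
    Subfield.le_topologicalClosure _ (Subfield.subset_closure (Or.inl x.2))

/-- The ring of integers of `K̆`. -/
def breveIntegers : ValuationSubring (Breve K) :=
  (𝓞_ℂ_[p]).comap (Breve K).subtype

/-- The function field `K̆(z)` of the projective line over `K̆`. -/
abbrev FunctionField : Type := RatFunc (Breve K)

/-- The group `G = GL₂(K)`. -/
abbrev G : Type := GL (Fin 2) K

variable {K}

section Moebius

variable {E : Type} [Field E]

/-- The rational function `(a z + c) / (b z + d)`, for `g = (a b; c d)`. -/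
def moebiusFun (g : GL (Fin 2) E) : RatFunc E :=
  (RatFunc.C (g.1 0 0) * RatFunc.X + RatFunc.C (g.1 1 0)) /
    (RatFunc.C (g.1 0 1) * RatFunc.X + RatFunc.C (g.1 1 1))

theorem lin_ne_zero {a b : E} (h : a ≠ 0 ∨ b ≠ 0) :
    RatFunc.C a * RatFunc.X + RatFunc.C b ≠ 0 := by
  intro h0
  have h1 : algebraMap E[X] (RatFunc E) (Polynomial.C a * Polynomial.X + Polynomial.C b) = 0 := by
    simpa [RatFunc.algebraMap_C, RatFunc.algebraMap_X] using h0
  rw [map_eq_zero_iff _ (RatFunc.algebraMap_injective E)] at h1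
  have ha : a = 0 := by simpa using congrArg (fun q => Polynomial.coeff q 1) h1
  have hb : b = 0 := by simpa using congrArg (fun q => Polynomial.coeff q 0) h1
  tauto

theorem det_ne_zero (g : GL (Fin 2) E) : g.1 0 0 * g.1 1 1 - g.1 0 1 * g.1 1 0 ≠ 0 := by
  have := g.isUnit.map (Matrix.detMonoidHom)
  simpa [Matrix.det_fin_two] using this.ne_zero

theorem moebius_den_ne_zero (g : GL (Fin 2) E) :
    RatFunc.C (g.1 0 1) * RatFunc.X + RatFunc.C (g.1 1 1) ≠ 0 := by
  apply lin_ne_zero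
  by_contra! h
  apply det_ne_zero g
  simp [h.1, h.2]

theorem transcendental_moebiusFun (g : GL (Fin 2) E) : Transcendental E (moebiusFun g) := by
  apply RatFunc.transcendental_of_ne_C
  rintro ⟨e, he⟩
  rw [moebiusFun, div_eq_iff (moebius_den_ne_zero g)] at he
  have : RatFunc.C (g.1 0 0 - e * g.1 0 1) * RatFunc.X + RatFunc.C (g.1 1 0 - e * g.1 1 1) = 0 := by
    simp only [map_sub, map_mul]
    linear_combination he
  refine lin_ne_zero ?_ this
  by_contra! h
  apply det_ne_zero g
  linear_combination g.1 1 1 * h.1 - g.1 0 1 * h.2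

/-- The substitution `z ↦ (a z + c) / (b z + d)` as an endomorphism of `E(z)`. -/
def moebiusHom (g : GL (Fin 2) E) : RatFunc E →ₐ[E] RatFunc E :=
  RatFunc.liftAlgHom (Polynomial.aeval (moebiusFun g))
    (nonZeroDivisors_le_comap_nonZeroDivisors_of_injective _
      (transcendental_iff_injective.mp (transcendental_moebiusFun g)))

theorem moebiusHom_X (g : GL (Fin 2) E) : moebiusHom g RatFunc.X = moebiusFun g := by
  rw [← RatFunc.algebraMap_X]
  have := RatFunc.liftAlgHom_apply_div (Polynomial.aeval (moebiusFun g))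
    (nonZeroDivisors_le_comap_nonZeroDivisors_of_injective _
      (transcendental_iff_injective.mp (transcendental_moebiusFun g))) Polynomial.X 1
  simpa [moebiusHom] using this

theorem moebiusHom_C (g : GL (Fin 2) E) (c : E) : moebiusHom g (RatFunc.C c) = RatFunc.C c :=
  (moebiusHom g).commutes c

theorem ratFunc_algHom_ext {f g : RatFunc E →ₐ[E] RatFunc E}
    (h : f RatFunc.X = g RatFunc.X) : f = g := by
  have key : ∀ a : E[X], f (algebraMap E[X] _ a) = g (algebraMap E[X] _ a) := by
    intro a
    have : (f.comp (IsScalarTower.toAlgHom E E[X] (RatFunc E))) =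
      (g.comp (IsScalarTower.toAlgHom E E[X] (RatFunc E))) := by
      apply Polynomial.algHom_ext
      simpa [RatFunc.algebraMap_X] using h
    exact DFunLike.congr_fun this a
  ext x
  induction x using RatFunc.induction_on with
  | f a b hb => simp [map_div₀, key]

theorem moebiusHom_one : moebiusHom (1 : GL (Fin 2) E) = AlgHom.id E _ := by
  apply ratFunc_algHom_ext
  simp [moebiusHom_X, moebiusFun]

theorem moebiusHom_mul (g h : GL (Fin 2) E) :
    moebiusHom (g * h) = (moebiusHom g).comp (moebiusHom h) := by
  apply ratFunc_algHom_ext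
  rw [AlgHom.comp_apply, moebiusHom_X, moebiusHom_X]
  have e1 := moebius_den_ne_zero (g * h)
  have e2 := moebius_den_ne_zero g
  have e3 : moebiusHom g (RatFunc.C (h.1 0 1) * RatFunc.X + RatFunc.C (h.1 1 1)) ≠ 0 := by
    rw [Ne, map_eq_zero]
    exact moebius_den_ne_zero h
  simp only [moebiusFun, map_div₀, map_add, map_mul, moebiusHom_C, moebiusHom_X] at e3 ⊢
  rw [div_eq_div_iff e1 e3]
  simp only [Units.val_mul, Matrix.mul_apply, Fin.sum_univ_two, map_add, map_mul]
  field_simp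
  ring

end Moebius

/-- The action of `g = (a b; c d) ∈ GL₂(K)` on the function field: the substitution
`z ↦ (a z + c) / (b z + d)`, where `z = z₀ / z₁` and `g` acts linearly on the homogeneous
coordinates `z₀, z₁`, which form the standard basis of `K²`. -/
def act (g : G K) : FunctionField K →+* FunctionField K :=
  (moebiusHom (Matrix.GeneralLinearGroup.map (toBreve K) g)).toRingHom

theorem act_one : act (1 : G K) = RingHom.id _ := by
  ext x
  simp [act, moebiusHom_one]

theorem act_mul (g h : G K) : act (g * h) = (act g).comp (act h) := by
  ext x
  simp [act, moebiusHom_mul]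

theorem act_C (g : G K) (c : Breve K) : act g (RatFunc.C c) = RatFunc.C c :=
  moebiusHom_C _ c


/-! ### The points of the special fibre -/

/-- The constant `ϖ` of the function field. -/
def Uniformizer.const (ϖ : Uniformizer K) : FunctionField K :=
  RatFunc.C (toBreve K (ϖ.val : K))

/-- The algebra `𝒪[X, Y, 1/(X^(q-1)-1), 1/(Y^(q-1)-1)] / (XY - ϖ)` of the standard edge, where `𝒪`
is the ring of integers of `K̆`, realized in the function field by `X = z`, `Y = ϖ / z`. -/
def edgeAlgebra (ϖ : Uniformizer K) : Subring (FunctionField K) :=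
  Subring.closure (RatFunc.C '' (breveIntegers K : Set (Breve K)) ∪
    {RatFunc.X, ϖ.const / RatFunc.X,
      (RatFunc.X ^ (residueCard K - 1) - 1)⁻¹,
      ((ϖ.const / RatFunc.X) ^ (residueCard K - 1) - 1)⁻¹})

/-- `B` is the localization of `A` at a prime ideal (namely the trace on `A` of the maximal ideal
of `B`): it contains `A`, and its elements are the quotients `a / s`, with `a, s ∈ A` and `s` a unit
of `B`. -/
def IsLocalizationOf {F : Type} [Field F] (A : Subring F) (B : LocalSubring F) : Prop :=
  A ≤ B.toSubring ∧
    ∀ b ∈ B.toSubring, ∃ a ∈ A, ∃ s ∈ A, s ≠ 0 ∧ s⁻¹ ∈ B.toSubring ∧ b = a * s⁻¹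

/-- The points of the special fibre of the semistable model of the Drinfeld half plane.

The semistable model is obtained by gluing the formal spectra of the `ϖ`-adic completions of the
algebras `g A`, `g ∈ GL₂(K)`, where `A` is the algebra of the standard edge `(s₀, s₁)`: the chart
`g A` belongs to the edge `g • (s₀, s₁)` of the Bruhat-Tits tree, all edges are of this form, and
`𝒪⁺` of the affinoid of an edge is the completion of its algebra. The gluing takes place inside the
function field, so that a point is the same thing as a local ring in the function field which is the
localization of some `g A` at a prime lying over the maximal ideal of `𝒪`; two points in two charts
are identified exactly when these local rings agree. -/
@[ext]
structure Point (ϖ : Uniformizer K) where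
  localRing : LocalSubring (FunctionField K)
  exists_chart : ∃ g : G K, IsLocalizationOf ((edgeAlgebra ϖ).map (act g)) localRing
  special : ∀ c : Breve K, RatFunc.C c ∈ localRing.toSubring → c ∈ breveIntegers K

variable {ϖ : Uniformizer K}

/-- The local ring of the ambient algebraic model at the point `x`. -/
abbrev Point.ring (x : Point ϖ) : Subring (FunctionField K) := x.localRing.toSubring

theorem act_injective (g : G K) : Function.Injective (act g) := (act g).injective

theorem map_act_mul (g h : G K) (A : Subring (FunctionField K)) :
    A.map (act (g * h)) = (A.map (act h)).map (act g) := by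
  rw [act_mul, Subring.map_map]

theorem IsLocalizationOf.map_act {A : Subring (FunctionField K)}
    {B : LocalSubring (FunctionField K)} (h : IsLocalizationOf A B) (g : G K) :
    IsLocalizationOf (A.map (act g)) (B.map (act g)) := by
  refine ⟨Set.image_mono h.1, ?_⟩
  rintro _ ⟨b, hb, rfl⟩
  obtain ⟨a, ha, s, hs, hs0, hsB, rfl⟩ := h.2 b hb
  refine ⟨act g a, ⟨a, ha, rfl⟩, act g s, ⟨s, hs, rfl⟩, ?_, ⟨s⁻¹, hsB, map_inv₀ _ _⟩, by simp⟩
  rwa [Ne, map_eq_zero]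

/-- `GL₂(K)` acts on the special fibre through its action on the function field. -/
instance : MulAction (G K) (Point ϖ) where
  smul g x :=
    { localRing := x.localRing.map (act g)
      exists_chart := by
        obtain ⟨h, hh⟩ := x.exists_chart
        exact ⟨g * h, by rw [map_act_mul]; exact hh.map_act g⟩
      special := by
        rintro c ⟨d, hd, hdc⟩
        refine x.special c ?_
        rwa [← act_injective g (hdc.trans (act_C g c).symm)] }
  one_smul x := by
    ext1
    apply LocalSubring.toSubring_injective
    change x.ring.map (act 1) = x.ring
    rw [act_one, Subring.map_id]
  mul_smul g h x := by
    ext1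
    apply LocalSubring.toSubring_injective
    exact map_act_mul g h x.ring

theorem smul_ring (g : G K) (x : Point ϖ) : (g • x).ring = x.ring.map (act g) := rfl

theorem act_mem_of_mem {g : G K} {x : Point ϖ} {f : FunctionField K} (hf : f ∈ (g⁻¹ • x).ring) :
    act g f ∈ x.ring := by
  have : act g f ∈ (g • g⁻¹ • x).ring := ⟨f, hf, rfl⟩
  rwa [smul_inv_smul] at this

theorem mem_of_act_mem {g : G K} {x : Point ϖ} {f : FunctionField K} (hf : act g f ∈ x.ring) :
    f ∈ (g⁻¹ • x).ring := by
  refine ⟨act g f, hf, ?_⟩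
  rw [← RingHom.comp_apply, ← act_mul, inv_mul_cancel, act_one, RingHom.id_apply]

/-- The Zariski topology: the coarsest one for which `{x | f is regular at x}` is open, for every
rational function `f`. -/
instance : TopologicalSpace (Point ϖ) :=
  TopologicalSpace.generateFrom {S | ∃ f : FunctionField K, S = {x | f ∈ x.ring}}

theorem continuous_smul_point (g : G K) : Continuous (fun x : Point ϖ => g⁻¹ • x) := by
  rw [continuous_generateFrom_iff]
  rintro _ ⟨f, rfl⟩
  apply isOpen_generateFrom_of_mem
  exact ⟨act g f, Set.ext fun x => ⟨act_mem_of_mem, mem_of_act_mem⟩⟩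

theorem C_mem_ring (x : Point ϖ) {c : Breve K} (hc : c ∈ breveIntegers K) :
    RatFunc.C c ∈ x.ring := by
  obtain ⟨g, hg⟩ := x.exists_chart
  exact hg.1 ⟨RatFunc.C c, Subring.subset_closure (Or.inl ⟨c, hc, rfl⟩), act_C g c⟩

theorem toBreve_mem (a : integers K) : toBreve K (a : K) ∈ breveIntegers K := a.2

/-- `ϖ` as an element of the local ring at `x`. -/
def uniformizerAt (x : Point ϖ) : x.ring := ⟨ϖ.const, C_mem_ring x (toBreve_mem ϖ.val)⟩

theorem uniformizer_inv_notMem : (toBreve K (ϖ.val : K))⁻¹ ∉ breveIntegers K := by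
  intro h
  apply ϖ.irreducible.not_isUnit
  have h0 : (ϖ.val : K) ≠ 0 := fun h0 => ϖ.irreducible.ne_zero (Subtype.ext h0)
  have h1 : (ϖ.val : K)⁻¹ ∈ integers K := by
    rw [← map_inv₀] at h
    exact h
  exact IsUnit.of_mul_eq_one ⟨(ϖ.val : K)⁻¹, h1⟩ (Subtype.ext (mul_inv_cancel₀ h0))

theorem uniformizerAt_mem (x : Point ϖ) :
    uniformizerAt x ∈ IsLocalRing.maximalIdeal x.ring := by
  rw [IsLocalRing.mem_maximalIdeal, mem_nonunits_iff, isUnit_iff_exists_inv]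
  rintro ⟨b, hb⟩
  apply uniformizer_inv_notMem (ϖ := ϖ)
  apply x.special
  have h1 : ϖ.const * (b : FunctionField K) = 1 := congrArg Subtype.val hb
  have h2 : RatFunc.C (toBreve K (ϖ.val : K))⁻¹ = (b : FunctionField K) := by
    rw [map_inv₀]
    exact inv_eq_of_mul_eq_one_right h1
  rw [h2]
  exact b.2


/-! ### Vertices and components -/

/-- The polynomials over `𝒪` all of whose coefficients lie in the maximal ideal. -/
def nonprimitive (K : IntermediateField ℚ_[p] ℂ_[p]) : Ideal (breveIntegers K)[X] :=
  RingHom.ker (Polynomial.mapRingHom (IsLocalRing.residue (breveIntegers K)))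

instance : (nonprimitive K).IsPrime := RingHom.ker_isPrime _

/-- The inclusion of `𝒪[z]` in the function field. -/
def polyToFun (K : IntermediateField ℚ_[p] ℂ_[p]) : (breveIntegers K)[X] →+* FunctionField K :=
  (algebraMap (Breve K)[X] (FunctionField K)).comp
    (Polynomial.mapRingHom (breveIntegers K).subtype)

theorem polyToFun_injective : Function.Injective (polyToFun K) :=
  (RatFunc.algebraMap_injective _).comp
    (Polynomial.map_injective _ Subtype.val_injective)

theorem polyToFun_isUnit (s : (nonprimitive K).primeCompl) : IsUnit (polyToFun K s) := by
  rw [isUnit_iff_ne_zero, Ne, map_eq_zero_iff _ polyToFun_injective]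
  intro h
  exact s.2 (by rw [h]; exact Ideal.zero_mem _)

/-- The Gauss valuation ring, i.e. the localization of `𝒪[z]` at `𝔪[z]`, as a subring of the
function field. -/
def gaussSubring (K : IntermediateField ℚ_[p] ℂ_[p]) : Subring (FunctionField K) where
  carrier := {f | ∃ a b : (breveIntegers K)[X], b ∉ nonprimitive K ∧
    f = polyToFun K a / polyToFun K b}
  zero_mem' := ⟨0, 1, (nonprimitive K).one_notMem, by simp⟩
  one_mem' := ⟨1, 1, (nonprimitive K).one_notMem, by simp⟩
  add_mem' := by
    rintro _ _ ⟨a, b, hb, rfl⟩ ⟨c, d, hd, rfl⟩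
    refine ⟨a * d + b * c, b * d, (nonprimitive K).primeCompl.mul_mem hb hd, ?_⟩
    rw [div_add_div _ _ (polyToFun_isUnit ⟨b, hb⟩).ne_zero (polyToFun_isUnit ⟨d, hd⟩).ne_zero]
    simp only [map_add, map_mul]
  mul_mem' := by
    rintro _ _ ⟨a, b, hb, rfl⟩ ⟨c, d, hd, rfl⟩
    refine ⟨a * c, b * d, (nonprimitive K).primeCompl.mul_mem hb hd, ?_⟩
    rw [div_mul_div_comm, map_mul, map_mul]
  neg_mem' := by
    rintro _ ⟨a, b, hb, rfl⟩
    exact ⟨-a, b, hb, by rw [map_neg, neg_div]⟩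

theorem mem_gaussSubring {f : FunctionField K} : f ∈ gaussSubring K ↔
    ∃ a b : (breveIntegers K)[X], b ∉ nonprimitive K ∧ f = polyToFun K a / polyToFun K b :=
  Iff.rfl

theorem isLocalRing_gaussSubring : IsLocalRing (gaussSubring K) := by
  have key : ∀ a b : (breveIntegers K)[X], a ∉ nonprimitive K → b ∉ nonprimitive K →
      ∀ f : gaussSubring K, (f : FunctionField K) = polyToFun K a / polyToFun K b → IsUnit f := by
    intro a b ha hb f hf
    refine isUnit_iff_exists_inv.mpr ⟨⟨polyToFun K b / polyToFun K a, b, a, ha, rfl⟩, ?_⟩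
    apply Subtype.ext
    have h1 := (polyToFun_isUnit ⟨a, ha⟩).ne_zero
    have h2 := (polyToFun_isUnit ⟨b, hb⟩).ne_zero
    change (f : FunctionField K) * _ = 1
    rw [hf, div_mul_div_comm, mul_comm, div_self (mul_ne_zero h2 h1)]
  refine IsLocalRing.of_isUnit_or_isUnit_one_sub_self ?_
  rintro ⟨_, a, b, hb, rfl⟩
  by_cases ha : a ∈ nonprimitive K
  · right
    refine key (b - a) b (fun h => hb ?_) hb _ ?_
    · simpa using Ideal.add_mem _ h ha
    · change 1 - polyToFun K a / polyToFun K b = _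
      rw [map_sub, sub_div, div_self (polyToFun_isUnit ⟨b, hb⟩).ne_zero]
  · left
    exact key a b ha hb _ rfl

/-- The Gauss valuation ring, the local ring at the generic point of the component attached to the
standard vertex. -/
def gaussRing (K : IntermediateField ℚ_[p] ℂ_[p]) : LocalSubring (FunctionField K) where
  toSubring := gaussSubring K
  isLocalRing := isLocalRing_gaussSubring

theorem mem_gaussRing {f : FunctionField K} : f ∈ (gaussRing K).toSubring ↔
    ∃ a b : (breveIntegers K)[X], b ∉ nonprimitive K ∧ f = polyToFun K a / polyToFun K b :=
  Iff.rfl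

theorem polyToFun_C (c : breveIntegers K) :
    polyToFun K (Polynomial.C c) = RatFunc.C (c : Breve K) := by
  simp [polyToFun, RatFunc.algebraMap_C]

theorem polyToFun_X : polyToFun K Polynomial.X = RatFunc.X := by
  simp [polyToFun, RatFunc.algebraMap_X]

theorem notMem_nonprimitive_of_coeff {f : (breveIntegers K)[X]} {n : ℕ}
    (h : f.coeff n = 1 ∨ f.coeff n = -1) : f ∉ nonprimitive K := by
  intro hf
  have h1 : f.map (IsLocalRing.residue (breveIntegers K)) = 0 := hf
  have h2 := congrArg (fun q => Polynomial.coeff q n) h1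
  simp only [Polynomial.coeff_map, Polynomial.coeff_zero] at h2
  rcases h with h | h <;> rw [h] at h2 <;> simp at h2

theorem polyToFun_mem_gaussRing (a : (breveIntegers K)[X]) :
    polyToFun K a ∈ (gaussRing K).toSubring :=
  mem_gaussRing.mpr ⟨a, 1, notMem_nonprimitive_of_coeff (n := 0) (by simp), by simp⟩

theorem const_eq (ϖ : Uniformizer K) :
    ϖ.const = polyToFun K (Polynomial.C ⟨_, toBreve_mem ϖ.val⟩) := by
  rw [polyToFun_C]; rfl

theorem edgeAlgebra_le_gaussRing (ϖ : Uniformizer K) :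
    edgeAlgebra ϖ ≤ (gaussRing K).toSubring := by
  have hX : (RatFunc.X : FunctionField K) ≠ 0 := RatFunc.X_ne_zero
  rw [edgeAlgebra, Subring.closure_le]
  rintro f (⟨c, hc, rfl⟩ | rfl | rfl | rfl | rfl)
  · rw [← polyToFun_C ⟨c, hc⟩]
    exact polyToFun_mem_gaussRing _
  · rw [← polyToFun_X]
    exact polyToFun_mem_gaussRing _
  · rw [const_eq, ← polyToFun_X]
    exact mem_gaussRing.mpr ⟨_, _, notMem_nonprimitive_of_coeff (n := 1) (by simp), rfl⟩
  · rcases Nat.eq_zero_or_pos (residueCard K - 1) with h0 | h0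
    · simp [h0]
    · refine mem_gaussRing.mpr ⟨1, Polynomial.X ^ (residueCard K - 1) - 1,
        notMem_nonprimitive_of_coeff (n := 0) (Or.inr ?_), ?_⟩
      · simp [Polynomial.coeff_X_pow, h0.ne]
      · simp [polyToFun_X]
  · rcases Nat.eq_zero_or_pos (residueCard K - 1) with h0 | h0
    · simp [h0]
    · refine mem_gaussRing.mpr ⟨Polynomial.X ^ (residueCard K - 1),
        Polynomial.C ⟨_, toBreve_mem ϖ.val⟩ ^ (residueCard K - 1)
          - Polynomial.X ^ (residueCard K - 1),
        notMem_nonprimitive_of_coeff (n := residueCard K - 1) (Or.inr ?_), ?_⟩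
      · rw [← map_pow, Polynomial.coeff_sub, Polynomial.coeff_C, if_neg h0.ne',
          Polynomial.coeff_X_pow, if_pos rfl, zero_sub]
      · rw [map_sub, map_pow, map_pow, polyToFun_X, ← const_eq, div_pow,
          div_sub_one (pow_ne_zero _ hX), inv_div]

/-- The generic point of the component `ℙ_{s₁}` attached to the standard vertex `s₁ = [𝒪_K²]`. -/
def standardGenericPoint (ϖ : Uniformizer K) : Point ϖ where
  localRing := gaussRing K
  exists_chart := by
    refine ⟨1, ?_⟩
    rw [act_one, Subring.map_id]
    have hz : RatFunc.X ∈ edgeAlgebra ϖ := Subring.subset_closure (Or.inr (Or.inl rfl))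
    have hpoly : ∀ a, polyToFun K a ∈ edgeAlgebra ϖ := by
      intro a
      induction a using Polynomial.induction_on' with
      | add a b ha hb => rw [map_add]; exact Subring.add_mem _ ha hb
      | monomial n c =>
        rw [← Polynomial.C_mul_X_pow_eq_monomial, map_mul, map_pow, polyToFun_C, polyToFun_X]
        exact mul_mem (Subring.subset_closure (Or.inl ⟨_, c.2, rfl⟩)) (pow_mem hz n)
    refine ⟨edgeAlgebra_le_gaussRing ϖ, fun b hb => ?_⟩
    obtain ⟨a, s, hs, rfl⟩ := mem_gaussRing.mp hb
    refine ⟨_, hpoly a, _, hpoly s, (polyToFun_isUnit ⟨s, hs⟩).ne_zero, ?_, div_eq_mul_inv _ _⟩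
    exact mem_gaussRing.mpr ⟨1, s, hs, by simp⟩
  special := by
    intro c hc
    obtain ⟨a, b, hb, h⟩ := mem_gaussRing.mp hc
    by_contra hcO
    have hc0 : c ≠ 0 := by
      rintro rfl
      exact hcO (zero_mem (breveIntegers K))
    have hcinv : c⁻¹ ∈ breveIntegers K := ((breveIntegers K).mem_or_inv_mem c).resolve_left hcO
    have hcu : IsLocalRing.residue (breveIntegers K) ⟨c⁻¹, hcinv⟩ = 0 := by
      rw [IsLocalRing.residue_eq_zero_iff, IsLocalRing.mem_maximalIdeal, mem_nonunits_iff,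
        isUnit_iff_exists_inv]
      rintro ⟨d, hd⟩
      apply hcO
      have h1 : c⁻¹ * (d : Breve K) = 1 := congrArg Subtype.val hd
      have h2 : (d : Breve K) = c := by field_simp at h1; exact h1
      rw [← h2]; exact d.2
    have hab : b = Polynomial.C ⟨c⁻¹, hcinv⟩ * a := by
      apply polyToFun_injective
      rw [eq_div_iff (polyToFun_isUnit ⟨b, hb⟩).ne_zero] at h
      rw [map_mul, polyToFun_C, ← h, ← mul_assoc, ← map_mul, inv_mul_cancel₀ hc0, map_one, one_mul]
    apply hb
    rw [hab]
    apply Ideal.mul_mem_right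
    change Polynomial.map _ _ = 0
    rw [Polynomial.map_C, hcu, map_zero]

/-- The generic point of the component `ℙ_s` attached to the vertex `s = g • s₁`. -/
def genericPoint (ϖ : Uniformizer K) (g : G K) : Point ϖ := g • standardGenericPoint ϖ

/-- The coordinate `X` on the component attached to the vertex `g • s₁`. -/
def coord (g : G K) : FunctionField K := act g RatFunc.X

/-- The component `ℙ_s` for `s = g • s₁`: the specializations of its generic point. -/
def component (ϖ : Uniformizer K) (g : G K) : Set (Point ϖ) :=
  {x | x.ring ≤ (genericPoint ϖ g).ring}

/-! ### The structure sheaves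

For `ν : ℕ∞` let `X_ν` be the closed formal subscheme `ϖ^(ν+1) = 0` of the semistable model. Thus
`X_0` is the special fibre, `X_⊤` is the semistable formal model itself, and
`𝒪_{X_⊤} = lim 𝒪_{X_n}`; over the chart of an edge its ring of sections is the `ϖ`-adic completion of
the algebra of that edge. All `X_ν` have the same underlying space `Point ϖ`. -/

/-- The ideal `(ϖ^(m+1))` of the local ring at `x`. -/
def thickening (x : Point ϖ) (m : ℕ) : Ideal x.ring := Ideal.span {uniformizerAt x ^ (m + 1)}

/-- Where the germs at `x` of functions on `X_ν` take their values: families of elements of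
`𝒪_x / ϖ^(m+1)` for `m ≤ ν`. -/
abbrev Germ (ν : ℕ∞) (x : Point ϖ) : Type :=
  ∀ m : {m : ℕ // (m : ℕ∞) ≤ ν}, x.ring ⧸ thickening x m

/-- The reductions of `f` modulo `ϖ^(m+1)`, `m ≤ ν`. -/
def toGerm (ν : ℕ∞) (x : Point ϖ) : x.ring →+* Germ ν x :=
  RingHom.pi fun m => Ideal.Quotient.mk (thickening x m)

/-- A family of germs is a section if, for each `n ≤ ν`, its reductions modulo `ϖ^(m+1)`, `m ≤ n`,
are given locally by one and the same rational function. -/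
def IsSection (ν : ℕ∞) {U : Opens (Point ϖ)} (s : ∀ x : U, Germ ν x.1) : Prop :=
  ∀ x : U, ∀ n : {n : ℕ // (n : ℕ∞) ≤ ν}, ∃ (V : Opens (Point ϖ)) (_ : x.1 ∈ V) (h : V ≤ U)
    (f : FunctionField K), ∀ y : V, ∃ hf : f ∈ y.1.ring,
      ∀ m ≤ n, s ⟨y.1, h y.2⟩ m = toGerm ν y.1 ⟨f, hf⟩ m

theorem IsSection.map₂ {ν : ℕ∞} {U : Opens (Point ϖ)} {s t : ∀ x : U, Germ ν x.1}
    (hs : IsSection ν s) (ht : IsSection ν t)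
    (F : FunctionField K → FunctionField K → FunctionField K)
    (r : ∀ x : U, Germ ν x.1)
    (hF : ∀ (y : U) (f g : FunctionField K) (hf : f ∈ y.1.ring) (hg : g ∈ y.1.ring),
      ∃ h : F f g ∈ y.1.ring, ∀ m, s y m = toGerm ν y.1 ⟨f, hf⟩ m →
        t y m = toGerm ν y.1 ⟨g, hg⟩ m → r y m = toGerm ν y.1 ⟨F f g, h⟩ m) :
    IsSection ν r := by
  intro x n
  obtain ⟨V, hxV, hV, f, hf⟩ := hs x n
  obtain ⟨W, hxW, hW, g, hg⟩ := ht x n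
  refine ⟨V ⊓ W, ⟨hxV, hxW⟩, inf_le_left.trans hV, F f g, fun y => ?_⟩
  obtain ⟨hfy, hfm⟩ := hf ⟨y.1, y.2.1⟩
  obtain ⟨hgy, hgm⟩ := hg ⟨y.1, y.2.2⟩
  obtain ⟨h, hm⟩ := hF ⟨y.1, hV y.2.1⟩ f g hfy hgy
  exact ⟨h, fun m hmn => hm m (hfm m hmn) (hgm m hmn)⟩

theorem IsSection.restrict {ν : ℕ∞} {U V : Opens (Point ϖ)} (h : V ≤ U)
    {s : ∀ x : U, Germ ν x.1} (hs : IsSection ν s) :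
    IsSection ν (fun x : V => s ⟨x.1, h x.2⟩) := by
  intro x n
  obtain ⟨W, hxW, hW, f, hf⟩ := hs ⟨x.1, h x.2⟩ n
  exact ⟨W ⊓ V, ⟨hxW, x.2⟩, inf_le_right, f, fun y => hf ⟨y.1, y.2.1⟩⟩

/-- The ring of sections of `𝒪_{X_ν}` over `U`. -/
def sections (ν : ℕ∞) (U : Opens (Point ϖ)) : Subring (∀ x : U, Germ ν x.1) where
  carrier := {s | IsSection ν s}
  zero_mem' x n := ⟨U, x.2, le_rfl, 0, fun y => ⟨zero_mem _, fun _ _ => rfl⟩⟩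
  one_mem' x n := ⟨U, x.2, le_rfl, 1, fun y => ⟨one_mem _, fun _ _ => rfl⟩⟩
  add_mem' {s t} hs ht := hs.map₂ ht (· + ·) _ fun y f g hf hg =>
    ⟨add_mem hf hg, fun m h1 h2 => by
      change s y m + t y m = _
      rw [h1, h2]; rfl⟩
  mul_mem' {s t} hs ht := hs.map₂ ht (· * ·) _ fun y f g hf hg =>
    ⟨mul_mem hf hg, fun m h1 h2 => by
      change s y m * t y m = _
      rw [h1, h2]; rfl⟩
  neg_mem' {s} hs := IsSection.map₂ hs hs (fun f _ => -f) _ fun y f g hf hg =>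
    ⟨neg_mem hf, fun m h1 _ => by
      change -(s y m) = _
      rw [h1]; rfl⟩

/-- Restriction of sections. -/
def restrict (ν : ℕ∞) {U V : Opens (Point ϖ)} (h : V ≤ U) : sections ν U →+* sections ν V where
  toFun s := ⟨fun x => s.1 ⟨x.1, h x.2⟩, IsSection.restrict h s.2⟩
  map_one' := rfl
  map_mul' _ _ := rfl
  map_zero' := rfl
  map_add' _ _ := rfl

/-- `IsSection` as a local predicate. -/
def sectionPredicate (ϖ : Uniformizer K) (ν : ℕ∞) :
    TopCat.LocalPredicate (X := TopCat.of (Point ϖ)) (fun x : Point ϖ => Germ ν x) where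
  pred s := IsSection ν s
  res i _ hs := IsSection.restrict i.le hs
  locality s hs x n := by
    obtain ⟨V, hxV, i, hV⟩ := hs x
    obtain ⟨W, hxW, hW, f, hf⟩ := hV ⟨x.1, hxV⟩ n
    exact ⟨W, hxW, hW.trans i.le, f, hf⟩

/-- The structure presheaf of `X_ν`. -/
def structurePresheaf (ϖ : Uniformizer K) (ν : ℕ∞) :
    TopCat.Presheaf RingCat (TopCat.of (Point ϖ)) where
  obj U := RingCat.of (sections ν U.unop)
  map i := RingCat.ofHom (restrict ν i.unop.le)

/-- The structure sheaf of `X_ν`. -/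
def structureSheaf (ϖ : Uniformizer K) (ν : ℕ∞) :
    TopCat.Sheaf RingCat (TopCat.of (Point ϖ)) :=
  ⟨structurePresheaf ϖ ν, (TopCat.Presheaf.isSheaf_iff_isSheaf_comp (forget RingCat) _).mpr
    (TopCat.Presheaf.isSheaf_of_iso (F := (TopCat.subsheafToTypes (sectionPredicate ϖ ν)).obj)
      (NatIso.ofComponents (fun _ => Iso.refl _)) (TopCat.subsheafToTypes (sectionPredicate ϖ ν)).2)⟩

/-- The isomorphism of local rings given by `g`. -/
def ringAct (g : G K) (x : Point ϖ) : (g⁻¹ • x).ring →+* x.ring :=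
  ((act g).comp (g⁻¹ • x).ring.subtype).codRestrict x.ring fun f => act_mem_of_mem f.2

theorem thickening_le_comap (g : G K) (x : Point ϖ) (m : ℕ) :
    thickening (g⁻¹ • x) m ≤ (thickening x m).comap (ringAct g x) := by
  rw [thickening, Ideal.span_le, Set.singleton_subset_iff]
  apply Ideal.subset_span
  apply Subtype.ext
  change act g (ϖ.const ^ (m + 1)) = ϖ.const ^ (m + 1)
  rw [map_pow, Uniformizer.const, act_C]

/-- The translation of germs by `g`. -/
def germAct (ν : ℕ∞) (g : G K) (x : Point ϖ) : Germ ν (g⁻¹ • x) →+* Germ ν x :=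
  RingHom.pi fun m => (Ideal.quotientMap (thickening x m) (ringAct g x)
    (thickening_le_comap g x m)).comp (Pi.evalRingHom _ m)

theorem germAct_toGerm (ν : ℕ∞) (g : G K) (x : Point ϖ) (f : (g⁻¹ • x).ring)
    (m : {m : ℕ // (m : ℕ∞) ≤ ν}) (s : Germ ν (g⁻¹ • x)) (h : s m = toGerm ν _ f m) :
    germAct ν g x s m = toGerm ν x ⟨act g f, act_mem_of_mem f.2⟩ m := by
  change Ideal.quotientMap (thickening x m) (ringAct g x) (thickening_le_comap g x m) (s m) = _
  rw [h]
  rfl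

/-- The action `s ↦ g · s`, `𝒪(g⁻¹ U) → 𝒪(U)`, on functions. -/
def sectionsAct (ν : ℕ∞) (g : G K) {V U : Opens (Point ϖ)} (h : ∀ x, x ∈ U ↔ g⁻¹ • x ∈ V) :
    sections ν V →+* sections ν U where
  toFun s := ⟨fun x => germAct ν g x.1 (s.1 ⟨g⁻¹ • x.1, (h x.1).mp x.2⟩), by
    intro x n
    obtain ⟨W, hxW, hW, f, hf⟩ := s.2 ⟨g⁻¹ • x.1, (h x.1).mp x.2⟩ n
    refine ⟨⟨_, W.2.preimage (continuous_smul_point g)⟩, hxW, fun y hy => (h y).mpr (hW hy),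
      act g f, fun y => ?_⟩
    obtain ⟨hfy, hfm⟩ := hf ⟨g⁻¹ • y.1, y.2⟩
    exact ⟨act_mem_of_mem hfy, fun m hm => germAct_toGerm ν g y.1 ⟨f, hfy⟩ m _ (hfm m hm)⟩⟩
  map_one' := Subtype.ext (funext fun x => map_one (germAct ν g x.1))
  map_mul' s t := Subtype.ext (funext fun x => map_mul (germAct ν g x.1) _ _)
  map_zero' := Subtype.ext (funext fun x => map_zero (germAct ν g x.1))
  map_add' s t := Subtype.ext (funext fun x => map_add (germAct ν g x.1) _ _)

/-- The residue field of the model at `x`. -/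
abbrev ResidueField (x : Point ϖ) : Type := IsLocalRing.ResidueField x.ring

theorem thickening_le_maximalIdeal (x : Point ϖ) (m : ℕ) :
    thickening x m ≤ IsLocalRing.maximalIdeal x.ring := by
  rw [thickening, Ideal.span_le, Set.singleton_subset_iff, pow_succ]
  exact Ideal.mul_mem_left _ _ (uniformizerAt_mem x)

/-- The value of a germ at `x` in the residue field of `x`. -/
def germValue (ν : ℕ∞) (x : Point ϖ) : Germ ν x →+* ResidueField x :=
  (Ideal.Quotient.factor (thickening_le_maximalIdeal x 0)).comp
    (Pi.evalRingHom (fun m : {m : ℕ // (m : ℕ∞) ≤ ν} => x.ring ⧸ thickening x m) ⟨0, zero_le⟩)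

/-- The value at the point `x`, in the residue field of `x`, of a function on `X_ν`. -/
def value (ν : ℕ∞) {U : Opens (Point ϖ)} (x : Point ϖ) (hx : x ∈ U) :
    sections ν U →+* ResidueField x :=
  (germValue ν x).comp ((Pi.evalRingHom _ (⟨x, hx⟩ : U)).comp (sections ν U).subtype)

/-! ### Line bundles -/

/-- Sheaves of modules on `X_ν`. -/
abbrev Modules (ϖ : Uniformizer K) (ν : ℕ∞) : Type 1 := SheafOfModules.{0} (structureSheaf ϖ ν)

variable {ν : ℕ∞}

/-- The sections of `L` over `U`. -/
def Sec (L : Modules ϖ ν) (U : Opens (Point ϖ)) : Type := L.val.obj (op U)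

instance (L : Modules ϖ ν) (U : Opens (Point ϖ)) : AddCommGroup (Sec L U) :=
  inferInstanceAs (AddCommGroup (L.val.obj (op U)))

instance (L : Modules ϖ ν) (U : Opens (Point ϖ)) : Module (sections ν U) (Sec L U) :=
  inferInstanceAs (Module ((structureSheaf ϖ ν).obj.obj (op U)) (L.val.obj (op U)))

/-- Restriction of sections of `L`. -/
def res (L : Modules ϖ ν) {U V : Opens (Point ϖ)} (h : V ≤ U) : Sec L U →+ Sec L V :=
  (L.val.presheaf.map (homOfLE h).op).hom

theorem res_smul (L : Modules ϖ ν) {U V : Opens (Point ϖ)} (h : V ≤ U) (f : sections ν U)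
    (e : Sec L U) : res L h (f • e) = restrict ν h f • res L h e :=
  L.val.map_smul (homOfLE h).op f e

/-- `e` trivializes `L` over `U`: multiplication by `e` is an isomorphism `𝒪_U → L|_U`. -/
def IsGenerator (L : Modules ϖ ν) {U : Opens (Point ϖ)} (e : Sec L U) : Prop :=
  ∀ (V : Opens (Point ϖ)) (h : V ≤ U),
    Function.Bijective fun f : sections ν V => f • res L h e

/-- `L` is a line bundle: it is locally isomorphic to the structure sheaf. -/
def IsLineBundle (L : Modules ϖ ν) : Prop :=
  ∀ x : Point ϖ, ∃ (U : Opens (Point ϖ)) (_ : x ∈ U) (e : Sec L U), IsGenerator L e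

/-- A semilinear action on `L` of the subgroup `H` of `GL₂(K)`: for `g ∈ H` and `U` open, a map
`ρ_g : L(g⁻¹ U) → L(U)` with `ρ_g (f r) = (g · f) ρ_g (r)`, compatibly with restrictions, and with
`ρ_(gh) = ρ_g ∘ ρ_h`, `ρ_1 = id`. The open set `g⁻¹ U` is written `V`. -/
structure EquivariantStructure (H : Subgroup (G K)) (L : Modules ϖ ν) where
  ρ : ∀ g ∈ H, ∀ {V U : Opens (Point ϖ)}, (∀ x, x ∈ U ↔ g⁻¹ • x ∈ V) → (Sec L V →+ Sec L U)
  ρ_res : ∀ g (hg : g ∈ H) {V U V' U' : Opens (Point ϖ)} (h : ∀ x, x ∈ U ↔ g⁻¹ • x ∈ V)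
    (h' : ∀ x, x ∈ U' ↔ g⁻¹ • x ∈ V') (hV : V' ≤ V) (hU : U' ≤ U) (r : Sec L V),
    ρ g hg h' (res L hV r) = res L hU (ρ g hg h r)
  ρ_smul : ∀ g (hg : g ∈ H) {V U : Opens (Point ϖ)} (h : ∀ x, x ∈ U ↔ g⁻¹ • x ∈ V)
    (f : sections ν V) (r : Sec L V), ρ g hg h (f • r) = sectionsAct ν g h f • ρ g hg h r
  ρ_one : ∀ {U : Opens (Point ϖ)} (h : ∀ x, x ∈ U ↔ (1 : G K)⁻¹ • x ∈ U) (r : Sec L U),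
    ρ 1 H.one_mem h r = r
  ρ_mul : ∀ g (hg : g ∈ H) g' (hg' : g' ∈ H) {W V U : Opens (Point ϖ)}
    (h : ∀ x, x ∈ U ↔ g⁻¹ • x ∈ V) (h' : ∀ x, x ∈ V ↔ g'⁻¹ • x ∈ W)
    (h'' : ∀ x, x ∈ U ↔ (g * g')⁻¹ • x ∈ W) (r : Sec L W),
    ρ (g * g') (H.mul_mem hg hg') h'' r = ρ g hg h (ρ g' hg' h' r)

/-! ### Orders and weights -/

open Classical in
/-- The generators at the point `x ∈ ℙ_s`, `s = g • s₁`, of the sheaf `𝒪_{ℙ_s}(k)`, seen inside the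
function field of `ℙ_s`. This sheaf is generated by `1` where the coordinate `X` is regular, and by
`X^k` near the point `X = ∞`. -/
def twistGenerators (g : G K) (k : ℤ) (x : Point ϖ) : Set (ResidueField (genericPoint ϖ g)) :=
  {c | ∃ (u : FunctionField K) (_ : u ∈ x.ring) (_ : u⁻¹ ∈ x.ring) (_ : u ≠ 0)
    (hu : u * coord g ^ (if coord g ∈ x.ring then 0 else k) ∈
      (genericPoint ϖ g).ring), c = IsLocalRing.residue (genericPoint ϖ g).ring ⟨_, hu⟩}

/-- An isomorphism of the restriction of `L` to the component `ℙ_s ≅ ℙ¹`, `s = g • s₁`, with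
`𝒪(k)`: a homomorphism from `L` to the direct image of `𝒪_{ℙ_s}(k)` (seen inside the constant sheaf
on `ℙ_s` given by the function field of `ℙ_s`) which takes local generators of `L` to local
generators of `𝒪_{ℙ_s}(k)`. -/
structure ComponentIso (L : Modules ϖ ν) (g : G K) (k : ℤ) where
  φ : ∀ {U : Opens (Point ϖ)}, genericPoint ϖ g ∈ U →
    (Sec L U →+ ResidueField (genericPoint ϖ g))
  φ_res : ∀ {U V : Opens (Point ϖ)} (h : V ≤ U) (hU : genericPoint ϖ g ∈ U)
    (hV : genericPoint ϖ g ∈ V) (r : Sec L U), φ hV (res L h r) = φ hU r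
  φ_smul : ∀ {U : Opens (Point ϖ)} (hU : genericPoint ϖ g ∈ U) (f : sections ν U) (r : Sec L U),
    φ hU (f • r) = value ν (genericPoint ϖ g) hU f * φ hU r
  φ_generator : ∀ {U : Opens (Point ϖ)} (hU : genericPoint ϖ g ∈ U) (e : Sec L U),
    IsGenerator L e → ∀ x ∈ U, x ∈ component ϖ g → φ hU e ∈ twistGenerators g k x

open Classical in
/-- The order `ord_s(L)` of a line bundle at the vertex `s = g • s₁`: the integer `k` such that the
restriction of `L` to `ℙ_s ≅ ℙ¹` is isomorphic to `𝒪(k)` (for a line bundle `L` there is exactly one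
such `k`, because `Pic(ℙ¹) = ℤ`). -/
def ord (L : Modules ϖ ν) (g : G K) : ℤ :=
  if h : ∃ k : ℤ, Nonempty (ComponentIso L g k) then h.choose else 0

theorem uniformizer_ne_zero (ϖ : Uniformizer K) : (ϖ.val : K) ≠ 0 :=
  fun h0 => ϖ.irreducible.ne_zero (Subtype.ext h0)

/-- The matrix `α = (1 0; 0 ϖ)`. -/
def alpha (ϖ : Uniformizer K) : G K :=
  Matrix.GeneralLinearGroup.mkOfDetNeZero !![1, 0; 0, (ϖ.val : K)]
    (by simpa [Matrix.det_fin_two] using uniformizer_ne_zero ϖ)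

/-- The order at the standard vertex `s₁ = [𝒪_K²]`. -/
def ordOne (L : Modules ϖ ν) : ℤ := ord L 1

/-- The order at the vertex `s₀ = α • s₁ = [𝒪_K × ϖ 𝒪_K]`. -/
def ordZero (L : Modules ϖ ν) : ℤ := ord L (alpha ϖ)

/-- The weight `w(L) = - (ord_{s₀}(L) + ord_{s₁}(L)) / (q - 1)`. -/
def weight (L : Modules ϖ ν) : ℚ :=
  -((ordZero L + ordOne L : ℤ) : ℚ) / ((residueCard K : ℚ) - 1)

/-- The subgroup `[G]₂` of the matrices whose determinant has even valuation. -/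
def evenSubgroup (ϖ : Uniformizer K) : Subgroup (G K) where
  carrier := {g | ∃ (n : ℤ) (u : (integers K)ˣ),
    g.det.val = ((u : integers K) : K) * (ϖ.val : K) ^ (2 * n)}
  one_mem' := ⟨0, 1, by simp⟩
  mul_mem' := by
    rintro g h ⟨n, u, hg⟩ ⟨m, v, hh⟩
    refine ⟨n + m, u * v, ?_⟩
    rw [map_mul, Units.val_mul, hg, hh, mul_add, zpow_add₀ (uniformizer_ne_zero ϖ)]
    push_cast
    ring
  inv_mem' := by
    rintro g ⟨n, u, hg⟩
    refine ⟨-n, u⁻¹, ?_⟩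
    have hu : ((u : integers K) : K) * ((u⁻¹ : (integers K)ˣ) : integers K) = 1 :=
      congrArg Subtype.val u.mul_inv
    rw [map_inv, Units.val_inv_eq_inv_val, hg, mul_inv, mul_neg, zpow_neg,
      inv_eq_of_mul_eq_one_right hu]

/-- The semistable formal model `Ĥ` of the Drinfeld half plane is `X_⊤`. -/
abbrev HHat : ℕ∞ := ⊤

/-- The special fibre `H̄` is `X_0`. -/
abbrev HBar : ℕ∞ := 0

end DrinfeldPlane

end

/-!
Let `x` be the intersection point of `ℙ_{s₀}` and `ℙ_{s₁}`. The diagonal matrices with entries in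
`𝒪_K^*` fix `x` and both components, so they act on the one-dimensional fibre of an equivariant line
bundle `L` at `x`. The congruences come from computing this character on either component.

On `ℙ_{s₁}`, with coordinate `z`, the matrix `t = diag ζ 1` acts by `z ↦ ζ z`, with fixed points `0`
and `∞`. If `L` restricts to `𝒪(k)`, then the quotient of the actions of `t` on `L` and on `𝒪(k)` is an
invertible function on `ℙ_{s₁}`, hence a constant `c`. As `𝒪(k)` is generated by `1` at `0` and by
`z ^ k` at `∞`, the element `t` acts by `c` on the fibre at `0` and by `c ζ ^ k` on the fibre at `∞`
(`ComponentIso.exists_actsOnFibreBy`). The matrix `w = (0 1; 1 0)` exchanges these points, so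
`diag 1 ζ` acts by `c ζ ^ k` at `0`, which is the point `x` (`exists_actsOnFibreBy_ordOne`). In the
same way on `ℙ_{s₀}`, where `x` is the point `∞` and `α w α⁻¹` exchanges the fixed points, `diag ζ 1`
acts by `c' ζ ^ k'` and `diag 1 ζ` by `c'` at `x` (`exists_actsOnFibreBy_ordZero`). Comparison gives
`ζ ^ (k + k') = 1` in the residue field for every `ζ`, that is, `q - 1 ∣ k + k'`. The matrices used have
unit determinant. If all of `GL₂(K)` acts, then `α w` fixes `x` and conjugates `diag ζ 1` to
`diag 1 ζ`, so that also `ζ ^ k = 1`; moreover `α` maps `ℙ_{s₁}` to `ℙ_{s₀}`, so that `k = k'`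
(`ord_mul_eq`).

The computation needs that `L` does restrict to some `𝒪(k)` on each component
(`exists_componentIso`), and that invertible functions on a component are constant
(`exists_C_sub_mem_maxAt`). Both are reduced to the function field `κ(z)` of `ℙ_{s₁}`: the points of
`ℙ_{s₁}` are determined by their local rings in `κ(z)` (`eq_of_redRing_eq`, separatedness), and every
valuation ring of `κ(z)` has a centre on `ℙ_{s₁}` (`exists_redRing_le`, properness). Constancy of
global functions is then the fact that the intersection of these valuation rings is integral over
`κ`, and `Pic ℙ¹ = ℤ` is `exists_mul_isUnitIn`, where the zeros and poles of a divisor are removed one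
by one.
-/

noncomputable section

namespace DrinfeldPlane

open CategoryTheory TopologicalSpace Opposite
open scoped Polynomial

variable {p : ℕ} [Fact p.Prime] {K : IntermediateField ℚ_[p] ℂ_[p]} {ϖ : Uniformizer K}

/-! ### Finiteness of the residue field -/

theorem mem_integers_iff_norm_le_one {x : K} : x ∈ integers K ↔ ‖(x : ℂ_[p])‖ ≤ 1 := by
  change (x : ℂ_[p]) ∈ (PadicComplex.valued p).v.valuationSubring ↔ _
  rw [PadicComplex.norm_eq_norm, Valuation.mem_valuationSubring_iff]
  exact (Valued.toNormedField.norm_le_one_iff (L := ℂ_[p]) (Γ₀ := NNReal)).symm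

/-- The unit ball of `K` is compact, and two points of it at distance `< 1` have the same residue.
-/
theorem finite_residueField [FiniteDimensional ℚ_[p] K] :
    Finite (IsLocalRing.ResidueField (integers K)) := by
  let W : Submodule ℚ_[p] ℂ_[p] := Subalgebra.toSubmodule K.toSubalgebra
  have : FiniteDimensional ℚ_[p] W := inferInstanceAs (FiniteDimensional ℚ_[p] K)
  have : ProperSpace W := FiniteDimensional.proper ℚ_[p] W
  obtain ⟨t, hts, htf, hcov⟩ := (isCompact_closedBall (0 : W) 1).finite_cover_balls zero_lt_one
  have hmem : ∀ x ∈ t, (⟨x.1, x.2⟩ : K) ∈ integers K := fun x hx => by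
    rw [mem_integers_iff_norm_le_one]
    simpa using hts hx
  have := htf.to_subtype
  refine Finite.of_surjective
    (fun x : t => IsLocalRing.residue (integers K) ⟨⟨x.1.1, x.1.2⟩, hmem x.1 x.2⟩) ?_
  intro r
  obtain ⟨y, rfl⟩ := IsLocalRing.residue_surjective r
  have hy : (⟨y.1.1, y.1.2⟩ : W) ∈ Metric.closedBall (0 : W) 1 := by
    exact mem_closedBall_zero_iff.mpr (mem_integers_iff_norm_le_one.mp y.2)
  obtain ⟨x, hx, hxy⟩ := Set.mem_iUnion₂.mp (hcov hy)
  refine ⟨⟨x, hx⟩, ?_⟩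
  have hd : ‖(y.1.1 - x.1 : ℂ_[p])‖ < 1 := by
    simpa [dist_eq_norm] using hxy
  symm
  rw [← sub_eq_zero, ← map_sub, IsLocalRing.residue_eq_zero_iff, IsLocalRing.mem_maximalIdeal,
    mem_nonunits_iff, isUnit_iff_exists_inv]
  rintro ⟨e, he⟩
  have he1 := mem_integers_iff_norm_le_one.mp e.2
  have he2 : (y.1.1 - x.1 : ℂ_[p]) * (e.1 : ℂ_[p]) = 1 :=
    congrArg (fun z : integers K => ((z : K) : ℂ_[p])) he
  have he3 := congrArg norm he2
  rw [norm_mul, norm_one] at he3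
  nlinarith [norm_nonneg (e.1 : ℂ_[p]), norm_nonneg (y.1.1 - x.1 : ℂ_[p])]

/-! ### Units and maximal ideals of the local rings -/

/-- The maximal ideal of the local ring at `x`, as a subset of the function field. -/
def maxAt (x : Point ϖ) : AddSubgroup (FunctionField K) :=
  (IsLocalRing.maximalIdeal x.ring).toAddSubgroup.map x.ring.subtype.toAddMonoidHom

/-- The rational function `f` is a unit of the local ring at `x`. -/
structure IsUnitAt (x : Point ϖ) (f : FunctionField K) : Prop where
  mem : f ∈ x.ring
  inv_mem : f⁻¹ ∈ x.ring
  ne_zero : f ≠ 0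

theorem mem_maxAt {x : Point ϖ} {f : FunctionField K} :
    f ∈ maxAt x ↔ ∃ hf : f ∈ x.ring, (⟨f, hf⟩ : x.ring) ∈ IsLocalRing.maximalIdeal x.ring := by
  constructor
  · rintro ⟨a, ha, rfl⟩
    exact ⟨a.2, ha⟩
  · rintro ⟨hf, h⟩
    exact ⟨⟨f, hf⟩, h, rfl⟩

theorem maxAt_le {x : Point ϖ} {f : FunctionField K} (h : f ∈ maxAt x) : f ∈ x.ring :=
  (mem_maxAt.mp h).1

theorem isUnit_iff_isUnitAt {x : Point ϖ} {f : FunctionField K} (hf : f ∈ x.ring) :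
    IsUnit (⟨f, hf⟩ : x.ring) ↔ IsUnitAt x f := by
  rw [isUnit_iff_exists_inv]
  constructor
  · rintro ⟨b, hb⟩
    have h1 : f * (b : FunctionField K) = 1 := congrArg Subtype.val hb
    have h0 : f ≠ 0 := left_ne_zero_of_mul_eq_one h1
    refine ⟨hf, ?_, h0⟩
    rw [inv_eq_of_mul_eq_one_right h1]
    exact b.2
  · intro h
    exact ⟨⟨f⁻¹, h.inv_mem⟩, Subtype.ext (mul_inv_cancel₀ h.ne_zero)⟩

theorem isUnitAt_iff {x : Point ϖ} {f : FunctionField K} :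
    IsUnitAt x f ↔ f ∈ x.ring ∧ f ∉ maxAt x := by
  constructor
  · intro h
    refine ⟨h.mem, fun hm => ?_⟩
    obtain ⟨hf, h2⟩ := mem_maxAt.mp hm
    exact h2 ((isUnit_iff_isUnitAt hf).mpr h)
  · rintro ⟨hf, hm⟩
    rw [← isUnit_iff_isUnitAt hf]
    by_contra h
    exact hm (mem_maxAt.mpr ⟨hf, h⟩)

theorem IsUnitAt.notMem {x : Point ϖ} {f : FunctionField K} (h : IsUnitAt x f) : f ∉ maxAt x :=
  (isUnitAt_iff.mp h).2

theorem isUnitAt_or_mem {x : Point ϖ} {f : FunctionField K} (h : f ∈ x.ring) :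
    IsUnitAt x f ∨ f ∈ maxAt x := by
  rw [isUnitAt_iff]; tauto

theorem mem_maxAt_of_inv_notMem {x : Point ϖ} {f : FunctionField K} (h : f ∈ x.ring)
    (h' : f⁻¹ ∉ x.ring) : f ∈ maxAt x :=
  (isUnitAt_or_mem h).resolve_left fun hu => h' hu.inv_mem

theorem mul_mem_maxAt {x : Point ϖ} {a f : FunctionField K} (ha : a ∈ x.ring)
    (hf : f ∈ maxAt x) : a * f ∈ maxAt x := by
  obtain ⟨h1, h2⟩ := mem_maxAt.mp hf
  exact mem_maxAt.mpr ⟨mul_mem ha h1, Ideal.mul_mem_left _ ⟨a, ha⟩ h2⟩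

theorem mul_mem_maxAt' {x : Point ϖ} {a f : FunctionField K} (hf : f ∈ maxAt x)
    (ha : a ∈ x.ring) : f * a ∈ maxAt x := mul_comm a f ▸ mul_mem_maxAt ha hf

theorem isUnitAt_one (x : Point ϖ) : IsUnitAt x 1 := ⟨one_mem _, by simp, one_ne_zero⟩

theorem IsUnitAt.mul {x : Point ϖ} {f g : FunctionField K} (hf : IsUnitAt x f)
    (hg : IsUnitAt x g) : IsUnitAt x (f * g) :=
  ⟨mul_mem hf.mem hg.mem, mul_inv f g ▸ mul_mem hf.inv_mem hg.inv_mem,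
    mul_ne_zero hf.ne_zero hg.ne_zero⟩

theorem IsUnitAt.inv {x : Point ϖ} {f : FunctionField K} (hf : IsUnitAt x f) :
    IsUnitAt x f⁻¹ := ⟨hf.inv_mem, (inv_inv f).symm ▸ hf.mem, inv_ne_zero hf.ne_zero⟩

theorem IsUnitAt.div {x : Point ϖ} {f g : FunctionField K} (hf : IsUnitAt x f)
    (hg : IsUnitAt x g) : IsUnitAt x (f / g) := div_eq_mul_inv f g ▸ hf.mul hg.inv

theorem IsUnitAt.neg {x : Point ϖ} {f : FunctionField K} (hf : IsUnitAt x f) :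
    IsUnitAt x (-f) :=
  ⟨neg_mem hf.mem, by rw [inv_neg]; exact neg_mem hf.inv_mem, neg_ne_zero.mpr hf.ne_zero⟩

theorem IsUnitAt.zpow {x : Point ϖ} {f : FunctionField K} (hf : IsUnitAt x f) (n : ℤ) :
    IsUnitAt x (f ^ n) := by
  have key : ∀ m : ℕ, IsUnitAt x (f ^ m) := fun m =>
    ⟨pow_mem hf.mem m, by rw [← inv_pow]; exact pow_mem hf.inv_mem m, pow_ne_zero m hf.ne_zero⟩
  cases n with
  | ofNat m => simpa using key m
  | negSucc m => rw [zpow_negSucc]; exact (key _).inv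

theorem IsUnitAt.add_maxAt {x : Point ϖ} {f g : FunctionField K} (hf : IsUnitAt x f)
    (hg : g ∈ maxAt x) : IsUnitAt x (f + g) :=
  isUnitAt_iff.mpr ⟨add_mem hf.mem (maxAt_le hg), fun h =>
    hf.notMem (by simpa using sub_mem h hg)⟩

theorem residue_eq_iff {x : Point ϖ} {f g : FunctionField K} (hf : f ∈ x.ring)
    (hg : g ∈ x.ring) :
    IsLocalRing.residue x.ring ⟨f, hf⟩ = IsLocalRing.residue x.ring ⟨g, hg⟩ ↔
      f - g ∈ maxAt x := by
  rw [← sub_eq_zero, ← map_sub, IsLocalRing.residue_eq_zero_iff, mem_maxAt]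
  exact ⟨fun h => ⟨sub_mem hf hg, h⟩, fun h => h.2⟩

theorem residue_eq_zero_iff {x : Point ϖ} {f : FunctionField K} (hf : f ∈ x.ring) :
    IsLocalRing.residue x.ring ⟨f, hf⟩ = 0 ↔ f ∈ maxAt x := by
  rw [IsLocalRing.residue_eq_zero_iff, mem_maxAt]
  exact ⟨fun h => ⟨hf, h⟩, fun h => h.2⟩

theorem maxAt_of_le {x y : Point ϖ} (h : x.ring ≤ y.ring) {f : FunctionField K}
    (hf : f ∈ x.ring) (hfy : f ∈ maxAt y) : f ∈ maxAt x :=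
  (isUnitAt_or_mem hf).resolve_left fun hu =>
    (IsUnitAt.notMem ⟨h hu.mem, h hu.inv_mem, hu.ne_zero⟩) hfy

theorem IsUnitAt.of_le {x y : Point ϖ} (h : x.ring ≤ y.ring) {f : FunctionField K}
    (hf : IsUnitAt x f) : IsUnitAt y f := ⟨h hf.mem, h hf.inv_mem, hf.ne_zero⟩

theorem act_mem_iff (g : G K) {x : Point ϖ} {f : FunctionField K} :
    act g f ∈ (g • x).ring ↔ f ∈ x.ring := by
  rw [smul_ring, Subring.mem_map]
  exact ⟨fun ⟨a, ha, h⟩ => act_injective g h ▸ ha, fun h => ⟨f, h, rfl⟩⟩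

theorem act_isUnitAt_iff (g : G K) {x : Point ϖ} {f : FunctionField K} :
    IsUnitAt (g • x) (act g f) ↔ IsUnitAt x f := by
  constructor
  · intro h
    refine ⟨(act_mem_iff g).mp h.mem, (act_mem_iff g).mp ?_, fun h0 => h.ne_zero (by simp [h0])⟩
    rw [map_inv₀]
    exact h.inv_mem
  · intro h
    refine ⟨(act_mem_iff g).mpr h.mem, ?_, ?_⟩
    · rw [← map_inv₀]
      exact (act_mem_iff g).mpr h.inv_mem
    · rw [Ne, map_eq_zero]
      exact h.ne_zero

theorem act_mem_maxAt_iff (g : G K) {x : Point ϖ} {f : FunctionField K} :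
    act g f ∈ maxAt (g • x) ↔ f ∈ maxAt x := by
  by_cases h : f ∈ x.ring
  · have := act_isUnitAt_iff g (x := x) (f := f)
    rw [isUnitAt_iff, isUnitAt_iff, act_mem_iff] at this
    tauto
  · exact ⟨fun h' => absurd ((act_mem_iff g).mp (maxAt_le h')) h,
      fun h' => absurd (maxAt_le h') h⟩

/-- The residue field of `𝒪`. -/
abbrev BreveResidue (K : IntermediateField ℚ_[p] ℂ_[p]) : Type :=
  IsLocalRing.ResidueField (breveIntegers K)

theorem isUnitAt_C (x : Point ϖ) {c : breveIntegers K} (hc : IsUnit c) :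
    IsUnitAt x (RatFunc.C (c : Breve K)) := by
  obtain ⟨d, hd⟩ := isUnit_iff_exists_inv.mp hc
  have h1 : RatFunc.C (c : Breve K) * RatFunc.C (d : Breve K) = 1 := by
    rw [← map_mul, ← map_one RatFunc.C]
    exact congrArg (fun z : breveIntegers K => RatFunc.C (z : Breve K)) hd
  exact ⟨C_mem_ring x c.2, by rw [inv_eq_of_mul_eq_one_right h1]; exact C_mem_ring x d.2,
    left_ne_zero_of_mul_eq_one h1⟩

theorem C_mem_maxAt_iff (x : Point ϖ) (c : breveIntegers K) :
    RatFunc.C (c : Breve K) ∈ maxAt x ↔ IsLocalRing.residue (breveIntegers K) c = 0 := by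
  rw [IsLocalRing.residue_eq_zero_iff, IsLocalRing.mem_maximalIdeal, mem_nonunits_iff]
  constructor
  · exact fun h hc => (isUnitAt_C x hc).notMem h
  · intro h
    refine (isUnitAt_or_mem (C_mem_ring x c.2)).resolve_left fun hu => h ?_
    have h2 := hu.inv_mem
    rw [← map_inv₀] at h2
    refine isUnit_iff_exists_inv.mpr ⟨⟨_, x.special _ h2⟩, Subtype.ext (mul_inv_cancel₀ ?_)⟩
    exact fun h0 => hu.ne_zero (by rw [h0, map_zero])

theorem const_mem_maxAt (x : Point ϖ) : ϖ.const ∈ maxAt x :=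
  mem_maxAt.mpr ⟨_, uniformizerAt_mem x⟩

theorem const_ne_zero (ϖ : Uniformizer K) : ϖ.const ≠ 0 := by
  rw [Uniformizer.const, Ne, map_eq_zero, map_eq_zero]
  exact uniformizer_ne_zero ϖ

theorem const_inv_notMem (x : Point ϖ) : ϖ.const⁻¹ ∉ x.ring := fun h =>
  IsUnitAt.notMem ⟨maxAt_le (const_mem_maxAt x), h, const_ne_zero ϖ⟩ (const_mem_maxAt x)

/-! ### Reduction of the Gauss valuation ring -/

/-- The reduction of a polynomial over `𝒪`, as a rational function over the residue field. -/
def polyRed (K : IntermediateField ℚ_[p] ℂ_[p]) :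
    (breveIntegers K)[X] →+* RatFunc (BreveResidue K) :=
  (algebraMap (BreveResidue K)[X] (RatFunc (BreveResidue K))).comp
    (Polynomial.mapRingHom (IsLocalRing.residue (breveIntegers K)))

theorem polyRed_eq_zero_iff {a : (breveIntegers K)[X]} : polyRed K a = 0 ↔ a ∈ nonprimitive K := by
  rw [polyRed, RingHom.comp_apply, map_eq_zero_iff _ (RatFunc.algebraMap_injective _)]
  rfl

theorem polyRed_C (c : breveIntegers K) :
    polyRed K (Polynomial.C c) = RatFunc.C (IsLocalRing.residue _ c) := by
  simp [polyRed, RatFunc.algebraMap_C]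

theorem polyRed_X : polyRed K Polynomial.X = RatFunc.X := by
  simp [polyRed, RatFunc.algebraMap_X]

theorem polyToFun_ne_zero {b : (breveIntegers K)[X]} (hb : b ∉ nonprimitive K) :
    polyToFun K b ≠ 0 := (polyToFun_isUnit ⟨b, hb⟩).ne_zero

theorem polyRed_div_eq {a b c d : (breveIntegers K)[X]} (hb : b ∉ nonprimitive K)
    (hd : d ∉ nonprimitive K) (h : polyToFun K a / polyToFun K b = polyToFun K c / polyToFun K d) :
    polyRed K a / polyRed K b = polyRed K c / polyRed K d := by
  rw [div_eq_div_iff (polyToFun_ne_zero hb) (polyToFun_ne_zero hd), ← map_mul, ← map_mul] at h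
  rw [div_eq_div_iff (polyRed_eq_zero_iff.not.mpr hb) (polyRed_eq_zero_iff.not.mpr hd), ← map_mul,
    ← map_mul, polyToFun_injective h]

/-- The value of the reduction map on `gaussSubring K`, computed from a chosen fraction. -/
def redFun (f : gaussSubring K) : RatFunc (BreveResidue K) :=
  polyRed K f.2.choose / polyRed K f.2.choose_spec.choose

theorem redFun_eq {f : gaussSubring K} {a b : (breveIntegers K)[X]} (hb : b ∉ nonprimitive K)
    (h : (f : FunctionField K) = polyToFun K a / polyToFun K b) :
    redFun f = polyRed K a / polyRed K b :=
  polyRed_div_eq f.2.choose_spec.choose_spec.1 hb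
    (f.2.choose_spec.choose_spec.2.symm.trans h)

/-- Reduction `a / b ↦ ā / b̄` from the Gauss valuation ring to the rational functions over the
residue field. It identifies the latter with the function field of `ℙ_{s₁}`. -/
def red : gaussSubring K →+* RatFunc (BreveResidue K) where
  toFun := redFun
  map_zero' := by
    rw [redFun_eq (a := 0) (b := 1) (nonprimitive K).one_notMem (by simp)]
    simp
  map_one' := by
    rw [redFun_eq (a := 1) (b := 1) (nonprimitive K).one_notMem (by simp)]
    simp
  map_add' := by
    rintro ⟨f, a, b, hb, rfl⟩ ⟨g, c, d, hd, rfl⟩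
    have hb' := polyRed_eq_zero_iff.not.mpr hb
    have hd' := polyRed_eq_zero_iff.not.mpr hd
    rw [redFun_eq (f := ⟨_, a, b, hb, rfl⟩) hb rfl, redFun_eq (f := ⟨_, c, d, hd, rfl⟩) hd rfl,
      redFun_eq (a := a * d + b * c) (b := b * d) ((nonprimitive K).primeCompl.mul_mem hb hd),
      div_add_div _ _ hb' hd']
    · simp only [map_add, map_mul]
    · simp only [map_add, map_mul]
      exact div_add_div _ _ (polyToFun_ne_zero hb) (polyToFun_ne_zero hd)
  map_mul' := by
    rintro ⟨f, a, b, hb, rfl⟩ ⟨g, c, d, hd, rfl⟩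
    rw [redFun_eq (f := ⟨_, a, b, hb, rfl⟩) hb rfl, redFun_eq (f := ⟨_, c, d, hd, rfl⟩) hd rfl,
      redFun_eq (a := a * c) (b := b * d) ((nonprimitive K).primeCompl.mul_mem hb hd),
      div_mul_div_comm]
    · simp only [map_mul]
    · simp only [map_mul]
      exact div_mul_div_comm _ _ _ _

theorem red_eq {f : gaussSubring K} {a b : (breveIntegers K)[X]} (hb : b ∉ nonprimitive K)
    (h : (f : FunctionField K) = polyToFun K a / polyToFun K b) :
    red f = polyRed K a / polyRed K b := redFun_eq hb h

theorem polyToFun_mem_gauss (a : (breveIntegers K)[X]) : polyToFun K a ∈ gaussSubring K :=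
  polyToFun_mem_gaussRing a

theorem red_polyToFun (a : (breveIntegers K)[X]) :
    red ⟨polyToFun K a, polyToFun_mem_gauss a⟩ = polyRed K a := by
  rw [red_eq (a := a) (b := 1) (nonprimitive K).one_notMem (by simp)]
  simp

theorem red_surjective : Function.Surjective (red (K := K)) := by
  have hmap : Function.Surjective
      (Polynomial.mapRingHom (IsLocalRing.residue (breveIntegers K))) :=
    Polynomial.map_surjective _ IsLocalRing.residue_surjective
  intro r
  induction r using RatFunc.induction_on with
  | f a b hb =>
    obtain ⟨a, rfl⟩ := hmap a
    obtain ⟨b, rfl⟩ := hmap b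
    exact ⟨⟨_, a, b, hb, rfl⟩, red_eq hb rfl⟩

theorem isUnit_of_red_ne_zero {f : gaussSubring K} (h : red f ≠ 0) : IsUnit f := by
  obtain ⟨f, a, b, hb, rfl⟩ := f
  rw [red_eq hb rfl] at h
  have ha : a ∉ nonprimitive K := fun ha => h (by rw [polyRed_eq_zero_iff.mpr ha, zero_div])
  refine isUnit_iff_exists_inv.mpr ⟨⟨_, b, a, ha, rfl⟩, Subtype.ext ?_⟩
  change polyToFun K a / polyToFun K b * (polyToFun K b / polyToFun K a) = 1
  rw [div_mul_div_cancel₀ (polyToFun_ne_zero hb), div_self (polyToFun_ne_zero ha)]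

theorem red_eq_zero_iff {f : gaussSubring K} : red f = 0 ↔ ¬ IsUnit f :=
  ⟨fun h hu => (hu.map red).ne_zero h, fun h => by_contra fun h' => h (isUnit_of_red_ne_zero h')⟩

theorem inv_mem_gauss {f : gaussSubring K} (h : red f ≠ 0) :
    (f : FunctionField K)⁻¹ ∈ gaussSubring K := by
  obtain ⟨g, hg⟩ := isUnit_iff_exists_inv.mp (isUnit_of_red_ne_zero h)
  have : (f : FunctionField K) * (g : FunctionField K) = 1 := congrArg Subtype.val hg
  rw [inv_eq_of_mul_eq_one_right this]
  exact g.2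

theorem red_inv {f : gaussSubring K} (h : red f ≠ 0) :
    red ⟨(f : FunctionField K)⁻¹, inv_mem_gauss h⟩ = (red f)⁻¹ := by
  symm
  apply inv_eq_of_mul_eq_one_right
  rw [← map_mul, ← map_one red]
  congr 1
  apply Subtype.ext
  refine mul_inv_cancel₀ fun h0 => h ?_
  rw [Subtype.ext h0 (a2 := (0 : gaussSubring K)), map_zero]

theorem gauss_eq (ϖ : Uniformizer K) : (genericPoint ϖ 1).ring = gaussSubring K := by
  rw [genericPoint, one_smul]; rfl

theorem mem_component_one {x : Point ϖ} : x ∈ component ϖ 1 ↔ x.ring ≤ gaussSubring K := by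
  change x.ring ≤ (genericPoint ϖ 1).ring ↔ _
  rw [gauss_eq]

theorem red_eq_zero_iff_mem_maxAt (f : gaussSubring K) :
    red f = 0 ↔ (f : FunctionField K) ∈ maxAt (genericPoint ϖ 1) := by
  rw [red_eq_zero_iff, genericPoint, one_smul, mem_maxAt]
  exact ⟨fun h => ⟨f.2, h⟩, fun h => h.2⟩

theorem red_eq_iff_sub_mem_maxAt (f g : gaussSubring K) :
    red f = red g ↔ (f : FunctionField K) - g ∈ maxAt (genericPoint ϖ 1) := by
  rw [← sub_eq_zero, ← map_sub, red_eq_zero_iff_mem_maxAt (ϖ := ϖ)]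
  rfl

/-! ### Constants from `𝒪_K` -/

/-- The inclusion of `𝒪_K` in the ring of integers of `K̆`. -/
def intO (K : IntermediateField ℚ_[p] ℂ_[p]) : integers K →+* breveIntegers K :=
  ((toBreve K).comp (integers K).subtype).codRestrict _ toBreve_mem

/-- The elements of `𝒪_K` as constant rational functions. -/
def intC (K : IntermediateField ℚ_[p] ℂ_[p]) : integers K →+* FunctionField K :=
  RatFunc.C.comp ((breveIntegers K).subtype.comp (intO K))

/-- Reduction of `𝒪_K` modulo its maximal ideal, with values in the residue field of `𝒪`. -/
def resO (K : IntermediateField ℚ_[p] ℂ_[p]) : integers K →+* BreveResidue K :=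
  (IsLocalRing.residue (breveIntegers K)).comp (intO K)

theorem mem_integers_iff {a : K} : a ∈ integers K ↔ toBreve K a ∈ breveIntegers K := Iff.rfl

theorem intC_uniformizer : intC K ϖ.val = ϖ.const := rfl

theorem intC_mem (x : Point ϖ) (a : integers K) : intC K a ∈ x.ring := C_mem_ring x (intO K a).2

theorem isUnitAt_intC (x : Point ϖ) {a : integers K} (ha : IsUnit a) : IsUnitAt x (intC K a) :=
  isUnitAt_C x (ha.map (intO K))

theorem act_intC (g : G K) (a : integers K) : act g (intC K a) = intC K a := act_C g _

theorem isUnit_of_isUnit_intO {a : integers K} (h : IsUnit (intO K a)) : IsUnit a := by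
  obtain ⟨d, hd⟩ := isUnit_iff_exists_inv.mp h
  have h1 : toBreve K (a : K) * (d : Breve K) = 1 := congrArg Subtype.val hd
  have h0 : (a : K) ≠ 0 := fun h0 => by simp [h0] at h1
  have h2 : (a : K)⁻¹ ∈ integers K := by
    change ((toBreve K (a : K)⁻¹ : Breve K)) ∈ breveIntegers K
    rw [map_inv₀, inv_eq_of_mul_eq_one_right h1]
    exact d.2
  exact IsUnit.of_mul_eq_one ⟨_, h2⟩ (Subtype.ext (mul_inv_cancel₀ h0))

theorem resO_eq_zero_iff {a : integers K} : resO K a = 0 ↔ ¬ IsUnit a := by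
  rw [resO, RingHom.comp_apply, IsLocalRing.residue_eq_zero_iff, IsLocalRing.mem_maximalIdeal,
    mem_nonunits_iff]
  exact not_congr ⟨isUnit_of_isUnit_intO, fun h => h.map _⟩

theorem resO_ne_zero_iff {a : integers K} : resO K a ≠ 0 ↔ IsUnit a := by
  rw [Ne, resO_eq_zero_iff, not_not]

theorem intC_mem_maxAt_iff (x : Point ϖ) (a : integers K) :
    intC K a ∈ maxAt x ↔ resO K a = 0 := C_mem_maxAt_iff x (intO K a)

theorem resO_eq_iff {a b : integers K} : resO K a = resO K b ↔
    IsLocalRing.residue (integers K) a = IsLocalRing.residue (integers K) b := by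
  rw [← sub_eq_zero, ← map_sub, resO_eq_zero_iff, ← sub_eq_zero (a := IsLocalRing.residue _ a),
    ← map_sub, IsLocalRing.residue_eq_zero_iff, IsLocalRing.mem_maximalIdeal, mem_nonunits_iff]

theorem resO_pow_card [Finite (IsLocalRing.ResidueField (integers K))] {t : integers K}
    (ht : IsUnit t) : resO K t ^ (residueCard K - 1) = 1 := by
  have := Fintype.ofFinite (IsLocalRing.ResidueField (integers K))
  rw [← map_pow, ← map_one (resO K), resO_eq_iff, map_pow, map_one, residueCard,
    Nat.card_eq_fintype_card]
  exact FiniteField.pow_card_sub_one_eq_one _ (ht.map _).ne_zero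

theorem exists_eq_uniformizer_mul {a : integers K} (ha : ¬ IsUnit a) :
    ∃ b, a = ϖ.val * b := by
  rcases ValuationRing.dvd_total ϖ.val a with h | ⟨b, hb⟩
  · exact h
  · have hb' := (ϖ.irreducible.isUnit_or_isUnit hb).resolve_left ha
    obtain ⟨c, hc⟩ := isUnit_iff_exists_inv.mp hb'
    exact ⟨c, by rw [hb, mul_assoc, hc, mul_one]⟩

theorem exists_primitive_scaling {a c : K} (h : a ≠ 0 ∨ c ≠ 0) : ∃ r : K, r ≠ 0 ∧
    ∃ a' c' : integers K, (IsUnit a' ∨ IsUnit c') ∧ a = r * a' ∧ c = r * c' := by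
  by_cases ha : a = 0
  · have hc : c ≠ 0 := h.resolve_left (not_not.mpr ha)
    exact ⟨c, hc, 0, 1, Or.inr isUnit_one, by simp [ha], by simp⟩
  · rcases (integers K).mem_or_inv_mem (c / a) with h1 | h1
    · exact ⟨a, ha, 1, ⟨_, h1⟩, Or.inl isUnit_one, by simp, by field_simp⟩
    · rw [inv_div] at h1
      by_cases hc : c = 0
      · exact ⟨a, ha, 1, 0, Or.inl isUnit_one, by simp, by simp [hc]⟩
      · exact ⟨c, hc, ⟨_, h1⟩, 1, Or.inr isUnit_one, by field_simp, by simp⟩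

/-! ### Charts -/

/-- The algebra of the standard edge, with the rational function `w` in the place of `z`. -/
def chartAlgebra (ϖ : Uniformizer K) (w : FunctionField K) : Subring (FunctionField K) :=
  Subring.closure (RatFunc.C '' (breveIntegers K : Set (Breve K)) ∪
    {w, ϖ.const / w, (w ^ (residueCard K - 1) - 1)⁻¹,
      ((ϖ.const / w) ^ (residueCard K - 1) - 1)⁻¹})

theorem edgeAlgebra_map_act (g : G K) :
    (edgeAlgebra ϖ).map (act g) = chartAlgebra ϖ (act g RatFunc.X) := by
  rw [edgeAlgebra, RingHom.map_closure, chartAlgebra, Set.image_union, Set.image_insert_eq,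
    Set.image_insert_eq, Set.image_insert_eq, Set.image_singleton, ← Set.image_comp]
  have h1 : (act g : FunctionField K → FunctionField K) ∘ RatFunc.C = RatFunc.C :=
    funext fun c => act_C g c
  have h2 : act g ϖ.const = ϖ.const := act_C g _
  simp only [h1, map_inv₀, map_sub, map_pow, map_one, map_div₀, h2]

theorem mem_chartAlgebra_le {w : FunctionField K} {B : Subring (FunctionField K)}
    (hC : ∀ c ∈ breveIntegers K, RatFunc.C c ∈ B) (h1 : w ∈ B) (h2 : ϖ.const / w ∈ B)
    (h3 : (w ^ (residueCard K - 1) - 1)⁻¹ ∈ B)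
    (h4 : ((ϖ.const / w) ^ (residueCard K - 1) - 1)⁻¹ ∈ B) : chartAlgebra ϖ w ≤ B := by
  rw [chartAlgebra, Subring.closure_le]
  rintro f (⟨c, hc, rfl⟩ | rfl | rfl | rfl | rfl)
  exacts [hC c hc, h1, h2, h3, h4]

theorem self_mem_chartAlgebra (w : FunctionField K) : w ∈ chartAlgebra ϖ w :=
  Subring.subset_closure (by simp)

theorem const_div_mem_chartAlgebra (w : FunctionField K) : ϖ.const / w ∈ chartAlgebra ϖ w :=
  Subring.subset_closure (by simp)

theorem inv_mem_chartAlgebra (w : FunctionField K) :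
    (w ^ (residueCard K - 1) - 1)⁻¹ ∈ chartAlgebra ϖ w :=
  Subring.subset_closure (by simp)

theorem inv_mem_chartAlgebra' (w : FunctionField K) :
    ((ϖ.const / w) ^ (residueCard K - 1) - 1)⁻¹ ∈ chartAlgebra ϖ w :=
  Subring.subset_closure (by simp)

theorem chartAlgebra_const_div (w : FunctionField K) :
    chartAlgebra ϖ (ϖ.const / w) = chartAlgebra ϖ w := by
  have h : ϖ.const / (ϖ.const / w) = w := div_div_cancel₀ (const_ne_zero ϖ)
  rw [chartAlgebra, h, chartAlgebra]
  congr 2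
  ext f
  simp only [Set.mem_insert_iff, Set.mem_singleton_iff]
  tauto

/-- `w'` is obtained from `w` by a fractional linear transformation with coefficients in `𝒪_K`,
invertible over `𝒪_K`. -/
def Unimodular (w w' : FunctionField K) : Prop :=
  ∃ a b c d : integers K, IsUnit (a * d - b * c) ∧
    w' * (intC K b * w + intC K d) = intC K a * w + intC K c

theorem intC_ne_zero {a : integers K} (ha : IsUnit a) : intC K a ≠ 0 := (ha.map (intC K)).ne_zero

theorem unimodular_den_ne_zero {w w' : FunctionField K} {a b c d : integers K}
    (hu : IsUnit (a * d - b * c))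
    (h : w' * (intC K b * w + intC K d) = intC K a * w + intC K c) :
    intC K b * w + intC K d ≠ 0 := by
  intro h0
  apply intC_ne_zero hu
  rw [h0, mul_zero] at h
  simp only [map_sub, map_mul]
  linear_combination intC K a * h0 + intC K b * h

theorem Unimodular.refl (w : FunctionField K) : Unimodular w w :=
  ⟨1, 0, 0, 1, by simp, by simp⟩

theorem Unimodular.symm {w w' : FunctionField K} (h : Unimodular w w') : Unimodular w' w := by
  obtain ⟨a, b, c, d, hu, h⟩ := h
  refine ⟨d, -b, -c, a, by convert hu using 1; ring, ?_⟩
  simp only [map_neg]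
  linear_combination -h

theorem Unimodular.trans {w w' w'' : FunctionField K} (h : Unimodular w w')
    (h' : Unimodular w' w'') : Unimodular w w'' := by
  obtain ⟨a, b, c, d, hu, h⟩ := h
  obtain ⟨a', b', c', d', hu', h'⟩ := h'
  refine ⟨a' * a + c' * b, b' * a + d' * b, a' * c + c' * d, b' * c + d' * d,
    by convert hu.mul hu' using 1; ring, ?_⟩
  simp only [map_add, map_mul]
  linear_combination (intC K b * w + intC K d) * h' + (intC K a' - w'' * intC K b') * h

theorem isUnit_or_of_det {a b c d : integers K} (hu : IsUnit (a * d - b * c)) :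
    (IsUnit a ∨ IsUnit c) ∧ (IsUnit b ∨ IsUnit d) := by
  constructor <;>
  · by_contra! h
    rw [← resO_eq_zero_iff, ← resO_eq_zero_iff] at h
    rw [← resO_ne_zero_iff] at hu
    exact hu (by simp [h.1, h.2])

theorem isUnitAt_den_or_num {x : Point ϖ} {w : FunctionField K} (hw : w ∈ x.ring)
    {a b c d : integers K} (hu : IsUnit (a * d - b * c)) :
    IsUnitAt x (intC K b * w + intC K d) ∨ IsUnitAt x (intC K a * w + intC K c) := by
  have h1 := isUnitAt_or_mem (add_mem (mul_mem (intC_mem x b) hw) (intC_mem x d))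
  have h2 := isUnitAt_or_mem (add_mem (mul_mem (intC_mem x a) hw) (intC_mem x c))
  by_contra! h
  have h3 := h1.resolve_left h.1
  have h4 := h2.resolve_left h.2
  have h5 : intC K (a * d - b * c) ∈ maxAt x := by
    have := sub_mem (mul_mem_maxAt (intC_mem x a) h3) (mul_mem_maxAt (intC_mem x b) h4)
    convert this using 1
    simp only [map_sub, map_mul]
    ring
  exact (isUnitAt_intC x hu).notMem h5

/-- The linear polynomial `a z + c` over `𝒪`. -/
def linPoly (a c : integers K) : (breveIntegers K)[X] :=
  Polynomial.C (intO K a) * Polynomial.X + Polynomial.C (intO K c)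

theorem polyToFun_linPoly (a c : integers K) :
    polyToFun K (linPoly a c) = intC K a * RatFunc.X + intC K c := by
  simp only [linPoly, map_add, map_mul, polyToFun_C, polyToFun_X]
  rfl

theorem polyRed_linPoly (a c : integers K) :
    polyRed K (linPoly a c) = RatFunc.C (resO K a) * RatFunc.X + RatFunc.C (resO K c) := by
  simp only [linPoly, map_add, map_mul, polyRed_C, polyRed_X]
  rfl

theorem linPoly_notMem {a c : integers K} (h : IsUnit a ∨ IsUnit c) :
    linPoly a c ∉ nonprimitive K := by
  rw [← polyRed_eq_zero_iff, polyRed_linPoly]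
  apply lin_ne_zero
  simpa only [resO_ne_zero_iff] using h

/-- Let the numerator and the denominator of `w = (a z + c) / (b z + d)` be primitive. If the matrix
were not invertible over `𝒪_K`, then `w` would reduce to a constant in `𝔽_q^*`, and `w ^ (q - 1) - 1`
would reduce to `0`. -/
theorem isUnit_det_of_inv_mem_gauss [Finite (IsLocalRing.ResidueField (integers K))]
    {a b c d : integers K} (h : IsUnit a ∨ IsUnit c) (h' : IsUnit b ∨ IsUnit d)
    {w : FunctionField K}
    (hw : w = (intC K a * RatFunc.X + intC K c) / (intC K b * RatFunc.X + intC K d))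
    (h0 : w ^ (residueCard K - 1) - 1 ≠ 0)
    (hinv : (w ^ (residueCard K - 1) - 1)⁻¹ ∈ gaussSubring K) : IsUnit (a * d - b * c) := by
  rw [← polyToFun_linPoly, ← polyToFun_linPoly] at hw
  have hM := linPoly_notMem h'
  have hwg : w ∈ gaussSubring K := ⟨_, _, hM, hw⟩
  have hred : red ⟨w, hwg⟩ = (RatFunc.C (resO K a) * RatFunc.X + RatFunc.C (resO K c)) /
      (RatFunc.C (resO K b) * RatFunc.X + RatFunc.C (resO K d)) := by
    rw [red_eq hM hw, polyRed_linPoly, polyRed_linPoly]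
  by_contra hdet
  rw [← resO_eq_zero_iff] at hdet
  simp only [map_sub, map_mul] at hdet
  -- the reductions of numerator and denominator are proportional over `𝔽_q`
  have key : ∃ t : integers K, IsUnit t ∧ resO K a = resO K t * resO K b ∧
      resO K c = resO K t * resO K d := by
    simp only [← resO_ne_zero_iff] at h h' ⊢
    rcases h' with hb | hd
    · obtain ⟨b', hb'⟩ := isUnit_iff_exists_inv.mp (resO_ne_zero_iff.mp hb)
      have hb'' : resO K b * resO K b' = 1 := by rw [← map_mul, hb', map_one]
      refine ⟨a * b', ?_, ?_, ?_⟩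
      · rw [map_mul]
        refine mul_ne_zero (fun ha => ?_) (right_ne_zero_of_mul_eq_one hb'')
        simp only [ha, zero_mul, zero_sub, neg_eq_zero, mul_eq_zero, hb, false_or] at hdet
        exact h.elim (fun h => h ha) (fun h => h hdet)
      · rw [map_mul]; linear_combination (-resO K a) * hb''
      · rw [map_mul]; linear_combination (-resO K c) * hb'' - resO K b' * hdet
    · obtain ⟨d', hd'⟩ := isUnit_iff_exists_inv.mp (resO_ne_zero_iff.mp hd)
      have hd'' : resO K d * resO K d' = 1 := by rw [← map_mul, hd', map_one]
      refine ⟨c * d', ?_, ?_, ?_⟩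
      · rw [map_mul]
        refine mul_ne_zero (fun hc => ?_) (right_ne_zero_of_mul_eq_one hd'')
        simp only [hc, mul_zero, sub_zero, mul_eq_zero, hd, or_false] at hdet
        exact h.elim (fun h => h hdet) (fun h => h hc)
      · rw [map_mul]; linear_combination (-resO K a) * hd'' + resO K d' * hdet
      · rw [map_mul]; linear_combination (-resO K c) * hd''
  obtain ⟨t, ht, h1, h2⟩ := key
  have hred' : red ⟨w, hwg⟩ = RatFunc.C (resO K t) := by
    have hne := polyRed_eq_zero_iff.not.mpr hM
    rw [polyRed_linPoly] at hne
    rw [hred, div_eq_iff hne, h1, h2]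
    simp only [map_mul]
    ring
  have h3 : (⟨w, hwg⟩ ^ (residueCard K - 1) - 1 : gaussSubring K) * ⟨_, hinv⟩ = 1 :=
    Subtype.ext (mul_inv_cancel₀ h0)
  have h4 := congrArg red h3
  rw [map_mul, map_sub, map_pow, hred', ← map_pow, resO_pow_card ht, map_one, map_one, sub_self,
    zero_mul] at h4
  exact zero_ne_one h4

theorem act_X_eq (g : G K) : act g RatFunc.X =
    (RatFunc.C (toBreve K (g.1 0 0)) * RatFunc.X + RatFunc.C (toBreve K (g.1 1 0))) /
      (RatFunc.C (toBreve K (g.1 0 1)) * RatFunc.X + RatFunc.C (toBreve K (g.1 1 1))) :=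
  moebiusHom_X _

theorem transcendental_act_X (g : G K) : Transcendental (Breve K) (act g RatFunc.X) := by
  change Transcendental (Breve K) (moebiusHom _ RatFunc.X)
  rw [moebiusHom_X]
  exact transcendental_moebiusFun _

theorem pow_sub_one_ne_zero {w : FunctionField K} (hw : Transcendental (Breve K) w) {n : ℕ}
    (hn : n ≠ 0) : w ^ n - 1 ≠ 0 := by
  intro h
  apply hw
  refine IsAlgebraic.of_pow (Nat.pos_of_ne_zero hn) ?_
  rw [sub_eq_zero.mp h]
  exact isAlgebraic_one

theorem residueCard_sub_one_ne_zero [Finite (IsLocalRing.ResidueField (integers K))] :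
    residueCard K - 1 ≠ 0 := by
  have := Finite.one_lt_card (α := IsLocalRing.ResidueField (integers K))
  change Nat.card _ - 1 ≠ 0
  omega

theorem transcendental_const_div {w : FunctionField K} (hw : Transcendental (Breve K) w) :
    Transcendental (Breve K) (ϖ.const / w) := by
  intro h
  apply hw
  have : w = ϖ.const * (ϖ.const / w)⁻¹ := by
    rw [inv_div, mul_div_cancel₀ _ (const_ne_zero ϖ)]
  rw [this]
  exact (isAlgebraic_algebraMap (A := FunctionField K) (toBreve K (ϖ.val : K))).mul h.inv

theorem integers_of_C_mem_gauss {a : K} (h : RatFunc.C (toBreve K a) ∈ gaussSubring K)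
    (ϖ : Uniformizer K) : a ∈ integers K :=
  have h1 : toBreve K a ∈ breveIntegers K := (standardGenericPoint ϖ).special _ h
  mem_integers_iff.mpr h1

/-- Every point of `ℙ_{s₁}` lies in a chart whose coordinate is unimodular over `z`. The coordinate
`w₀` of a chart around the point is a constant `ρ` times a quotient of primitive linear polynomials.
As `w₀` and `ϖ / w₀` are regular along `ℙ_{s₁}`, both `ρ` and `ϖ / ρ` are integral, so that one of
them is a unit; correspondingly `w₀` or `ϖ / w₀` is the required coordinate. -/
theorem exists_unimodular_chart [Finite (IsLocalRing.ResidueField (integers K))] {x : Point ϖ}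
    (hx : x ∈ component ϖ 1) :
    ∃ w, Unimodular RatFunc.X w ∧ IsLocalizationOf (chartAlgebra ϖ w) x.localRing := by
  rw [mem_component_one] at hx
  obtain ⟨g, hg⟩ := x.exists_chart
  rw [edgeAlgebra_map_act] at hg
  have hX := act_X_eq g
  have htr := transcendental_act_X g
  generalize act g RatFunc.X = w₀ at *
  have hdet := det_ne_zero g
  obtain ⟨r, hr, a, c, hac, ha, hc⟩ := exists_primitive_scaling (a := g.1 0 0) (c := g.1 1 0)
    (by by_contra! h; exact hdet (by rw [h.1, h.2]; ring))
  obtain ⟨s, hs, b, d, hbd, hb, hd⟩ := exists_primitive_scaling (a := g.1 0 1) (c := g.1 1 1)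
    (by by_contra! h; exact hdet (by rw [h.1, h.2]; ring))
  set N := intC K a * RatFunc.X + intC K c with hN
  set M := intC K b * RatFunc.X + intC K d with hM
  have hN0 : N ≠ 0 := by
    rw [hN, ← polyToFun_linPoly]; exact polyToFun_ne_zero (linPoly_notMem hac)
  have hM0 : M ≠ 0 := by
    rw [hM, ← polyToFun_linPoly]; exact polyToFun_ne_zero (linPoly_notMem hbd)
  have hNM : N / M ∈ gaussSubring K :=
    ⟨linPoly a c, _, linPoly_notMem hbd, by rw [polyToFun_linPoly, polyToFun_linPoly, ← hN, ← hM]⟩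
  have hMN : M / N ∈ gaussSubring K :=
    ⟨linPoly b d, _, linPoly_notMem hac, by rw [polyToFun_linPoly, polyToFun_linPoly, ← hN, ← hM]⟩
  have hr0 : (RatFunc.C (toBreve K r) : FunctionField K) ≠ 0 := by
    rw [Ne, map_eq_zero, map_eq_zero]; exact hr
  have hs0 : (RatFunc.C (toBreve K s) : FunctionField K) ≠ 0 := by
    rw [Ne, map_eq_zero, map_eq_zero]; exact hs
  have hw₀ : w₀ = RatFunc.C (toBreve K (r / s)) * (N / M) := by
    rw [hX, ha, hb, hc, hd, map_div₀, map_div₀, div_mul_div_comm]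
    simp only [map_mul]
    congr 1 <;> rw [mul_add, ← mul_assoc] <;> rfl
  have hrs : r / s ∈ integers K := by
    refine integers_of_C_mem_gauss ?_ ϖ
    have := mul_mem (hx (hg.1 (self_mem_chartAlgebra w₀))) hMN
    rw [hw₀, mul_assoc, div_mul_div_cancel₀ hM0, div_self hN0, mul_one] at this
    exact this
  have hrs' : (ϖ.val : K) / (r / s) ∈ integers K := by
    refine integers_of_C_mem_gauss ?_ ϖ
    have := mul_mem (hx (hg.1 (const_div_mem_chartAlgebra w₀))) hNM
    rw [hw₀, ← div_div, div_mul_cancel₀ _ (div_ne_zero hN0 hM0)] at this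
    rw [map_div₀, map_div₀]
    exact this
  have hrs0 : r / s ≠ 0 := div_ne_zero hr hs
  have hfac : ϖ.val = ⟨_, hrs⟩ * ⟨_, hrs'⟩ :=
    Subtype.ext (mul_div_cancel₀ _ hrs0).symm
  -- `ρ = r / s`
  rcases ϖ.irreducible.isUnit_or_isUnit hfac with hu | hu
  · have hw : w₀ = (intC K (⟨_, hrs⟩ * a) * RatFunc.X + intC K (⟨_, hrs⟩ * c)) / M := by
      rw [hw₀, map_mul, map_mul, mul_assoc, ← mul_add, ← hN, mul_div_assoc]
      rfl
    refine ⟨w₀, ⟨⟨_, hrs⟩ * a, b, ⟨_, hrs⟩ * c, d, ?_, ?_⟩, hg⟩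
    · refine isUnit_det_of_inv_mem_gauss ?_ hbd hw
        (pow_sub_one_ne_zero htr residueCard_sub_one_ne_zero)
        (hx (hg.1 (inv_mem_chartAlgebra w₀)))
      exact hac.imp hu.mul hu.mul
    · rw [hw, ← hM, div_mul_cancel₀ _ hM0]
  · have hw : ϖ.const / w₀ = (intC K (⟨_, hrs'⟩ * b) * RatFunc.X + intC K (⟨_, hrs'⟩ * d)) / N := by
      have h1 : ϖ.const = RatFunc.C (toBreve K (r / s)) * intC K ⟨_, hrs'⟩ := by
        exact (congrArg (intC K) hfac).trans (map_mul _ _ _)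
      have h2 : (RatFunc.C (toBreve K (r / s)) : FunctionField K) ≠ 0 := by
        rw [Ne, map_eq_zero, map_eq_zero]; exact hrs0
      rw [hw₀, map_mul, map_mul, mul_assoc, ← mul_add, ← hM, h1]
      field_simp
    refine ⟨ϖ.const / w₀, ⟨⟨_, hrs'⟩ * b, a, ⟨_, hrs'⟩ * d, c, ?_, ?_⟩, ?_⟩
    · refine isUnit_det_of_inv_mem_gauss ?_ hac hw
        (pow_sub_one_ne_zero (transcendental_const_div htr) residueCard_sub_one_ne_zero)
        (hx (hg.1 (inv_mem_chartAlgebra' w₀)))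
      exact hbd.imp hu.mul hu.mul
    · rw [hw, ← hN, div_mul_cancel₀ _ hN0]
    · rw [chartAlgebra_const_div]; exact hg

/-! ### The reduction of a point of the standard component -/

section

/-- The image in `κ(z)`, the function field of `ℙ_{s₁}`, of the local ring at `x`. For a point `x` of
`ℙ_{s₁}` this is the local ring of `ℙ_{s₁}` at `x`. -/
def redRing (x : Point ϖ) : Subring (RatFunc (BreveResidue K)) :=
  (x.ring.comap (gaussSubring K).subtype).map red

/-- The elements of the Gauss valuation ring with reduction in `R`. -/
def gaussPreimage (R : Subring (RatFunc (BreveResidue K))) : Subring (FunctionField K) :=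
  (R.comap red).map (gaussSubring K).subtype

theorem mem_redRing {x : Point ϖ} {r : RatFunc (BreveResidue K)} :
    r ∈ redRing x ↔ ∃ f : gaussSubring K, (f : FunctionField K) ∈ x.ring ∧ red f = r := Iff.rfl

theorem mem_gaussPreimage {R : Subring (RatFunc (BreveResidue K))} {f : FunctionField K} :
    f ∈ gaussPreimage R ↔ ∃ hf : f ∈ gaussSubring K, red ⟨f, hf⟩ ∈ R := by
  constructor
  · rintro ⟨a, ha, rfl⟩
    exact ⟨a.2, ha⟩
  · rintro ⟨hf, h⟩
    exact ⟨⟨f, hf⟩, h, rfl⟩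

theorem inv_mem_gaussPreimage {R : Subring (RatFunc (BreveResidue K))} {f : gaussSubring K}
    (h0 : red f ≠ 0) (h : (red f)⁻¹ ∈ R) : (f : FunctionField K)⁻¹ ∈ gaussPreimage R :=
  mem_gaussPreimage.mpr ⟨inv_mem_gauss h0, by rwa [red_inv h0]⟩

theorem le_gaussPreimage {x : Point ϖ} (hx : x ∈ component ϖ 1) :
    x.ring ≤ gaussPreimage (redRing x) := fun f hf =>
  mem_gaussPreimage.mpr ⟨mem_component_one.mp hx hf, ⟨f, _⟩, hf, rfl⟩

theorem red_ne_zero_of_isUnitAt {x : Point ϖ} (hx : x ∈ component ϖ 1) {f : gaussSubring K}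
    (h : IsUnitAt x f) : red f ≠ 0 := by
  rw [Ne, red_eq_zero_iff_mem_maxAt (ϖ := ϖ)]
  exact (h.of_le hx).notMem

theorem isUnitAt_of_red {x : Point ϖ} (hx : x ∈ component ϖ 1) {f : gaussSubring K}
    (hf : (f : FunctionField K) ∈ x.ring) (h0 : red f ≠ 0) (h : (red f)⁻¹ ∈ redRing x) :
    IsUnitAt x f := by
  obtain ⟨g, hg, hfg⟩ := mem_redRing.mp h
  have h1 : red (f * g) = red 1 := by rw [map_mul, hfg, mul_inv_cancel₀ h0, map_one]
  rw [red_eq_iff_sub_mem_maxAt (ϖ := ϖ)] at h1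
  have hfgx : (f * g : FunctionField K) ∈ x.ring := mul_mem hf hg
  have h2 := (isUnitAt_one x).add_maxAt (maxAt_of_le hx (sub_mem hfgx (one_mem _)) h1)
  have h3 : IsUnitAt x (f * g : FunctionField K) := by
    convert h2 using 1
    ring
  refine ⟨hf, ?_, left_ne_zero_of_mul h3.ne_zero⟩
  have := mul_mem hg h3.inv_mem
  rwa [mul_inv, mul_left_comm, mul_inv_cancel₀ (right_ne_zero_of_mul h3.ne_zero), mul_one] at this

theorem isUnitAt_of_inv_mem_gaussPreimage {x : Point ϖ} (hx : x ∈ component ϖ 1)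
    {f : FunctionField K} (hf : f ∈ x.ring) (h0 : f ≠ 0)
    (h : f⁻¹ ∈ gaussPreimage (redRing x)) : IsUnitAt x f := by
  obtain ⟨hg, hr⟩ := mem_gaussPreimage.mp h
  have hfg := mem_component_one.mp hx hf
  have h1 : red ⟨f, hfg⟩ * red ⟨f⁻¹, hg⟩ = 1 := by
    rw [← map_mul, ← map_one red]
    exact congrArg red (Subtype.ext (mul_inv_cancel₀ h0))
  refine isUnitAt_of_red hx (f := ⟨f, hfg⟩) hf (left_ne_zero_of_mul_eq_one h1) ?_
  rwa [inv_eq_of_mul_eq_one_right h1]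

theorem exists_unit_lift {x : Point ϖ} (hx : x ∈ component ϖ 1) {r : RatFunc (BreveResidue K)}
    (hr : r ∈ redRing x) (hr' : r⁻¹ ∈ redRing x) (h0 : r ≠ 0) :
    ∃ f : gaussSubring K, IsUnitAt x f ∧ red f = r := by
  obtain ⟨f, hf, rfl⟩ := hr
  exact ⟨f, isUnitAt_of_red hx hf h0 hr', rfl⟩

theorem isUnitAt_red {x : Point ϖ} (hx : x ∈ component ϖ 1) {f : gaussSubring K}
    (h : IsUnitAt x f) : red f ∈ redRing x ∧ (red f)⁻¹ ∈ redRing x := by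
  have h0 := red_ne_zero_of_isUnitAt hx h
  exact ⟨⟨f, h.mem, rfl⟩, by rw [← red_inv h0]; exact ⟨_, h.inv_mem, rfl⟩⟩

theorem C_mem_redRing (x : Point ϖ) (c : BreveResidue K) : RatFunc.C c ∈ redRing x := by
  obtain ⟨c, rfl⟩ := IsLocalRing.residue_surjective c
  refine ⟨⟨_, polyToFun_mem_gauss (Polynomial.C c)⟩, ?_, ?_⟩
  · change polyToFun K (Polynomial.C c) ∈ x.ring
    rw [polyToFun_C]
    exact C_mem_ring x c.2
  · rw [red_polyToFun, polyRed_C]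

theorem X_mem_gauss : (RatFunc.X : FunctionField K) ∈ gaussSubring K :=
  polyToFun_X (K := K) ▸ polyToFun_mem_gauss Polynomial.X

theorem red_X : red ⟨RatFunc.X, X_mem_gauss (K := K)⟩ = RatFunc.X := by
  rw [← polyRed_X, ← red_polyToFun]
  congr 2
  exact polyToFun_X.symm

theorem intC_mem_gauss (a : integers K) : intC K a ∈ gaussSubring K :=
  polyToFun_C (intO K a) ▸ polyToFun_mem_gauss (Polynomial.C (intO K a))

theorem red_intC (a : integers K) : red ⟨intC K a, intC_mem_gauss a⟩ = RatFunc.C (resO K a) := by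
  change _ = RatFunc.C (IsLocalRing.residue _ (intO K a))
  rw [← polyRed_C, ← red_polyToFun]
  congr 2
  exact (polyToFun_C (intO K a)).symm

theorem C_mem_gauss {c : Breve K} (hc : c ∈ breveIntegers K) : RatFunc.C c ∈ gaussSubring K :=
  polyToFun_C ⟨c, hc⟩ ▸ polyToFun_mem_gauss (Polynomial.C ⟨c, hc⟩)

theorem red_C (c : breveIntegers K) :
    red ⟨RatFunc.C (c : Breve K), C_mem_gauss c.2⟩ = RatFunc.C (IsLocalRing.residue _ c) := by
  rw [← polyRed_C, ← red_polyToFun]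
  congr 2
  exact (polyToFun_C c).symm

theorem X_inv_mem_gauss : (RatFunc.X : FunctionField K)⁻¹ ∈ gaussSubring K :=
  inv_mem_gauss (f := ⟨RatFunc.X, X_mem_gauss⟩) (by rw [red_X]; exact RatFunc.X_ne_zero)

/-! ### Unimodular coordinates -/

theorem Unimodular.mem_gauss {w : FunctionField K} (h : Unimodular RatFunc.X w) :
    w ∈ gaussSubring K ∧ w⁻¹ ∈ gaussSubring K ∧ w ≠ 0 := by
  obtain ⟨a, b, c, d, hu, h⟩ := h
  have h1 := unimodular_den_ne_zero hu h
  obtain ⟨hac, hbd⟩ := isUnit_or_of_det hu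
  rw [← eq_div_iff h1, ← polyToFun_linPoly, ← polyToFun_linPoly] at h
  have hN := linPoly_notMem hac
  have hM := linPoly_notMem hbd
  refine ⟨⟨_, _, hM, h⟩, ⟨_, _, hN, by rw [h, inv_div]⟩, ?_⟩
  rw [h]
  exact div_ne_zero (polyToFun_ne_zero hN) (polyToFun_ne_zero hM)

theorem transcendental_X : Transcendental (Breve K) (RatFunc.X : FunctionField K) := by
  have := transcendental_act_X (K := K) 1
  rwa [act_one] at this

theorem Unimodular.transcendental {w : FunctionField K} (h : Unimodular RatFunc.X w) :
    Transcendental (Breve K) w := by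
  intro hw
  obtain ⟨a, b, c, d, hu, h⟩ := h.symm
  have hc : ∀ a, IsAlgebraic (Breve K) (intC K a) := fun a =>
    isAlgebraic_algebraMap (A := FunctionField K) (intO K a : Breve K)
  have h1 := unimodular_den_ne_zero hu h
  apply transcendental_X (K := K)
  rw [← eq_div_iff h1] at h
  rw [h, div_eq_mul_inv]
  exact (((hc a).mul hw).add (hc c)).mul (((hc b).mul hw).add (hc d)).inv

theorem const_div_mem_maxAt {x : Point ϖ} (hx : x ∈ component ϖ 1) {w : FunctionField K}
    (h : Unimodular RatFunc.X w) (hw : ϖ.const / w ∈ x.ring) : ϖ.const / w ∈ maxAt x := by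
  obtain ⟨-, h1, h2⟩ := h.mem_gauss
  refine mem_maxAt_of_inv_notMem hw fun h3 => ?_
  rw [inv_div] at h3
  apply const_inv_notMem (standardGenericPoint ϖ)
  have := mul_mem (mem_component_one.mp hx h3) h1
  rwa [div_eq_mul_inv, mul_comm w, mul_assoc, mul_inv_cancel₀ h2, mul_one] at this

theorem pow_mem_maxAt {x : Point ϖ} {f : FunctionField K} (hf : f ∈ maxAt x) {n : ℕ}
    (hn : n ≠ 0) : f ^ n ∈ maxAt x := by
  obtain ⟨m, rfl⟩ := Nat.exists_eq_succ_of_ne_zero hn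
  rw [pow_succ]
  exact mul_mem_maxAt (pow_mem (maxAt_le hf) m) hf

theorem isUnitAt_pow_sub_one {x : Point ϖ} {f : FunctionField K} (hf : f ∈ maxAt x) {n : ℕ}
    (hn : n ≠ 0) : IsUnitAt x (f ^ n - 1) := by
  have := (isUnitAt_one x).neg.add_maxAt (pow_mem_maxAt hf hn)
  rwa [neg_add_eq_sub] at this

theorem pow_sub_pow_mem_maxAt {x : Point ϖ} {f g : FunctionField K} (hf : f ∈ x.ring)
    (hg : g ∈ x.ring) (h : f - g ∈ maxAt x) (n : ℕ) : f ^ n - g ^ n ∈ maxAt x := by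
  rw [← residue_eq_iff (pow_mem hf n) (pow_mem hg n)]
  rw [← residue_eq_iff hf hg] at h
  exact (map_pow (IsLocalRing.residue x.ring) ⟨f, hf⟩ n).trans
    ((congrArg (· ^ n) h).trans (map_pow (IsLocalRing.residue x.ring) ⟨g, hg⟩ n).symm)

variable [Finite (IsLocalRing.ResidueField (integers K))]

/-- If a unimodular chart contains the point `x` of `ℙ_{s₁}` after reduction, then it contains `x`.
What has to be excluded is that `w` takes a value in `𝔽_q^*` at `x`; there `w ^ (q - 1) - 1` would not
be invertible. -/
theorem chartAlgebra_le_of_unimodular {x : Point ϖ} (hx : x ∈ component ϖ 1)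
    {w w' : FunctionField K} (hXw : Unimodular RatFunc.X w) (hXw' : Unimodular RatFunc.X w')
    (hw : chartAlgebra ϖ w ≤ x.ring) (hw' : chartAlgebra ϖ w' ≤ gaussPreimage (redRing x)) :
    chartAlgebra ϖ w' ≤ x.ring := by
  obtain ⟨a, b, c, d, hu, h⟩ := hXw.symm.trans hXw'
  have hn := residueCard_sub_one_ne_zero (K := K)
  have hwx : w ∈ x.ring := hw (self_mem_chartAlgebra w)
  have hle := le_gaussPreimage hx
  have hD : IsUnitAt x (intC K b * w + intC K d) := by
    refine (isUnitAt_den_or_num hwx hu).elim id fun hN => ?_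
    refine isUnitAt_of_inv_mem_gaussPreimage hx
      (add_mem (mul_mem (intC_mem x b) hwx) (intC_mem x d)) (unimodular_den_ne_zero hu h) ?_
    have h1 := mul_mem (hw' (self_mem_chartAlgebra w')) (hle hN.inv_mem)
    have h2 : w' ≠ 0 := hXw'.mem_gauss.2.2
    rwa [← h, mul_inv, ← mul_assoc, mul_inv_cancel₀ h2, one_mul] at h1
  have hw'x : w' ∈ x.ring := by
    have : w' = (intC K a * w + intC K c) * (intC K b * w + intC K d)⁻¹ := by
      rw [← h, mul_assoc, mul_inv_cancel₀ hD.ne_zero, mul_one]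
    rw [this]
    exact mul_mem (add_mem (mul_mem (intC_mem x a) hwx) (intC_mem x c)) hD.inv_mem
  have hcd : ϖ.const / w' ∈ x.ring := by
    rcases isUnitAt_or_mem hw'x with hu' | hm
    · rw [div_eq_mul_inv]
      exact mul_mem (maxAt_le (const_mem_maxAt x)) hu'.inv_mem
    have hN : intC K a * w + intC K c ∈ maxAt x := h ▸ mul_mem_maxAt' hm hD.mem
    have ha : IsUnit a := by
      by_contra ha
      have h1 : intC K a * w ∈ maxAt x :=
        mul_mem_maxAt' ((intC_mem_maxAt_iff x a).mpr (resO_eq_zero_iff.mpr ha)) hwx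
      have h2 : intC K c ∈ maxAt x := by simpa using sub_mem hN h1
      exact (isUnit_or_of_det hu).1.elim ha fun hc => (isUnitAt_intC x hc).notMem h2
    have hc : ¬ IsUnit c := by
      -- otherwise `w` takes a value in `𝔽_q^*` at `x`
      intro hc
      obtain ⟨a', ha'⟩ := isUnit_iff_exists_inv.mp ha
      have haa : intC K a * intC K a' = 1 := by rw [← map_mul, ha', map_one]
      have ht : IsUnit (-(c * a')) := (hc.mul (IsUnit.of_mul_eq_one_right a ha')).neg
      have h1 : w - intC K (-(c * a')) ∈ maxAt x := by
        have := mul_mem_maxAt (intC_mem x a') hN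
        convert this using 1
        rw [map_neg, map_mul]
        linear_combination (-w) * haa
      have h2 := pow_sub_pow_mem_maxAt hwx (intC_mem x _) h1 (residueCard K - 1)
      have h3 : intC K (-(c * a')) ^ (residueCard K - 1) - 1 ∈ maxAt x := by
        rw [← map_pow, ← map_one (intC K), ← map_sub, intC_mem_maxAt_iff, map_sub, map_pow,
          resO_pow_card ht, map_one, sub_self]
      have h4 : w ^ (residueCard K - 1) - 1 ∈ maxAt x := by simpa using add_mem h2 h3
      exact IsUnitAt.notMem ⟨maxAt_le h4, hw (inv_mem_chartAlgebra w),
        pow_sub_one_ne_zero hXw.transcendental hn⟩ h4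
    obtain ⟨e, rfl⟩ := exists_eq_uniformizer_mul (ϖ := ϖ) hc
    have hw0 : w ≠ 0 := hXw.mem_gauss.2.2
    have hE : IsUnitAt x (intC K a + intC K e * (ϖ.const / w)) :=
      (isUnitAt_intC x ha).add_maxAt (mul_mem_maxAt (intC_mem x e)
        (const_div_mem_maxAt hx hXw (hw (const_div_mem_chartAlgebra w))))
    have hfac : intC K a * w + intC K (ϖ.val * e) =
        w * (intC K a + intC K e * (ϖ.const / w)) := by
      rw [map_mul, intC_uniformizer]
      field_simp
    have : ϖ.const / w' = (ϖ.const / w) * (intC K b * w + intC K d) *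
        (intC K a + intC K e * (ϖ.const / w))⁻¹ := by
      rw [hfac] at h
      have hE0 := hE.ne_zero
      have hD0 := hD.ne_zero
      rw [← div_eq_mul_inv, eq_div_iff hE0, div_mul_eq_mul_div, div_mul_eq_mul_div,
        div_eq_div_iff hXw'.mem_gauss.2.2 hw0]
      linear_combination (-ϖ.const) * h
    rw [this]
    exact mul_mem (mul_mem (hw (const_div_mem_chartAlgebra w)) hD.mem) hE.inv_mem
  refine mem_chartAlgebra_le (fun c hc => C_mem_ring x hc) hw'x hcd ?_ ?_
  · refine (isUnitAt_of_inv_mem_gaussPreimage hx (sub_mem (pow_mem hw'x _) (one_mem _))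
      (pow_sub_one_ne_zero hXw'.transcendental hn) (hw' (inv_mem_chartAlgebra w'))).inv_mem
  · exact (isUnitAt_pow_sub_one (const_div_mem_maxAt hx hXw' hcd) hn).inv_mem

theorem ring_le_of_redRing_eq {x y : Point ϖ} (hx : x ∈ component ϖ 1) (hy : y ∈ component ϖ 1)
    (h : redRing x = redRing y) : y.ring ≤ x.ring := by
  obtain ⟨w, hXw, hw⟩ := exists_unimodular_chart hx
  obtain ⟨w', hXw', hw'⟩ := exists_unimodular_chart hy
  have hyx : y.ring ≤ gaussPreimage (redRing x) := h ▸ le_gaussPreimage hy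
  have key := chartAlgebra_le_of_unimodular hx hXw hXw' hw.1 (hw'.1.trans hyx)
  intro f hf
  obtain ⟨a, ha, s, hs, hs0, hsy, rfl⟩ := hw'.2 f hf
  exact mul_mem (key ha) (isUnitAt_of_inv_mem_gaussPreimage hx (key hs) hs0 (hyx hsy)).inv_mem

/-- The model is separated: a point of `ℙ_{s₁}` is determined by its local ring in `ℙ_{s₁}`. -/
theorem eq_of_redRing_eq {x y : Point ϖ} (hx : x ∈ component ϖ 1) (hy : y ∈ component ϖ 1)
    (h : redRing x = redRing y) : x = y :=
  Point.ext (LocalSubring.toSubring_injective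
    (le_antisymm (ring_le_of_redRing_eq hy hx h.symm) (ring_le_of_redRing_eq hx hy h)))

theorem X_mem_or_inv_mem {x : Point ϖ} (hx : x ∈ component ϖ 1) :
    RatFunc.X ∈ x.ring ∨ RatFunc.X⁻¹ ∈ x.ring := by
  obtain ⟨w, hXw, hw⟩ := exists_unimodular_chart hx
  obtain ⟨a, b, c, d, hu, h⟩ := hXw.symm
  have hwx : w ∈ x.ring := hw.1 (self_mem_chartAlgebra w)
  have hD0 := unimodular_den_ne_zero hu h
  rw [← eq_div_iff hD0] at h
  rcases isUnitAt_den_or_num hwx hu with hD | hN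
  · left
    rw [h, div_eq_mul_inv]
    exact mul_mem (add_mem (mul_mem (intC_mem x a) hwx) (intC_mem x c)) hD.inv_mem
  · right
    rw [h, inv_div, div_eq_mul_inv]
    exact mul_mem (add_mem (mul_mem (intC_mem x b) hwx) (intC_mem x d)) hN.inv_mem

theorem X_mem_redRing_iff {x : Point ϖ} (hx : x ∈ component ϖ 1) :
    RatFunc.X ∈ redRing x ↔ RatFunc.X ∈ x.ring := by
  constructor
  · intro h
    refine (X_mem_or_inv_mem hx).elim id fun h1 => ?_
    have h0 : red ⟨RatFunc.X, X_mem_gauss (K := K)⟩ ≠ 0 := by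
      rw [red_X]; exact RatFunc.X_ne_zero
    have h2 : red ⟨_, X_inv_mem_gauss (K := K)⟩ = RatFunc.X⁻¹ := by
      rw [← red_X (K := K), ← red_inv h0]
    have := (isUnitAt_of_red hx (f := ⟨_, X_inv_mem_gauss⟩) h1 (by
      rw [h2]; exact inv_ne_zero RatFunc.X_ne_zero) (by rwa [h2, inv_inv])).inv_mem
    simpa using this
  · intro h
    exact ⟨⟨_, X_mem_gauss⟩, h, red_X⟩

end

/-! ### Construction of points -/

section

/-- The localization of a subring `A` of a ring `R` at the elements invertible in `R`. It is local
because `R` is, which is what `hR` says. -/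
theorem exists_isLocalizationOf {F : Type} [Field F] {A R : Subring F} (hAR : A ≤ R)
    (hR : ∀ f ∈ R, (f ≠ 0 ∧ f⁻¹ ∈ R) ∨ (1 - f ≠ 0 ∧ (1 - f)⁻¹ ∈ R)) :
    ∃ B : LocalSubring F, IsLocalizationOf A B ∧ B.toSubring ≤ R ∧
      ∀ f ∈ B.toSubring, f ≠ 0 → f⁻¹ ∈ R → f⁻¹ ∈ B.toSubring := by
  let B : Subring F :=
    { carrier := {f | ∃ a ∈ A, ∃ s ∈ A, s ≠ 0 ∧ s⁻¹ ∈ R ∧ f = a * s⁻¹}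
      zero_mem' := ⟨0, zero_mem _, 1, one_mem _, one_ne_zero, by simp [one_mem], by simp⟩
      one_mem' := ⟨1, one_mem _, 1, one_mem _, one_ne_zero, by simp [one_mem], by simp⟩
      add_mem' := by
        rintro _ _ ⟨a, ha, s, hs, hs0, hsR, rfl⟩ ⟨b, hb, t, ht, ht0, htR, rfl⟩
        refine ⟨a * t + b * s, add_mem (mul_mem ha ht) (mul_mem hb hs), s * t, mul_mem hs ht,
          mul_ne_zero hs0 ht0, by rw [mul_inv]; exact mul_mem hsR htR, ?_⟩
        field_simp
      mul_mem' := by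
        rintro _ _ ⟨a, ha, s, hs, hs0, hsR, rfl⟩ ⟨b, hb, t, ht, ht0, htR, rfl⟩
        refine ⟨a * b, mul_mem ha hb, s * t, mul_mem hs ht,
          mul_ne_zero hs0 ht0, by rw [mul_inv]; exact mul_mem hsR htR, ?_⟩
        field_simp
      neg_mem' := by
        rintro _ ⟨a, ha, s, hs, hs0, hsR, rfl⟩
        exact ⟨-a, neg_mem ha, s, hs, hs0, hsR, by ring⟩ }
  have hBR : B ≤ R := by
    rintro _ ⟨a, ha, s, -, -, hsR, rfl⟩
    exact mul_mem (hAR ha) hsR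
  have hinv : ∀ f ∈ B, f ≠ 0 → f⁻¹ ∈ R → f⁻¹ ∈ B := by
    rintro _ ⟨a, ha, s, hs, hs0, hsR, rfl⟩ h0 h
    have ha0 : a ≠ 0 := left_ne_zero_of_mul h0
    refine ⟨s, hs, a, ha, ha0, ?_, by rw [mul_inv, inv_inv, mul_comm]⟩
    have := mul_mem hsR h
    rwa [mul_inv, inv_inv, mul_left_comm, inv_mul_cancel₀ hs0, mul_one] at this
  have hAB : A ≤ B := fun a ha => ⟨a, ha, 1, one_mem _, one_ne_zero, by simp [one_mem], by simp⟩
  have hloc : IsLocalRing B := by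
    refine IsLocalRing.of_isUnit_or_isUnit_one_sub_self ?_
    rintro ⟨f, hf⟩
    rcases hR f (hBR hf) with ⟨h0, h⟩ | ⟨h0, h⟩
    · exact Or.inl (IsUnit.of_mul_eq_one ⟨_, hinv f hf h0 h⟩ (Subtype.ext (mul_inv_cancel₀ h0)))
    · exact Or.inr (IsUnit.of_mul_eq_one ⟨_, hinv _ (sub_mem (one_mem _) hf) h0 h⟩
        (Subtype.ext (mul_inv_cancel₀ h0)))
  refine ⟨⟨B⟩, ⟨hAB, ?_⟩, hBR, hinv⟩
  rintro _ ⟨a, ha, s, hs, hs0, hsR, rfl⟩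
  exact ⟨a, ha, s, hs, hs0, hinv s (hAB hs) hs0 hsR, rfl⟩

/-- The preimage of a valuation ring under reduction is local. -/
theorem gaussPreimage_local (V : ValuationSubring (RatFunc (BreveResidue K)))
    {f : FunctionField K} (hf : f ∈ gaussPreimage V.toSubring) :
    (f ≠ 0 ∧ f⁻¹ ∈ gaussPreimage V.toSubring) ∨
      (1 - f ≠ 0 ∧ (1 - f)⁻¹ ∈ gaussPreimage V.toSubring) := by
  have key : ∀ (g : FunctionField K) (hg : g ∈ gaussSubring K) (hV : red ⟨g, hg⟩ ∈ V),
      IsUnit (⟨_, hV⟩ : V) → g ≠ 0 ∧ g⁻¹ ∈ gaussPreimage V.toSubring := by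
    intro g hg hV hu
    obtain ⟨v, hv⟩ := isUnit_iff_exists_inv.mp hu
    have h1 : red ⟨g, hg⟩ * (v : RatFunc (BreveResidue K)) = 1 := congrArg Subtype.val hv
    have h0 := left_ne_zero_of_mul_eq_one h1
    refine ⟨?_, inv_mem_gaussPreimage h0 (by rw [inv_eq_of_mul_eq_one_right h1]; exact v.2)⟩
    rintro rfl
    exact h0 (map_zero red)
  obtain ⟨hg, hV⟩ := mem_gaussPreimage.mp hf
  rcases IsLocalRing.isUnit_or_isUnit_one_sub_self (⟨_, hV⟩ : V) with h | h
  · exact Or.inl (key f hg hV h)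
  · refine Or.inr (key _ (sub_mem (one_mem _) hg) ?_ ?_)
    · have : red (1 - ⟨f, hg⟩) ∈ V := by
        rw [map_sub, map_one]; exact sub_mem (one_mem V) hV
      exact this
    · convert h using 2
      exact (map_sub red 1 ⟨f, hg⟩).trans (by rw [map_one])

theorem special_of_le_gauss {B : Subring (FunctionField K)} (h : B ≤ gaussSubring K)
    (ϖ : Uniformizer K) (c : Breve K) (hc : RatFunc.C c ∈ B) : c ∈ breveIntegers K :=
  (standardGenericPoint ϖ).special c (h hc)

theorem gaussPreimage_le (R : Subring (RatFunc (BreveResidue K))) :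
    gaussPreimage R ≤ gaussSubring K := fun _ hf => (mem_gaussPreimage.mp hf).1

/-- The centre of the valuation ring `V` of the function field of `ℙ_{s₁}` in the chart with
coordinate `g z`. -/
theorem exists_point_of_chart_le (V : ValuationSubring (RatFunc (BreveResidue K))) (g : G K)
    (h : chartAlgebra ϖ (act g RatFunc.X) ≤ gaussPreimage V.toSubring) :
    ∃ x : Point ϖ, x ∈ component ϖ 1 ∧ redRing x ≤ V.toSubring := by
  obtain ⟨B, hB, hBR, -⟩ := exists_isLocalizationOf h fun f hf => gaussPreimage_local V hf
  refine ⟨⟨B, ⟨g, by rwa [edgeAlgebra_map_act]⟩,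
    special_of_le_gauss (hBR.trans (gaussPreimage_le _)) ϖ⟩,
    mem_component_one.mpr (hBR.trans (gaussPreimage_le _)), ?_⟩
  intro r hr
  obtain ⟨f, hf, rfl⟩ := mem_redRing.mp hr
  exact (mem_gaussPreimage.mp (hBR hf)).2

/-- The matrix `(0 1; 1 0)`, which acts by `z ↦ 1 / z`. -/
def weyl (K : IntermediateField ℚ_[p] ℂ_[p]) : G K :=
  Matrix.GeneralLinearGroup.mkOfDetNeZero !![0, 1; 1, 0] (by simp [Matrix.det_fin_two])

/-- The matrix `(1 0; c 1)`, which acts by `z ↦ z + c`. -/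
def lower (c : K) : G K :=
  Matrix.GeneralLinearGroup.mkOfDetNeZero !![1, 0; c, 1] (by simp [Matrix.det_fin_two])

theorem act_weyl_X : act (weyl K) RatFunc.X = RatFunc.X⁻¹ := by
  rw [act_X_eq]
  simp [weyl, Matrix.GeneralLinearGroup.mkOfDetNeZero]

theorem act_lower_X (c : integers K) : act (lower (c : K)) RatFunc.X = RatFunc.X + intC K c := by
  rw [act_X_eq]
  simp [lower, Matrix.GeneralLinearGroup.mkOfDetNeZero]
  rfl

theorem red_const_div {w : FunctionField K} (h : w⁻¹ ∈ gaussSubring K) :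
    ∃ h' : ϖ.const / w ∈ gaussSubring K, red ⟨ϖ.const / w, h'⟩ = 0 := by
  have h1 : ϖ.const ∈ gaussSubring K := intC_mem_gauss ϖ.val
  refine ⟨by rw [div_eq_mul_inv]; exact mul_mem h1 h, ?_⟩
  have h2 : red ⟨ϖ.const, h1⟩ = 0 := by
    have := red_intC ϖ.val
    rw [resO_eq_zero_iff.mpr ϖ.irreducible.not_isUnit, map_zero] at this
    exact this
  have h3 : red ((⟨ϖ.const, h1⟩ : gaussSubring K) * ⟨w⁻¹, h⟩) = 0 := by rw [map_mul, h2, zero_mul]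
  rw [← h3]
  congr 1
  exact Subtype.ext (div_eq_mul_inv _ _)

theorem C_mem_gaussPreimage {R : Subring (RatFunc (BreveResidue K))}
    (hR : ∀ c, RatFunc.C c ∈ R) {c : Breve K} (hc : c ∈ breveIntegers K) :
    RatFunc.C c ∈ gaussPreimage R :=
  mem_gaussPreimage.mpr ⟨C_mem_gauss hc, by rw [red_C ⟨c, hc⟩]; exact hR _⟩

variable [Finite (IsLocalRing.ResidueField (integers K))]

theorem chartAlgebra_le_gaussPreimage {R : Subring (RatFunc (BreveResidue K))}
    (hR : ∀ c, RatFunc.C c ∈ R) {w : FunctionField K} (hXw : Unimodular RatFunc.X w)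
    (h1 : red ⟨w, hXw.mem_gauss.1⟩ ∈ R)
    (h2 : red ⟨w, hXw.mem_gauss.1⟩ ^ (residueCard K - 1) - 1 ≠ 0)
    (h3 : (red ⟨w, hXw.mem_gauss.1⟩ ^ (residueCard K - 1) - 1)⁻¹ ∈ R) :
    chartAlgebra ϖ w ≤ gaussPreimage R := by
  have hn := residueCard_sub_one_ne_zero (K := K)
  obtain ⟨h4, h5⟩ := red_const_div (ϖ := ϖ) hXw.mem_gauss.2.1
  refine mem_chartAlgebra_le (fun c hc => C_mem_gaussPreimage hR hc)
    (mem_gaussPreimage.mpr ⟨_, h1⟩) (mem_gaussPreimage.mpr ⟨h4, by rw [h5]; exact zero_mem R⟩)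
    ?_ ?_
  · have h6 : red (⟨w, hXw.mem_gauss.1⟩ ^ (residueCard K - 1) - 1) =
        red ⟨w, hXw.mem_gauss.1⟩ ^ (residueCard K - 1) - 1 := by
      rw [map_sub, map_pow, map_one]
    rw [← h6] at h2 h3
    exact inv_mem_gaussPreimage h2 h3
  · have h6 : red (⟨_, h4⟩ ^ (residueCard K - 1) - 1) = -1 := by
      rw [map_sub, map_pow, map_one, h5, zero_pow hn, zero_sub]
    refine inv_mem_gaussPreimage (f := ⟨_, h4⟩ ^ (residueCard K - 1) - 1) ?_ ?_
    · rw [h6]; exact neg_ne_zero.mpr one_ne_zero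
    · rw [h6, inv_eq_of_mul_eq_one_right (by norm_num : (-1 : RatFunc (BreveResidue K)) * -1 = 1)]
      exact neg_mem (one_mem R)

instance : IsLocalHom (resO K) := ⟨fun _ h => resO_ne_zero_iff.mp h.ne_zero⟩

/-- A place at which `z` is regular and `z ^ (q - 1) - 1` is not invertible is centred at an element
of `𝔽_q`, because `z ^ q - z` is the product of the `z - a`, `a ∈ 𝔽_q`. -/
theorem exists_X_sub_mem_maximalIdeal {V : ValuationSubring (RatFunc (BreveResidue K))}
    (hV : ∀ c, RatFunc.C c ∈ V) (hX : RatFunc.X ∈ V)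
    (h : (RatFunc.X ^ (residueCard K - 1) - 1)⁻¹ ∉ V) :
    ∃ a : integers K, RatFunc.X - RatFunc.C (resO K a) ∈ V.nonunits := by
  have := Fintype.ofFinite (IsLocalRing.ResidueField (integers K))
  let i : IsLocalRing.ResidueField (integers K) →+* BreveResidue K :=
    IsLocalRing.ResidueField.lift (resO K)
  have hcard : residueCard K = Fintype.card (IsLocalRing.ResidueField (integers K)) :=
    Nat.card_eq_fintype_card
  have hq : 1 < Fintype.card (IsLocalRing.ResidueField (integers K)) := Fintype.one_lt_card
  have hprod : (∏ a : IsLocalRing.ResidueField (integers K), (Polynomial.X - Polynomial.C a)) =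
      Polynomial.X ^ residueCard K - Polynomial.X := by
    rw [hcard]
    have := Polynomial.prod_multiset_X_sub_C_of_monic_of_roots_card_eq
      (p := (Polynomial.X ^ Fintype.card (IsLocalRing.ResidueField (integers K)) -
        Polynomial.X : (IsLocalRing.ResidueField (integers K))[X]))
      (Polynomial.monic_X_pow_sub (by rw [Polynomial.degree_X]; exact_mod_cast hq))
      (by rw [FiniteField.roots_X_pow_card_sub_X, FiniteField.X_pow_card_sub_X_natDegree_eq _ hq]
          rfl)
    rw [FiniteField.roots_X_pow_card_sub_X] at this
    exact this
  have hprod' := congrArg (Polynomial.eval₂ (RatFunc.C.comp i) RatFunc.X) hprod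
  rw [Polynomial.eval₂_finsetProd, Polynomial.eval₂_sub, Polynomial.eval₂_X_pow,
    Polynomial.eval₂_X] at hprod'
  simp only [Polynomial.eval₂_sub, Polynomial.eval₂_X, Polynomial.eval₂_C] at hprod'
  have hm : (∏ a : IsLocalRing.ResidueField (integers K),
      (⟨RatFunc.X - RatFunc.C (i a), sub_mem hX (hV _)⟩ : V)) ∈ IsLocalRing.maximalIdeal V := by
    rw [← ValuationSubring.coe_mem_nonunits_iff, ← ValuationSubring.subtype_apply, map_prod]
    change (∏ a, (RatFunc.X - RatFunc.C (i a))) ∈ _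
    have h1 : (RatFunc.X ^ (residueCard K - 1) - 1 : RatFunc (BreveResidue K)) ∈ V.nonunits :=
      (ValuationSubring.mem_nonunits_iff_or (A := V)).mpr (Or.inr h)
    have h2 := Ideal.mul_mem_left (IsLocalRing.maximalIdeal V) ⟨RatFunc.X, hX⟩
      (ValuationSubring.coe_mem_nonunits_iff (a := ⟨_, V.nonunits_le h1⟩).mp h1)
    rw [← ValuationSubring.coe_mem_nonunits_iff] at h2
    convert h2 using 1
    change _ = RatFunc.X * (RatFunc.X ^ (residueCard K - 1) - 1)
    refine hprod'.trans ?_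
    rw [mul_sub, ← pow_succ', mul_one, Nat.sub_add_cancel (by omega)]
  obtain ⟨a, -, ha⟩ := (Ideal.IsPrime.prod_mem_iff (hp := inferInstance)).mp hm
  obtain ⟨a, rfl⟩ := IsLocalRing.residue_surjective a
  refine ⟨a, ?_⟩
  rw [← ValuationSubring.coe_mem_nonunits_iff] at ha
  exact ha

theorem pow_sub_one_of_mem_nonunits {F : Type} [Field F] {V : ValuationSubring F} {r : F}
    (h : r ∈ V.nonunits) {n : ℕ} (hn : n ≠ 0) : r ^ n - 1 ≠ 0 ∧ (r ^ n - 1)⁻¹ ∈ V := by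
  have h1 : V.valuation (r ^ n - 1) = 1 := by
    rw [Valuation.map_sub_eq_of_lt_right, map_one]
    rw [map_one, map_pow]
    exact pow_lt_one₀ zero_le ((ValuationSubring.mem_nonunits_iff (A := V)).mp h) hn
  refine ⟨fun h0 => by simp [h0] at h1, ?_⟩
  rw [← V.valuation_le_one_iff, map_inv₀, h1, inv_one]

/-- `ℙ_{s₁}` is proper: every valuation ring of its function field has a centre on it. The chart to
use has the coordinate `z`, `z - a` or `1 / z`. -/
theorem exists_redRing_le (ϖ : Uniformizer K) (V : ValuationSubring (RatFunc (BreveResidue K)))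
    (hV : ∀ c, RatFunc.C c ∈ V) : ∃ x : Point ϖ, x ∈ component ϖ 1 ∧ redRing x ≤ V.toSubring := by
  have hn := residueCard_sub_one_ne_zero (K := K)
  by_cases hX : RatFunc.X ∈ V
  · by_cases h : (RatFunc.X ^ (residueCard K - 1) - 1)⁻¹ ∈ V
    · refine exists_point_of_chart_le V 1 ?_
      rw [act_one, RingHom.id_apply]
      refine chartAlgebra_le_gaussPreimage hV (Unimodular.refl _) ?_ ?_ ?_
      · rwa [red_X]
      · rw [red_X]
        intro h0
        have h1 : Transcendental (BreveResidue K) (RatFunc.X : RatFunc (BreveResidue K)) :=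
          RatFunc.transcendental_X
        refine h1 (IsAlgebraic.of_pow (Nat.pos_of_ne_zero hn) ?_)
        rw [sub_eq_zero.mp h0]
        exact isAlgebraic_one
      · rwa [red_X]
    · obtain ⟨a, ha⟩ := exists_X_sub_mem_maximalIdeal hV hX h
      have hu : Unimodular (RatFunc.X : FunctionField K) (RatFunc.X + intC K (-a)) :=
        ⟨1, 0, -a, 1, by simp, by simp⟩
      have hr : red ⟨_, hu.mem_gauss.1⟩ = RatFunc.X - RatFunc.C (resO K a) := by
        rw [← red_X (K := K), ← red_intC, ← map_sub]
        congr 1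
        apply Subtype.ext
        change RatFunc.X + intC K (-a) = RatFunc.X - intC K a
        rw [map_neg, sub_eq_add_neg]
      refine exists_point_of_chart_le V (lower ((-a : integers K) : K)) ?_
      rw [act_lower_X]
      obtain ⟨h1, h2⟩ := pow_sub_one_of_mem_nonunits ha hn
      exact chartAlgebra_le_gaussPreimage hV hu (by rw [hr]; exact V.nonunits_le ha)
        (by rwa [hr]) (by rwa [hr])
  · have hu : Unimodular (RatFunc.X : FunctionField K) RatFunc.X⁻¹ :=
      ⟨0, 1, 1, 0, by simp, by simp [RatFunc.X_ne_zero]⟩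
    have h0 : red ⟨RatFunc.X, X_mem_gauss (K := K)⟩ ≠ 0 := by
      rw [red_X]; exact RatFunc.X_ne_zero
    have hr : red ⟨_, hu.mem_gauss.1⟩ = RatFunc.X⁻¹ := by rw [← red_X (K := K), ← red_inv h0]
    have ha : (RatFunc.X : RatFunc (BreveResidue K))⁻¹ ∈ V.nonunits :=
      (ValuationSubring.mem_nonunits_iff_or (A := V)).mpr (Or.inr (by rwa [inv_inv]))
    refine exists_point_of_chart_le V (weyl K) ?_
    rw [act_weyl_X]
    obtain ⟨h1, h2⟩ := pow_sub_one_of_mem_nonunits ha hn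
    exact chartAlgebra_le_gaussPreimage hV hu (by rw [hr]; exact V.nonunits_le ha)
      (by rwa [hr]) (by rwa [hr])

/-- Global functions on `ℙ_{s₁}` are constant. -/
theorem exists_eq_C_of_forall_mem_redRing (ϖ : Uniformizer K) {r : RatFunc (BreveResidue K)}
    (h : ∀ x : Point ϖ, x ∈ component ϖ 1 → r ∈ redRing x) : ∃ c, r = RatFunc.C c := by
  by_contra hr
  apply RatFunc.transcendental_of_ne_C r hr
  have h1 : r ∈ (⨅ V : {V : ValuationSubring (RatFunc (BreveResidue K)) //
      Set.range RatFunc.C ⊆ (V.toSubring : Set (RatFunc (BreveResidue K)))}, V.1.toSubring) := by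
    rw [Subring.mem_iInf]
    rintro ⟨V, hV⟩
    obtain ⟨x, hx, hxV⟩ := exists_redRing_le ϖ V fun c => hV ⟨c, rfl⟩
    exact hxV (h x hx)
  rw [iInf_valuationSubring_superset] at h1
  have h2 : IsIntegral (Subring.closure
    (Set.range (RatFunc.C : BreveResidue K →+* RatFunc (BreveResidue K)))) r := h1
  let φ : BreveResidue K →+* Subring.closure
      (Set.range (RatFunc.C : BreveResidue K →+* RatFunc (BreveResidue K))) :=
    RatFunc.C.codRestrict _ fun c => Subring.subset_closure ⟨c, rfl⟩
  have hφ : Function.Surjective φ := by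
    rintro ⟨y, hy⟩
    rw [← RingHom.coe_range, Subring.closure_eq] at hy
    obtain ⟨c, rfl⟩ := hy
    exact ⟨c, rfl⟩
  obtain ⟨P, hP, hPr⟩ := h2
  obtain ⟨Q, hQ, -, hQm⟩ := Polynomial.lifts_and_degree_eq_and_monic
    ((Polynomial.mem_lifts P).mpr (Polynomial.map_surjective φ hφ P)) hP
  refine ⟨Q, hQm.ne_zero, ?_⟩
  rw [← hQ, Polynomial.eval₂_map] at hPr
  exact hPr

end

/-! ### Divisors on the projective line -/

section ProjectiveLine

variable {k : Type} [Field k]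

/-- `r` is a unit of the subring `R` of a field. -/
structure IsUnitIn {E : Type} [Field E] (R : Subring E) (r : E) : Prop where
  mem : r ∈ R
  inv_mem : r⁻¹ ∈ R
  ne_zero : r ≠ 0

section

variable {E : Type} [Field E] {R : Subring E} {r s : E}

theorem IsUnitIn.mul (hr : IsUnitIn R r) (hs : IsUnitIn R s) : IsUnitIn R (r * s) :=
  ⟨mul_mem hr.mem hs.mem, mul_inv r s ▸ mul_mem hr.inv_mem hs.inv_mem,
    mul_ne_zero hr.ne_zero hs.ne_zero⟩

theorem IsUnitIn.inv (hr : IsUnitIn R r) : IsUnitIn R r⁻¹ :=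
  ⟨hr.inv_mem, (inv_inv r).symm ▸ hr.mem, inv_ne_zero hr.ne_zero⟩

theorem isUnitIn_one : IsUnitIn R 1 := ⟨one_mem _, by simp [one_mem], one_ne_zero⟩

theorem IsUnitIn.pow (hr : IsUnitIn R r) (n : ℕ) : IsUnitIn R (r ^ n) :=
  ⟨pow_mem hr.mem n, inv_pow r n ▸ pow_mem hr.inv_mem n, pow_ne_zero n hr.ne_zero⟩

theorem IsUnitIn.zpow (hr : IsUnitIn R r) (n : ℤ) : IsUnitIn R (r ^ n) := by
  cases n with
  | ofNat m => simpa using hr.pow m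
  | negSucc m => rw [zpow_negSucc]; exact (hr.pow _).inv

theorem IsUnitIn.of_mul (hr : r ∈ R) (hs : s ∈ R) (h : IsUnitIn R (r * s)) : IsUnitIn R r := by
  have hs0 := right_ne_zero_of_mul h.ne_zero
  refine ⟨hr, ?_, left_ne_zero_of_mul h.ne_zero⟩
  have := mul_mem hs h.inv_mem
  rwa [mul_inv, mul_left_comm, mul_inv_cancel₀ hs0, mul_one] at this

end

/-- A local subring of the field `k(X)` containing `k`. -/
structure IsPlaceRing (R : Subring (RatFunc k)) : Prop where
  C_mem : ∀ c, RatFunc.C c ∈ R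
  isLocal : ∀ r ∈ R, ∀ s ∈ R, r + s = 1 → IsUnitIn R r ∨ IsUnitIn R s

variable {R : Subring (RatFunc k)}

theorem IsPlaceRing.eval₂_mem (hR : IsPlaceRing R) {y : RatFunc k} (hy : y ∈ R) (a : k[X]) :
    Polynomial.eval₂ RatFunc.C y a ∈ R := by
  rw [Polynomial.eval₂_eq_sum]
  exact sum_mem fun i _ => mul_mem (hR.C_mem _) (pow_mem hy _)

theorem eval₂_X_eq (a : k[X]) :
    Polynomial.eval₂ RatFunc.C RatFunc.X a = algebraMap k[X] (RatFunc k) a := by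
  have : Polynomial.eval₂RingHom (RatFunc.C (K := k)) RatFunc.X =
      algebraMap k[X] (RatFunc k) := by
    apply Polynomial.ringHom_ext
    · intro c; simp [RatFunc.algebraMap_C]
    · simp [RatFunc.algebraMap_X]
  exact congrArg (fun f => f a) this

theorem IsPlaceRing.poly_mem (hR : IsPlaceRing R) (hX : RatFunc.X ∈ R) (a : k[X]) :
    algebraMap k[X] (RatFunc k) a ∈ R := eval₂_X_eq a ▸ hR.eval₂_mem hX a

theorem isUnitIn_of_not_dvd (hR : IsPlaceRing R) (hX : RatFunc.X ∈ R) {P a : k[X]}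
    (hP : Irreducible P) (hPR : ¬ IsUnitIn R (algebraMap k[X] (RatFunc k) P)) (ha : ¬ P ∣ a) :
    IsUnitIn R (algebraMap k[X] (RatFunc k) a) := by
  obtain ⟨u, v, huv⟩ := (hP.coprime_iff_not_dvd.mpr ha)
  have h := congrArg (algebraMap k[X] (RatFunc k)) huv
  rw [map_add, map_one, map_mul, map_mul] at h
  have hm := hR.poly_mem hX
  rcases hR.isLocal _ (mul_mem (hm u) (hm P)) _ (mul_mem (hm v) (hm a)) h with h1 | h1
  · rw [mul_comm] at h1
    exact absurd (h1.of_mul (hm P) (hm u)) hPR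
  · rw [mul_comm] at h1
    exact h1.of_mul (hm a) (hm v)

/-- The order of `r` along `P` serves for all the places on the affine line at which `P` vanishes. -/
theorem exists_zpow_mul_isUnitIn {P : k[X]} (hP : Irreducible P) {r : RatFunc k} (hr : r ≠ 0) :
    ∃ n : ℤ, ∀ R : Subring (RatFunc k), IsPlaceRing R → RatFunc.X ∈ R →
      ¬ IsUnitIn R (algebraMap k[X] (RatFunc k) P) →
      IsUnitIn R (r * algebraMap k[X] (RatFunc k) P ^ (-n)) := by
  induction r using RatFunc.induction_on with
  | f a b hb =>
    have ha : a ≠ 0 := by rintro rfl; simp at hr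
    obtain ⟨m, a', ha', rfl⟩ := WfDvdMonoid.max_power_factor ha hP
    obtain ⟨l, b', hb', rfl⟩ := WfDvdMonoid.max_power_factor hb hP
    refine ⟨m - l, fun R hR hX hPR => ?_⟩
    convert (isUnitIn_of_not_dvd hR hX hP hPR ha').mul
      (isUnitIn_of_not_dvd hR hX hP hPR hb').inv using 1
    have hP0 : algebraMap k[X] (RatFunc k) P ≠ 0 := by
      rw [Ne, map_eq_zero_iff _ (RatFunc.algebraMap_injective k)]
      exact hP.ne_zero
    rw [map_mul, map_mul, map_pow, map_pow, neg_sub, zpow_sub₀ hP0, zpow_natCast, zpow_natCast]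
    field_simp

/-- The order of `r` at infinity, with the uniformizer `1 / X`. -/
theorem exists_zpow_mul_isUnitIn_infinity {r : RatFunc k} (hr : r ≠ 0) :
    ∃ n : ℤ, ∀ R : Subring (RatFunc k), IsPlaceRing R → RatFunc.X⁻¹ ∈ R → RatFunc.X ∉ R →
      IsUnitIn R (r * RatFunc.X⁻¹ ^ (-n)) := by
  have hX0 : (RatFunc.X : RatFunc k) ≠ 0 := RatFunc.X_ne_zero
  have key : ∀ a : k[X], a ≠ 0 → ∀ R : Subring (RatFunc k), IsPlaceRing R → RatFunc.X⁻¹ ∈ R →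
      RatFunc.X ∉ R →
      IsUnitIn R (algebraMap k[X] (RatFunc k) a * RatFunc.X⁻¹ ^ a.natDegree) := by
    intro a ha R hR hX hX'
    have hrev : algebraMap k[X] (RatFunc k) a * RatFunc.X⁻¹ ^ a.natDegree =
        Polynomial.eval₂ RatFunc.C RatFunc.X⁻¹ a.reverse := by
      let := invertibleOfNonzero hX0
      have := Polynomial.eval₂_reverse_mul_pow RatFunc.C (RatFunc.X : RatFunc k) a
      rw [invOf_eq_inv, eval₂_X_eq] at this
      rw [← this, mul_assoc, ← mul_pow, mul_inv_cancel₀ hX0, one_pow, mul_one]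
    have hlc : a.leadingCoeff ≠ 0 := Polynomial.leadingCoeff_ne_zero.mpr ha
    have hC : RatFunc.C a.leadingCoeff⁻¹ * RatFunc.C a.leadingCoeff = (1 : RatFunc k) := by
      rw [← map_mul, inv_mul_cancel₀ hlc, map_one]
    -- the reversed polynomial takes the value `a.leadingCoeff ≠ 0` at infinity
    have hsplit : Polynomial.eval₂ RatFunc.C RatFunc.X⁻¹ a.reverse =
        Polynomial.eval₂ RatFunc.C RatFunc.X⁻¹ a.reverse.divX * RatFunc.X⁻¹ +
          RatFunc.C a.leadingCoeff := by
      conv_lhs => rw [← Polynomial.divX_mul_X_add a.reverse]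
      simp [Polynomial.coeff_zero_reverse]
    rw [hrev]
    set e := Polynomial.eval₂ RatFunc.C (RatFunc.X : RatFunc k)⁻¹ a.reverse
    set d := Polynomial.eval₂ RatFunc.C (RatFunc.X : RatFunc k)⁻¹ a.reverse.divX
    have he : e ∈ R := hR.eval₂_mem hX _
    have hd : d ∈ R := hR.eval₂_mem hX _
    rcases hR.isLocal (e * RatFunc.C a.leadingCoeff⁻¹) (mul_mem he (hR.C_mem _))
      (RatFunc.X⁻¹ * (-(d * RatFunc.C a.leadingCoeff⁻¹)))
      (mul_mem hX (neg_mem (mul_mem hd (hR.C_mem _))))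
      (by rw [hsplit]; linear_combination hC) with h | h
    · exact h.of_mul he (hR.C_mem _)
    · have := (h.of_mul hX (neg_mem (mul_mem hd (hR.C_mem _)))).inv_mem
      rw [inv_inv] at this
      exact absurd this hX'
  induction r using RatFunc.induction_on with
  | f a b hb =>
    have ha : a ≠ 0 := by rintro rfl; simp at hr
    refine ⟨b.natDegree - a.natDegree, fun R hR hX hX' => ?_⟩
    convert (key a ha R hR hX hX').mul (key b hb R hR hX hX').inv using 1
    have hb0 : algebraMap k[X] (RatFunc k) b ≠ 0 := by
      rwa [Ne, map_eq_zero_iff _ (RatFunc.algebraMap_injective k)]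
    rw [neg_sub, zpow_sub₀ (inv_ne_zero hX0), zpow_natCast, zpow_natCast]
    field_simp

/-- A local ring in which every element is a unit times a power of the nonunit `π`, by exponents that
do not depend on the ring, is determined by `π`. -/
theorem le_of_common_uniformizer {E : Type} [Field E] {R R' : Subring E} {π : E}
    (hπ : π ∈ R) (hπ' : π⁻¹ ∉ R) (hπR' : π ∈ R')
    (h : ∀ r ≠ 0, ∃ n : ℤ, IsUnitIn R (r * π ^ (-n)) ∧ IsUnitIn R' (r * π ^ (-n))) : R ≤ R' := by
  have hπ0 : π ≠ 0 := by rintro rfl; simp [zero_mem] at hπ'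
  intro r hr
  by_cases hr0 : r = 0
  · rw [hr0]; exact zero_mem _
  obtain ⟨n, h1, h2⟩ := h r hr0
  rcases le_or_gt 0 n with hn | hn
  · lift n to ℕ using hn
    have := mul_mem h2.mem (pow_mem hπR' n)
    rwa [zpow_neg, zpow_natCast, inv_mul_cancel_right₀ (pow_ne_zero n hπ0)] at this
  · exfalso
    apply hπ'
    obtain ⟨m, hm⟩ := Int.eq_ofNat_of_zero_le (show 0 ≤ -n - 1 by omega)
    obtain rfl : n = -(m + 1 : ℤ) := by omega
    have h3 := mul_mem hr h1.inv_mem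
    rw [mul_inv, ← mul_assoc, mul_inv_cancel₀ hr0, one_mul, neg_neg] at h3
    have h4 := mul_mem (pow_mem hπ m) h3
    convert h4 using 1
    rw [← zpow_natCast, ← zpow_neg, ← zpow_add₀ hπ0, ← zpow_neg_one]
    congr 1
    ring

theorem le_of_not_isUnitIn {R R' : Subring (RatFunc k)} (hR : IsPlaceRing R)
    (hR' : IsPlaceRing R') (hX : RatFunc.X ∈ R) (hX' : RatFunc.X ∈ R') {P : k[X]}
    (hP : Irreducible P) (hPR : ¬ IsUnitIn R (algebraMap k[X] (RatFunc k) P))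
    (hPR' : ¬ IsUnitIn R' (algebraMap k[X] (RatFunc k) P)) : R ≤ R' := by
  have hP0 : algebraMap k[X] (RatFunc k) P ≠ 0 := by
    rw [Ne, map_eq_zero_iff _ (RatFunc.algebraMap_injective k)]
    exact hP.ne_zero
  refine le_of_common_uniformizer (hR.poly_mem hX P)
    (fun h => hPR ⟨hR.poly_mem hX P, h, hP0⟩) (hR'.poly_mem hX' P) fun r hr => ?_
  obtain ⟨n, hn⟩ := exists_zpow_mul_isUnitIn hP hr
  exact ⟨n, hn R hR hX hPR, hn R' hR' hX' hPR'⟩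

theorem le_of_X_notMem {R R' : Subring (RatFunc k)} (hR : IsPlaceRing R)
    (hR' : IsPlaceRing R') (hX : RatFunc.X⁻¹ ∈ R) (hX' : RatFunc.X⁻¹ ∈ R')
    (h : RatFunc.X ∉ R) (h' : RatFunc.X ∉ R') : R ≤ R' := by
  refine le_of_common_uniformizer hX (by rwa [inv_inv]) hX' fun r hr => ?_
  obtain ⟨n, hn⟩ := exists_zpow_mul_isUnitIn_infinity hr
  exact ⟨n, hn R hR hX h, hn R' hR' hX' h'⟩

variable {ι : Type} {S : ι → Subring (RatFunc k)}

/-- A Cartier divisor on the affine line, given at each point by a local equation `γ i`, trivial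
where the polynomial `b` is invertible, is principal. The prime factors of `b` are removed one by
one. -/
theorem exists_mul_isUnitIn_affine (hS : ∀ i, IsPlaceRing (S i)) (hinj : Function.Injective S)
    {b : k[X]} (hb0 : b ≠ 0) (γ : ι → RatFunc k) (hγ : ∀ i, γ i ≠ 0)
    (hb : ∀ i, RatFunc.X ∈ S i → IsUnitIn (S i) (algebraMap k[X] (RatFunc k) b) →
      IsUnitIn (S i) (γ i)) :
    ∃ h : RatFunc k, h ≠ 0 ∧ ∀ i, RatFunc.X ∈ S i → IsUnitIn (S i) (h * γ i) := by
  induction b using WfDvdMonoid.induction_on_irreducible generalizing γ with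
  | zero => exact absurd rfl hb0
  | unit u hu =>
    refine ⟨1, one_ne_zero, fun i hX => ?_⟩
    rw [one_mul]
    obtain ⟨v, hv⟩ := isUnit_iff_exists_inv.mp hu
    refine hb i hX (IsUnitIn.of_mul ((hS i).poly_mem hX u) ((hS i).poly_mem hX v) ?_)
    rw [← map_mul, hv, map_one]
    exact isUnitIn_one
  | mul b P hb0' hP ih =>
    by_cases hex : ∃ i, RatFunc.X ∈ S i ∧ ¬ IsUnitIn (S i) (algebraMap k[X] (RatFunc k) P)
    · obtain ⟨i₀, hX₀, hP₀⟩ := hex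
      obtain ⟨n, hn⟩ := exists_zpow_mul_isUnitIn hP (hγ i₀)
      have hP0 : algebraMap k[X] (RatFunc k) P ≠ 0 := by
        rw [Ne, map_eq_zero_iff _ (RatFunc.algebraMap_injective k)]
        exact hP.ne_zero
      obtain ⟨h, hh0, hh⟩ := ih hb0' (fun i => γ i * algebraMap k[X] (RatFunc k) P ^ (-n))
        (fun i => mul_ne_zero (hγ i) (zpow_ne_zero _ hP0)) fun i hX hbi => by
          by_cases hPi : IsUnitIn (S i) (algebraMap k[X] (RatFunc k) P)
          · exact (hb i hX (by rw [map_mul]; exact hPi.mul hbi)).mul (hPi.zpow _)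
          · obtain rfl : i = i₀ := hinj (le_antisymm
              (le_of_not_isUnitIn (hS i) (hS i₀) hX hX₀ hP hPi hP₀)
              (le_of_not_isUnitIn (hS i₀) (hS i) hX₀ hX hP hP₀ hPi))
            exact hn _ (hS i) hX hPi
      refine ⟨h * algebraMap k[X] (RatFunc k) P ^ (-n), mul_ne_zero hh0 (zpow_ne_zero _ hP0),
        fun i hX => ?_⟩
      convert hh i hX using 1
      ring
    · push Not at hex
      exact ih hb0' γ hγ fun i hX hbi => hb i hX (by rw [map_mul]; exact (hex i hX).mul hbi)

open Classical in
/-- A Cartier divisor on the projective line is linearly equivalent to a multiple of the point at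
infinity. -/
theorem exists_mul_isUnitIn (hS : ∀ i, IsPlaceRing (S i)) (hinj : Function.Injective S)
    (hX : ∀ i, RatFunc.X ∈ S i ∨ RatFunc.X⁻¹ ∈ S i)
    {b : k[X]} (hb0 : b ≠ 0) (γ : ι → RatFunc k) (hγ : ∀ i, γ i ≠ 0)
    (hb : ∀ i, RatFunc.X ∈ S i → IsUnitIn (S i) (algebraMap k[X] (RatFunc k) b) →
      IsUnitIn (S i) (γ i)) :
    ∃ h : RatFunc k, h ≠ 0 ∧ ∃ n : ℤ, ∀ i,
      IsUnitIn (S i) (h * γ i * RatFunc.X ^ (-(if RatFunc.X ∈ S i then 0 else n))) := by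
  obtain ⟨h, hh0, hh⟩ := exists_mul_isUnitIn_affine hS hinj hb0 γ hγ hb
  refine ⟨h, hh0, ?_⟩
  by_cases hex : ∃ i, RatFunc.X ∉ S i
  · obtain ⟨i₀, hi₀⟩ := hex
    obtain ⟨n, hn⟩ := exists_zpow_mul_isUnitIn_infinity (mul_ne_zero hh0 (hγ i₀))
    refine ⟨-n, fun i => ?_⟩
    by_cases hi : RatFunc.X ∈ S i
    · simpa [hi] using hh i hi
    · have hXi := (hX i).resolve_left hi
      have hXi₀ := (hX i₀).resolve_left hi₀
      obtain rfl : i = i₀ := hinj (le_antisymm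
        (le_of_X_notMem (hS i) (hS i₀) hXi hXi₀ hi hi₀)
        (le_of_X_notMem (hS i₀) (hS i) hXi₀ hXi hi₀ hi))
      convert hn _ (hS i) hXi hi using 2
      rw [if_neg hi, neg_neg, inv_zpow, zpow_neg, inv_inv]
  · push Not at hex
    exact ⟨0, fun i => by simpa using hh i (hex i)⟩

end ProjectiveLine

/-! ### Divisors and constants on a component -/

section

theorem genericPoint_mul (g h : G K) : genericPoint ϖ (g * h) = g • genericPoint ϖ h :=
  mul_smul g h _

theorem genericPoint_eq_smul (g : G K) : genericPoint ϖ g = g • genericPoint ϖ 1 := by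
  rw [← genericPoint_mul, mul_one]

theorem genericPoint_mem_component (g : G K) : genericPoint ϖ g ∈ component ϖ g :=
  le_refl (genericPoint ϖ g).ring

theorem smul_ring_le_iff (g : G K) {x y : Point ϖ} :
    (g • x).ring ≤ (g • y).ring ↔ x.ring ≤ y.ring := by
  constructor
  · intro h f hf
    exact (act_mem_iff g).mp (h ((act_mem_iff g).mpr hf))
  · intro h
    exact Set.image_mono h

theorem smul_mem_component_iff (g h : G K) {x : Point ϖ} :
    g • x ∈ component ϖ (g * h) ↔ x ∈ component ϖ h := by
  change (g • x).ring ≤ (genericPoint ϖ (g * h)).ring ↔ _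
  rw [genericPoint_mul, smul_ring_le_iff]
  rfl

theorem smul_mem_component_iff' (g : G K) {x : Point ϖ} :
    g • x ∈ component ϖ g ↔ x ∈ component ϖ 1 := by
  have := smul_mem_component_iff g 1 (x := x)
  rwa [mul_one] at this

theorem act_inv_act (g : G K) (f : FunctionField K) : act g⁻¹ (act g f) = f := by
  rw [← RingHom.comp_apply, ← act_mul, inv_mul_cancel, act_one, RingHom.id_apply]

theorem act_act_inv (g : G K) (f : FunctionField K) : act g (act g⁻¹ f) = f := by
  rw [← RingHom.comp_apply, ← act_mul, mul_inv_cancel, act_one, RingHom.id_apply]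

theorem act_inv_mem_iff (g : G K) {x : Point ϖ} {f : FunctionField K} :
    act g⁻¹ f ∈ x.ring ↔ f ∈ (g • x).ring := by
  rw [← act_mem_iff g, act_act_inv]

theorem coord_mem_smul_iff (g : G K) {x : Point ϖ} :
    coord g ∈ (g • x).ring ↔ RatFunc.X ∈ x.ring := act_mem_iff g

theorem isUnitAt_X_genericPoint : IsUnitAt (genericPoint ϖ 1) RatFunc.X := by
  refine ⟨?_, ?_, RatFunc.X_ne_zero⟩
  · rw [gauss_eq]; exact X_mem_gauss
  · rw [gauss_eq]; exact X_inv_mem_gauss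

theorem isUnitAt_coord (g : G K) : IsUnitAt (genericPoint ϖ g) (coord g) := by
  rw [genericPoint_eq_smul]
  exact (act_isUnitAt_iff g).mpr isUnitAt_X_genericPoint

theorem X_zpow_mem_gauss (n : ℤ) : (RatFunc.X : FunctionField K) ^ n ∈ gaussSubring K := by
  cases n with
  | ofNat m => rw [Int.ofNat_eq_natCast, zpow_natCast]; exact pow_mem X_mem_gauss m
  | negSucc m =>
    rw [zpow_negSucc, ← inv_pow]; exact pow_mem X_inv_mem_gauss _

theorem red_X_zpow (n : ℤ) : red ⟨RatFunc.X ^ n, X_zpow_mem_gauss (K := K) n⟩ = RatFunc.X ^ n := by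
  have hX0 : (RatFunc.X : FunctionField K) ≠ 0 := RatFunc.X_ne_zero
  have key : ∀ m : ℕ, red ⟨RatFunc.X ^ (m : ℤ), X_zpow_mem_gauss (K := K) m⟩ =
      RatFunc.X ^ (m : ℤ) := by
    intro m
    have h := map_pow red ⟨RatFunc.X, X_mem_gauss (K := K)⟩ m
    rw [red_X] at h
    rw [zpow_natCast (RatFunc.X : RatFunc (BreveResidue K)), ← h]
    exact congrArg red (Subtype.ext (zpow_natCast _ m))
  obtain ⟨m, rfl | rfl⟩ := n.eq_nat_or_neg
  · exact key m
  · rw [zpow_neg (RatFunc.X : RatFunc (BreveResidue K))]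
    apply eq_inv_of_mul_eq_one_left
    rw [← key m, ← map_mul, ← map_one red]
    congr 1
    apply Subtype.ext
    change RatFunc.X ^ (-(m : ℤ)) * RatFunc.X ^ (m : ℤ) = (1 : FunctionField K)
    rw [← zpow_add₀ hX0, neg_add_cancel, zpow_zero]

theorem isPlaceRing_redRing {x : Point ϖ} (hx : x ∈ component ϖ 1) : IsPlaceRing (redRing x) := by
  refine ⟨C_mem_redRing x, fun r hr s hs hrs => ?_⟩
  have key : ∀ f : gaussSubring K, IsUnitAt x f → IsUnitIn (redRing x) (red f) := fun f hf =>
    ⟨(isUnitAt_red hx hf).1, (isUnitAt_red hx hf).2, red_ne_zero_of_isUnitAt hx hf⟩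
  obtain ⟨f, hf, rfl⟩ := mem_redRing.mp hr
  rcases isUnitAt_or_mem hf with h | h
  · exact Or.inl (key f h)
  · right
    have h1 := key (1 + -f) ((isUnitAt_one x).add_maxAt (neg_mem h))
    convert h1 using 1
    rw [map_add, map_one, map_neg]
    linear_combination hrs

theorem isUnitAt_iff_isUnitIn {x : Point ϖ} (hx : x ∈ component ϖ 1) {f : gaussSubring K}
    (hf : (f : FunctionField K) ∈ x.ring) : IsUnitAt x f ↔ IsUnitIn (redRing x) (red f) :=
  ⟨fun h => ⟨(isUnitAt_red hx h).1, (isUnitAt_red hx h).2, red_ne_zero_of_isUnitAt hx h⟩,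
    fun h => isUnitAt_of_red hx hf h.ne_zero h.inv_mem⟩

theorem polyToFun_mem {x : Point ϖ} (hX : RatFunc.X ∈ x.ring) (a : (breveIntegers K)[X]) :
    polyToFun K a ∈ x.ring := by
  induction a using Polynomial.induction_on' with
  | add a b ha hb => rw [map_add]; exact add_mem ha hb
  | monomial n c =>
    rw [← Polynomial.C_mul_X_pow_eq_monomial, map_mul, map_pow, polyToFun_C, polyToFun_X]
    exact mul_mem (C_mem_ring x c.2) (pow_mem hX n)

variable [Finite (IsLocalRing.ResidueField (integers K))]

/-- An open set that meets `ℙ_{s₁}` contains all of its affine points outside the zeros of some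
polynomial. -/
theorem exists_polynomial_of_isOpen {U : Set (Point ϖ)} (hU : IsOpen U)
    (h : genericPoint ϖ 1 ∈ U) :
    ∃ b : (BreveResidue K)[X], b ≠ 0 ∧ ∀ x ∈ component ϖ 1, RatFunc.X ∈ redRing x →
      IsUnitIn (redRing x) (algebraMap _ _ b) → x ∈ U := by
  induction hU with
  | basic S hS =>
    obtain ⟨f, rfl⟩ := hS
    have hf : f ∈ gaussSubring K := by rw [← gauss_eq ϖ]; exact h
    obtain ⟨a, b, hb, rfl⟩ := hf
    refine ⟨b.map (IsLocalRing.residue (breveIntegers K)), hb, fun x hx hX hu => ?_⟩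
    have hXx := (X_mem_redRing_iff hx).mp hX
    have hbu : IsUnitAt x (polyToFun K b) :=
      (isUnitAt_iff_isUnitIn hx (f := ⟨_, polyToFun_mem_gauss b⟩) (polyToFun_mem hXx b)).mpr
        (by rw [red_polyToFun]; exact hu)
    rw [Set.mem_ofPred_eq, div_eq_mul_inv]
    exact mul_mem (polyToFun_mem hXx a) hbu.inv_mem
  | univ => exact ⟨1, one_ne_zero, fun x _ _ _ => trivial⟩
  | inter S T _ _ ihS ihT =>
    obtain ⟨b, hb0, hb⟩ := ihS h.1
    obtain ⟨c, hc0, hc⟩ := ihT h.2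
    refine ⟨b * c, mul_ne_zero hb0 hc0, fun x hx hX hu => ?_⟩
    have hm := (isPlaceRing_redRing hx).poly_mem hX
    rw [map_mul] at hu
    exact ⟨hb x hx hX (hu.of_mul (hm b) (hm c)),
      hc x hx hX (IsUnitIn.of_mul (hm c) (hm b) (by rwa [mul_comm]))⟩
  | sUnion S _ ih =>
    obtain ⟨T, hT, hxT⟩ := h
    obtain ⟨b, hb0, hb⟩ := ih T hT hxT
    exact ⟨b, hb0, fun x hx hX hu => ⟨T, hT, hb x hx hX hu⟩⟩

open Classical in
theorem exists_divisor_trivialization_one (c : Point ϖ → FunctionField K)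
    (hc : ∀ x ∈ component ϖ 1, IsUnitAt (genericPoint ϖ 1) (c x))
    {U : Set (Point ϖ)} (hU : IsOpen U) (hη : genericPoint ϖ 1 ∈ U)
    (hcU : ∀ x ∈ U, x ∈ component ϖ 1 →
      ∃ u, IsUnitAt x u ∧ c x - u ∈ maxAt (genericPoint ϖ 1)) :
    ∃ h, IsUnitAt (genericPoint ϖ 1) h ∧ ∃ n : ℤ, ∀ x ∈ component ϖ 1, ∃ u, IsUnitAt x u ∧
      h * c x - u * RatFunc.X ^ (if RatFunc.X ∈ x.ring then 0 else n) ∈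
        maxAt (genericPoint ϖ 1) := by
  obtain ⟨b, hb0, hb⟩ := exists_polynomial_of_isOpen hU hη
  have hcg : ∀ x ∈ component ϖ 1, c x ∈ gaussSubring K := fun x hx => by
    rw [← gauss_eq ϖ]; exact (hc x hx).mem
  obtain ⟨h, hh0, n, hn⟩ := exists_mul_isUnitIn
    (S := fun x : {x : Point ϖ // x ∈ component ϖ 1} => redRing x.1)
    (fun x => isPlaceRing_redRing x.2)
    (fun x y hxy => Subtype.ext (eq_of_redRing_eq x.2 y.2 hxy))
    (fun x => by
      refine (X_mem_or_inv_mem x.2).imp (X_mem_redRing_iff x.2).mpr fun hx => ?_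
      refine ⟨⟨_, X_inv_mem_gauss⟩, hx, ?_⟩
      have h0 : red ⟨RatFunc.X, X_mem_gauss (K := K)⟩ ≠ 0 := by
        rw [red_X]; exact RatFunc.X_ne_zero
      rw [← red_X (K := K), ← red_inv h0])
    hb0 (fun x => red ⟨c x.1, hcg x.1 x.2⟩)
    (fun x => red_ne_zero_of_isUnitAt (genericPoint_mem_component 1) (hc x.1 x.2))
    (fun x hX hbx => by
      obtain ⟨u, hu, hcu⟩ := hcU x.1 (hb x.1 x.2 hX hbx) x.2
      have hug := mem_component_one.mp x.2 hu.mem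
      have := (red_eq_iff_sub_mem_maxAt (ϖ := ϖ) ⟨_, hcg x.1 x.2⟩ ⟨u, hug⟩).mpr hcu
      rw [this]
      exact (isUnitAt_iff_isUnitIn x.2 (f := ⟨u, hug⟩) hu.mem).mp hu)
  obtain ⟨f, rfl⟩ := red_surjective h
  refine ⟨f, ?_, n, fun x hx => ?_⟩
  · rw [isUnitAt_iff, ← red_eq_zero_iff_mem_maxAt]
    exact ⟨by rw [gauss_eq]; exact f.2, hh0⟩
  · have h1 := hn ⟨x, hx⟩
    obtain ⟨u, hu, hur⟩ := exists_unit_lift hx h1.mem h1.inv_mem h1.ne_zero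
    refine ⟨u, hu, ?_⟩
    have h2 := (red_eq_iff_sub_mem_maxAt (ϖ := ϖ) (f * ⟨c x, hcg x hx⟩)
      (u * ⟨_, X_zpow_mem_gauss (if RatFunc.X ∈ x.ring then 0 else n)⟩)).mp ?_
    · exact h2
    · have hX0 : (RatFunc.X : RatFunc (BreveResidue K)) ≠ 0 := RatFunc.X_ne_zero
      rw [map_mul, map_mul, red_X_zpow, hur, mul_assoc, ← zpow_add₀ hX0]
      simp only [X_mem_redRing_iff hx]
      simp

/-- A family of local equations on `ℙ_s` is equivalent to the family of local equations of a multiple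
of the point at infinity: `Pic ℙ¹ = ℤ`. -/
theorem exists_divisor_trivialization (g : G K) (c : Point ϖ → FunctionField K)
    (hc : ∀ x ∈ component ϖ g, IsUnitAt (genericPoint ϖ g) (c x))
    {U : Set (Point ϖ)} (hU : IsOpen U) (hη : genericPoint ϖ g ∈ U)
    (hcU : ∀ x ∈ U, x ∈ component ϖ g →
      ∃ u, IsUnitAt x u ∧ c x - u ∈ maxAt (genericPoint ϖ g)) :
    ∃ h, IsUnitAt (genericPoint ϖ g) h ∧ ∃ n : ℤ, ∀ x ∈ component ϖ g, ∃ u, IsUnitAt x u ∧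
      h * c x - u * coord g ^ (open Classical in if coord g ∈ x.ring then 0 else n) ∈
        maxAt (genericPoint ϖ g) := by
  classical
  rw [genericPoint_eq_smul] at *
  obtain ⟨h, hh, n, hn⟩ := exists_divisor_trivialization_one (fun x => act g⁻¹ (c (g • x)))
    (fun x hx => by
      rw [← act_isUnitAt_iff g, act_act_inv]
      exact hc _ ((smul_mem_component_iff' g).mpr hx))
    (U := {x | g • x ∈ U})
    (hU.preimage (by simpa using continuous_smul_point (ϖ := ϖ) g⁻¹)) hη
    (fun x hxU hx => by
      obtain ⟨u, hu, hcu⟩ := hcU _ hxU ((smul_mem_component_iff' g).mpr hx)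
      refine ⟨act g⁻¹ u, ?_, ?_⟩
      · rwa [← act_isUnitAt_iff g, act_act_inv]
      · rwa [← map_sub, ← act_mem_maxAt_iff g, act_act_inv])
  refine ⟨act g h, (act_isUnitAt_iff g).mpr hh, n, fun x hx => ?_⟩
  obtain ⟨y, rfl⟩ := MulAction.surjective g x
  obtain ⟨u, hu, hun⟩ := hn y ((smul_mem_component_iff' g).mp hx)
  refine ⟨act g u, (act_isUnitAt_iff g).mpr hu, ?_⟩
  rw [← act_mem_maxAt_iff g, map_sub, map_mul, map_mul, act_act_inv, map_zpow₀] at hun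
  simp only [coord_mem_smul_iff]
  exact hun

/-- A rational function on `ℙ_s` that is regular everywhere is constant. -/
theorem exists_C_sub_mem_maxAt (g : G K) {f : FunctionField K}
    (h : ∀ x ∈ component ϖ g, ∃ u ∈ x.ring, f - u ∈ maxAt (genericPoint ϖ g)) :
    ∃ c : breveIntegers K, f - RatFunc.C (c : Breve K) ∈ maxAt (genericPoint ϖ g) := by
  rw [genericPoint_eq_smul] at *
  obtain ⟨u, hu, hfu⟩ := h _ (genericPoint_eq_smul (ϖ := ϖ) g ▸ genericPoint_mem_component g)
  have hf : f ∈ (g • genericPoint ϖ 1).ring := by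
    have := add_mem (maxAt_le hfu) hu
    rwa [sub_add_cancel] at this
  rw [← act_inv_mem_iff, gauss_eq] at hf
  obtain ⟨r, hr⟩ := exists_eq_C_of_forall_mem_redRing ϖ (r := red ⟨act g⁻¹ f, hf⟩) (by
    intro x hx
    obtain ⟨u, hu, hfu⟩ := h _ ((smul_mem_component_iff' g).mpr hx)
    rw [← act_inv_mem_iff] at hu
    have hug := mem_component_one.mp hx hu
    refine ⟨⟨act g⁻¹ u, hug⟩, hu, ?_⟩
    rw [red_eq_iff_sub_mem_maxAt (ϖ := ϖ), ← act_mem_maxAt_iff g]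
    change act g (act g⁻¹ u - act g⁻¹ f) ∈ _
    rw [map_sub, act_act_inv, act_act_inv, ← neg_sub]
    exact neg_mem hfu)
  obtain ⟨c, rfl⟩ := IsLocalRing.residue_surjective r
  refine ⟨c, ?_⟩
  rw [← red_C, red_eq_iff_sub_mem_maxAt (ϖ := ϖ), ← act_mem_maxAt_iff g] at hr
  change act g (act g⁻¹ f - RatFunc.C (c : Breve K)) ∈ _ at hr
  rwa [map_sub, act_act_inv, act_C] at hr

end

/-! ### Stabilizers -/

/-- A matrix that transforms `z` to a rational function with nonconstant reduction preserves the
Gauss valuation ring. -/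
theorem gauss_map_act_le {g : G K} (hw : act g RatFunc.X ∈ gaussSubring K)
    (hr : ¬ ∃ c, red ⟨_, hw⟩ = RatFunc.C c) : (gaussSubring K).map (act g) ≤ gaussSubring K := by
  have htr := RatFunc.transcendental_of_ne_C _ hr
  have hmem : ∀ a, act g (polyToFun K a) ∈ gaussSubring K := by
    intro a
    induction a using Polynomial.induction_on' with
    | add a b ha hb => rw [map_add, map_add]; exact add_mem ha hb
    | monomial n c =>
      rw [← Polynomial.C_mul_X_pow_eq_monomial, map_mul, map_mul, map_pow, map_pow, polyToFun_C,
        polyToFun_X, act_C]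
      exact mul_mem (C_mem_gauss c.2) (pow_mem hw n)
  let ψ : (breveIntegers K)[X] →+* gaussSubring K :=
    ((act g).comp (polyToFun K)).codRestrict _ hmem
  have hψ : red.comp ψ = ((Polynomial.aeval (red ⟨_, hw⟩)).toRingHom).comp
      (Polynomial.mapRingHom (IsLocalRing.residue (breveIntegers K))) := by
    apply Polynomial.ringHom_ext
    · intro c
      have h1 : ψ (Polynomial.C c) = ⟨_, C_mem_gauss c.2⟩ := Subtype.ext (by
        change act g (polyToFun K (Polynomial.C c)) = _
        rw [polyToFun_C, act_C])
      rw [RingHom.comp_apply, h1, red_C]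
      simp [RatFunc.algebraMap_eq_C]
    · have h1 : ψ Polynomial.X = ⟨_, hw⟩ := Subtype.ext (by
        change act g (polyToFun K Polynomial.X) = _
        rw [polyToFun_X])
      rw [RingHom.comp_apply, h1]
      simp
  rintro _ ⟨_, ⟨a, b, hb, rfl⟩, rfl⟩
  have hb' : red (ψ b) ≠ 0 := by
    have h1 : red (ψ b) = Polynomial.aeval (red ⟨_, hw⟩)
        (b.map (IsLocalRing.residue (breveIntegers K))) := congrArg (fun f => f b) hψ
    rw [h1]
    intro h0
    exact hb ((transcendental_iff.mp htr) _ h0)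
  rw [map_div₀, div_eq_mul_inv]
  exact mul_mem (hmem a) (inv_mem_gauss hb')

theorem smul_genericPoint_one_of_le {g : G K} (h : (gaussSubring K).map (act g) ≤ gaussSubring K)
    (h' : (gaussSubring K).map (act g⁻¹) ≤ gaussSubring K) :
    g • genericPoint ϖ 1 = genericPoint ϖ 1 := by
  apply Point.ext
  apply LocalSubring.toSubring_injective
  change (g • genericPoint ϖ 1).ring = (genericPoint ϖ 1).ring
  rw [smul_ring, gauss_eq]
  refine le_antisymm h fun f hf => ?_
  exact ⟨act g⁻¹ f, h' ⟨f, hf, rfl⟩, act_act_inv g f⟩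

/-- The diagonal matrix with entries `a`, `d`. -/
def diag (a d : (integers K)ˣ) : G K :=
  Matrix.GeneralLinearGroup.mkOfDetNeZero !![((a : integers K) : K), 0; 0, ((d : integers K) : K)]
    (by
      have h : ∀ a : (integers K)ˣ, ((a : integers K) : K) ≠ 0 := fun a h =>
        a.ne_zero (Subtype.ext h)
      simp [Matrix.det_fin_two, h a, h d])

theorem act_diag_X (a d : (integers K)ˣ) :
    act (diag a d) RatFunc.X = intC K (a * ↑d⁻¹ : integers K) * RatFunc.X := by
  have hd : intC K (d : integers K) * intC K ↑d⁻¹ = 1 := by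
    rw [← map_mul, Units.mul_inv, map_one]
  have hd0 : intC K (d : integers K) ≠ 0 := left_ne_zero_of_mul_eq_one hd
  have h : act (diag a d) RatFunc.X = intC K a * RatFunc.X / intC K d := by
    rw [act_X_eq]
    simp [diag, Matrix.GeneralLinearGroup.mkOfDetNeZero]
    rfl
  rw [h, div_eq_iff hd0, map_mul]
  linear_combination (-intC K a * RatFunc.X) * hd

theorem matrix_ext {g h : G K} (h00 : g.1 0 0 = h.1 0 0) (h01 : g.1 0 1 = h.1 0 1)
    (h10 : g.1 1 0 = h.1 1 0) (h11 : g.1 1 1 = h.1 1 1) : g = h := by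
  apply Units.ext
  refine Matrix.ext fun i j => ?_
  fin_cases i <;> fin_cases j <;> assumption

theorem diag_mul (a d a' d' : (integers K)ˣ) :
    diag a d * diag a' d' = diag (a * a') (d * d') := by
  apply matrix_ext <;>
    simp [diag, Matrix.GeneralLinearGroup.mkOfDetNeZero, Matrix.mul_apply]

theorem diag_inv (a d : (integers K)ˣ) : (diag a d)⁻¹ = diag a⁻¹ d⁻¹ := by
  apply inv_eq_of_mul_eq_one_right
  rw [diag_mul, mul_inv_cancel, mul_inv_cancel]
  apply matrix_ext <;> simp [diag, Matrix.GeneralLinearGroup.mkOfDetNeZero]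

theorem weyl_mul_weyl : weyl K * weyl K = 1 := by
  apply matrix_ext <;>
    simp [weyl, Matrix.GeneralLinearGroup.mkOfDetNeZero, Matrix.mul_apply]

theorem weyl_inv : (weyl K)⁻¹ = weyl K := inv_eq_of_mul_eq_one_right weyl_mul_weyl

theorem weyl_mul_diag (a d : (integers K)ˣ) : weyl K * diag a d = diag d a * weyl K := by
  apply matrix_ext <;>
    simp [weyl, diag, Matrix.GeneralLinearGroup.mkOfDetNeZero, Matrix.mul_apply]

theorem alpha_mul_diag (a d : (integers K)ˣ) : alpha ϖ * diag a d = diag a d * alpha ϖ := by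
  apply matrix_ext <;>
    simp [alpha, diag, Matrix.GeneralLinearGroup.mkOfDetNeZero, Matrix.mul_apply, mul_comm]

theorem act_alpha_X : act (alpha ϖ) RatFunc.X = RatFunc.X / ϖ.const := by
  rw [act_X_eq]
  simp [alpha, Matrix.GeneralLinearGroup.mkOfDetNeZero]
  rfl

theorem act_const (g : G K) : act g ϖ.const = ϖ.const := act_C g _

theorem act_alpha_weyl_X : act (alpha ϖ * weyl K) RatFunc.X = ϖ.const / RatFunc.X := by
  rw [act_mul, RingHom.comp_apply, act_weyl_X, map_inv₀, act_alpha_X, inv_div]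

theorem act_alpha_weyl_inv_X :
    act (alpha ϖ * weyl K)⁻¹ RatFunc.X = ϖ.const / RatFunc.X := by
  have h := act_inv_act (alpha ϖ * weyl K) (ϖ.const / RatFunc.X)
  rwa [map_div₀, act_const, act_alpha_weyl_X, div_div_cancel₀ (const_ne_zero ϖ)] at h

theorem diag_smul_genericPoint (a d : (integers K)ˣ) :
    diag a d • genericPoint ϖ 1 = genericPoint ϖ 1 := by
  have key : ∀ a d : (integers K)ˣ, (gaussSubring K).map (act (diag a d)) ≤ gaussSubring K := by
    intro a d
    have hu : IsUnit (a * ↑d⁻¹ : integers K) := a.isUnit.mul d⁻¹.isUnit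
    have hw : act (diag a d) RatFunc.X ∈ gaussSubring K := by
      rw [act_diag_X]; exact mul_mem (intC_mem_gauss _) X_mem_gauss
    refine gauss_map_act_le hw ?_
    have hr : red ⟨_, hw⟩ = RatFunc.C (resO K (a * ↑d⁻¹ : integers K)) * RatFunc.X := by
      rw [← red_X (K := K), ← red_intC, ← map_mul]
      exact congrArg red (Subtype.ext (act_diag_X a d))
    rintro ⟨c, hc⟩
    rw [hr] at hc
    refine lin_ne_zero (a := resO K (a * ↑d⁻¹ : integers K)) (b := -c)
      (Or.inl (resO_ne_zero_iff.mpr hu)) ?_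
    rw [hc, map_neg, add_neg_cancel]
  refine smul_genericPoint_one_of_le (key a d) ?_
  rw [diag_inv]
  exact key _ _

theorem weyl_smul_genericPoint : weyl K • genericPoint ϖ 1 = genericPoint ϖ 1 := by
  have key : (gaussSubring K).map (act (weyl K)) ≤ gaussSubring K := by
    have hw : act (weyl K) RatFunc.X ∈ gaussSubring K := by
      rw [act_weyl_X]; exact X_inv_mem_gauss
    refine gauss_map_act_le hw ?_
    have h0 : red ⟨RatFunc.X, X_mem_gauss (K := K)⟩ ≠ 0 := by
      rw [red_X]; exact RatFunc.X_ne_zero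
    have hr : red ⟨_, hw⟩ = RatFunc.X⁻¹ := by
      rw [← red_X (K := K), ← red_inv h0]
      exact congrArg red (Subtype.ext act_weyl_X)
    rintro ⟨c, hc⟩
    rw [hr] at hc
    refine lin_ne_zero (a := c) (b := (-1 : BreveResidue K))
      (Or.inr (neg_ne_zero.mpr one_ne_zero)) ?_
    rw [← hc, inv_mul_cancel₀ RatFunc.X_ne_zero, map_neg, map_one, add_neg_cancel]
  refine smul_genericPoint_one_of_le key ?_
  rw [weyl_inv]
  exact key

theorem weyl_smul_mem_component {x : Point ϖ} (hx : x ∈ component ϖ 1) :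
    weyl K • x ∈ component ϖ 1 := by
  change (weyl K • x).ring ≤ (genericPoint ϖ 1).ring
  rw [← weyl_smul_genericPoint, smul_ring_le_iff]
  exact hx

/-! ### The double point -/

/-- The algebra `𝒪[z, ϖ / z]`, whose localization at `z = ϖ / z = 0` is the local ring at the
intersection point of `ℙ_{s₀}` and `ℙ_{s₁}`. Unlike the algebra of the standard edge, it is stable
under diagonal matrices. -/
def nodeAlgebra (ϖ : Uniformizer K) : Subring (FunctionField K) :=
  Subring.closure (RatFunc.C '' (breveIntegers K : Set (Breve K)) ∪
    {RatFunc.X, ϖ.const / RatFunc.X})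

/-- `x` is the intersection point of `ℙ_{s₀}` and `ℙ_{s₁}`. -/
structure IsNode (x : Point ϖ) : Prop where
  isLocalizationOf : IsLocalizationOf (nodeAlgebra ϖ) x.localRing
  X_mem : RatFunc.X ∈ maxAt x
  const_div_X_mem : ϖ.const / RatFunc.X ∈ maxAt x

theorem nodeAlgebra_le {B : Subring (FunctionField K)}
    (hC : ∀ c ∈ breveIntegers K, RatFunc.C c ∈ B) (h1 : RatFunc.X ∈ B)
    (h2 : ϖ.const / RatFunc.X ∈ B) : nodeAlgebra ϖ ≤ B := by
  rw [nodeAlgebra, Subring.closure_le]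
  rintro f (⟨c, hc, rfl⟩ | rfl | rfl)
  exacts [hC c hc, h1, h2]

theorem C_mem_nodeAlgebra {c : Breve K} (hc : c ∈ breveIntegers K) :
    RatFunc.C c ∈ nodeAlgebra ϖ := Subring.subset_closure (Or.inl ⟨c, hc, rfl⟩)

theorem X_mem_nodeAlgebra : RatFunc.X ∈ nodeAlgebra ϖ := Subring.subset_closure (by simp)

theorem const_div_X_mem_nodeAlgebra : ϖ.const / RatFunc.X ∈ nodeAlgebra ϖ :=
  Subring.subset_closure (by simp)

/-- The residue field of `x` consists of constants. -/
def HasConstantResidues (x : Point ϖ) : Prop :=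
  ∀ f ∈ x.ring, ∃ c : breveIntegers K, f - RatFunc.C (c : Breve K) ∈ maxAt x

theorem HasConstantResidues.smul {x : Point ϖ} (h : HasConstantResidues x) (g : G K) :
    HasConstantResidues (g • x) := by
  intro f hf
  obtain ⟨c, hc⟩ := h (act g⁻¹ f) ((act_inv_mem_iff g).mpr hf)
  refine ⟨c, ?_⟩
  rwa [← act_mem_maxAt_iff g, map_sub, act_act_inv, act_C] at hc

/-- The elements of `𝒪[z, ϖ / z]` are constant where `z` and `ϖ / z` vanish. -/
theorem exists_C_sub_mem_of_mem_nodeAlgebra {f : FunctionField K} (hf : f ∈ nodeAlgebra ϖ) :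
    ∃ c : breveIntegers K, ∀ x : Point ϖ, RatFunc.X ∈ maxAt x → ϖ.const / RatFunc.X ∈ maxAt x →
      f - RatFunc.C (c : Breve K) ∈ maxAt x := by
  rw [nodeAlgebra] at hf
  induction hf using Subring.closure_induction with
  | mem f hf =>
    rcases hf with ⟨c, hc, rfl⟩ | rfl | rfl
    · exact ⟨⟨c, hc⟩, fun x _ _ => by simp [zero_mem]⟩
    · exact ⟨0, fun x hX _ => by simpa using hX⟩
    · exact ⟨0, fun x _ hX' => by simpa using hX'⟩
  | zero => exact ⟨0, fun x _ _ => by simp [zero_mem]⟩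
  | one => exact ⟨1, fun x _ _ => by simp [zero_mem]⟩
  | add f g _ _ hf hg =>
    obtain ⟨c, hc⟩ := hf
    obtain ⟨d, hd⟩ := hg
    refine ⟨c + d, fun x h h' => ?_⟩
    convert add_mem (hc x h h') (hd x h h') using 1
    push_cast
    rw [map_add]
    ring
  | neg f _ hf =>
    obtain ⟨c, hc⟩ := hf
    refine ⟨-c, fun x h h' => ?_⟩
    convert neg_mem (hc x h h') using 1
    push_cast
    rw [map_neg]
    ring
  | mul f g _ _ hf hg =>
    obtain ⟨c, hc⟩ := hf
    obtain ⟨d, hd⟩ := hg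
    refine ⟨c * d, fun x h h' => ?_⟩
    have hg : g ∈ x.ring := by
      have := add_mem (maxAt_le (hd x h h')) (C_mem_ring x d.2)
      rwa [sub_add_cancel] at this
    convert add_mem (mul_mem_maxAt hg (hc x h h'))
      (mul_mem_maxAt (C_mem_ring x c.2) (hd x h h')) using 1
    push_cast
    rw [map_mul]
    ring

theorem isUnitAt_iff_of_C_sub_mem {x : Point ϖ} {f : FunctionField K} {c : breveIntegers K}
    (h : f - RatFunc.C (c : Breve K) ∈ maxAt x) : IsUnitAt x f ↔ IsUnit c := by
  constructor
  · intro hu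
    by_contra hc
    have h1 : RatFunc.C (c : Breve K) ∈ maxAt x :=
      (C_mem_maxAt_iff x c).mpr ((IsLocalRing.residue_eq_zero_iff c).mpr hc)
    exact hu.notMem (by simpa using add_mem h h1)
  · intro hc
    simpa using (isUnitAt_C x hc).add_maxAt h

theorem IsNode.hasConstantResidues {x : Point ϖ} (hx : IsNode x) : HasConstantResidues x := by
  intro f hf
  obtain ⟨a, ha, s, hs, hs0, hsx, rfl⟩ := hx.isLocalizationOf.2 f hf
  obtain ⟨c, hc⟩ := exists_C_sub_mem_of_mem_nodeAlgebra ha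
  obtain ⟨d, hd⟩ := exists_C_sub_mem_of_mem_nodeAlgebra hs
  replace hc := hc x hx.X_mem hx.const_div_X_mem
  replace hd := hd x hx.X_mem hx.const_div_X_mem
  have hsu : IsUnitAt x s := ⟨hx.isLocalizationOf.1 hs, hsx, hs0⟩
  have hdu : IsUnit d := (isUnitAt_iff_of_C_sub_mem hd).mp hsu
  obtain ⟨e, he⟩ := isUnit_iff_exists_inv.mp hdu
  have he' : RatFunc.C (d : Breve K) * RatFunc.C (e : Breve K) = 1 := by
    rw [← map_mul, ← map_one RatFunc.C]
    exact congrArg (fun z : breveIntegers K => RatFunc.C (z : Breve K)) he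
  refine ⟨c * e, ?_⟩
  have h1 := mul_mem_maxAt hsx (sub_mem hc (mul_mem_maxAt (C_mem_ring x (c * e).2) hd))
  convert h1 using 1
  have := hsu.ne_zero
  push_cast
  rw [map_mul]
  field_simp
  linear_combination (-RatFunc.C (c : Breve K)) * he'

theorem IsNode.le {x y : Point ϖ} (hx : IsNode x) (hy : IsNode y) : x.ring ≤ y.ring := by
  intro f hf
  obtain ⟨a, ha, s, hs, hs0, hsx, rfl⟩ := hx.isLocalizationOf.2 f hf
  refine mul_mem (hy.isLocalizationOf.1 ha) ?_
  obtain ⟨c, hc⟩ := exists_C_sub_mem_of_mem_nodeAlgebra hs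
  have h1 := (isUnitAt_iff_of_C_sub_mem (hc x hx.X_mem hx.const_div_X_mem)).mp
    ⟨hx.isLocalizationOf.1 hs, hsx, hs0⟩
  exact ((isUnitAt_iff_of_C_sub_mem (hc y hy.X_mem hy.const_div_X_mem)).mpr h1).inv_mem

/-- The local ring at the node is the only localization of `𝒪[z, ϖ / z]` in which `z` and `ϖ / z` are
not invertible. -/
theorem IsNode.eq {x y : Point ϖ} (hx : IsNode x) (hy : IsNode y) : x = y :=
  Point.ext (LocalSubring.toSubring_injective (le_antisymm (hx.le hy) (hy.le hx)))

theorem IsNode.smul {x : Point ϖ} (hx : IsNode x) {g : G K}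
    (h : (nodeAlgebra ϖ).map (act g) = nodeAlgebra ϖ) (h1 : act g⁻¹ RatFunc.X ∈ maxAt x)
    (h2 : act g⁻¹ (ϖ.const / RatFunc.X) ∈ maxAt x) : g • x = x := by
  refine IsNode.eq ⟨?_, ?_, ?_⟩ hx
  · have := hx.isLocalizationOf.map_act g
    rwa [h] at this
  · rwa [← act_mem_maxAt_iff g, act_act_inv] at h1
  · rwa [← act_mem_maxAt_iff g, act_act_inv] at h2

theorem map_act_eq_of_le {A : Subring (FunctionField K)} {g : G K} (h : A.map (act g) ≤ A)
    (h' : A.map (act g⁻¹) ≤ A) : A.map (act g) = A :=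
  le_antisymm h fun f hf => ⟨act g⁻¹ f, h' ⟨f, hf, rfl⟩, act_act_inv g f⟩

theorem nodeAlgebra_map_act_le {g : G K} (h1 : act g RatFunc.X ∈ nodeAlgebra ϖ)
    (h2 : act g (ϖ.const / RatFunc.X) ∈ nodeAlgebra ϖ) :
    (nodeAlgebra ϖ).map (act g) ≤ nodeAlgebra ϖ := by
  rw [Subring.map_le_iff_le_comap]
  refine nodeAlgebra_le (fun c hc => ?_) h1 h2
  rw [Subring.mem_comap, act_C]
  exact C_mem_nodeAlgebra hc

theorem act_diag_const_div_X (a d : (integers K)ˣ) : act (diag a d) (ϖ.const / RatFunc.X) =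
    intC K (d * ↑a⁻¹ : integers K) * (ϖ.const / RatFunc.X) := by
  have h : intC K (a * ↑d⁻¹ : integers K) * intC K (d * ↑a⁻¹ : integers K) = 1 := by
    rw [← map_mul, ← map_one (intC K)]
    congr 1
    rw [mul_assoc, Units.inv_mul_cancel_left, Units.mul_inv]
  have h1 := left_ne_zero_of_mul_eq_one h
  have hX0 : (RatFunc.X : FunctionField K) ≠ 0 := RatFunc.X_ne_zero
  rw [map_div₀, act_const, act_diag_X, div_eq_iff (mul_ne_zero h1 hX0)]
  field_simp
  linear_combination (-ϖ.const) * h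

theorem IsNode.diag_smul {x : Point ϖ} (hx : IsNode x) (a d : (integers K)ˣ) :
    diag a d • x = x := by
  have key : ∀ a d : (integers K)ˣ,
      (nodeAlgebra ϖ).map (act (diag a d)) ≤ nodeAlgebra ϖ := by
    intro a d
    refine nodeAlgebra_map_act_le ?_ ?_
    · rw [act_diag_X]
      exact mul_mem (C_mem_nodeAlgebra (intO K _).2) X_mem_nodeAlgebra
    · rw [act_diag_const_div_X]
      exact mul_mem (C_mem_nodeAlgebra (intO K _).2) const_div_X_mem_nodeAlgebra
  refine hx.smul (map_act_eq_of_le (key a d) ?_) ?_ ?_ <;> rw [diag_inv]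
  · exact key _ _
  · rw [act_diag_X]
    exact mul_mem_maxAt (intC_mem x _) hx.X_mem
  · rw [act_diag_const_div_X]
    exact mul_mem_maxAt (intC_mem x _) hx.const_div_X_mem

theorem IsNode.alpha_weyl_smul {x : Point ϖ} (hx : IsNode x) :
    (alpha ϖ * weyl K) • x = x := by
  have h : ϖ.const / (ϖ.const / RatFunc.X) = RatFunc.X := div_div_cancel₀ (const_ne_zero ϖ)
  have h1 : act (alpha ϖ * weyl K) (ϖ.const / RatFunc.X) = RatFunc.X := by
    rw [map_div₀, act_const, act_alpha_weyl_X, h]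
  have h2 : act (alpha ϖ * weyl K)⁻¹ (ϖ.const / RatFunc.X) = RatFunc.X := by
    rw [map_div₀, act_const, act_alpha_weyl_inv_X, h]
  refine hx.smul (map_act_eq_of_le (nodeAlgebra_map_act_le ?_ ?_) (nodeAlgebra_map_act_le ?_ ?_))
    ?_ ?_
  · rw [act_alpha_weyl_X]; exact const_div_X_mem_nodeAlgebra
  · rw [h1]; exact X_mem_nodeAlgebra
  · rw [act_alpha_weyl_inv_X]; exact const_div_X_mem_nodeAlgebra
  · rw [h2]; exact X_mem_nodeAlgebra
  · rw [act_alpha_weyl_inv_X]; exact hx.const_div_X_mem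
  · rw [h2]; exact hx.X_mem

/-- On `ℙ_{s₁}`, the node is the point `0`, which the Weyl element moves to `∞`. -/
theorem IsNode.X_notMem_weyl_smul {x : Point ϖ} (hx : IsNode x) :
    RatFunc.X ∉ (weyl K • x).ring := by
  rw [← act_inv_mem_iff, weyl_inv, act_weyl_X]
  exact fun h => IsUnitAt.notMem ⟨maxAt_le hx.X_mem, h, RatFunc.X_ne_zero⟩ hx.X_mem

/-- The node is the centre on `ℙ_{s₁}` of the `z`-adic valuation. In the localization of `𝒪[z, ϖ / z]`
there, `z ^ (q - 1) - 1` and its analogue for `ϖ / z` are invertible, so that it is also a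
localization of the algebra of the standard edge. -/
theorem exists_isNode [Finite (IsLocalRing.ResidueField (integers K))] (ϖ : Uniformizer K) :
    ∃ x : Point ϖ, x ∈ component ϖ 1 ∧ IsNode x := by
  have hn := residueCard_sub_one_ne_zero (K := K)
  let v := (Polynomial.idealX (BreveResidue K)).valuation (RatFunc (BreveResidue K))
  let V := v.valuationSubring
  have hV : ∀ a : (BreveResidue K)[X], algebraMap _ (RatFunc (BreveResidue K)) a ∈ V := fun a =>
    (v.mem_valuationSubring_iff _).mpr (IsDedekindDomain.HeightOneSpectrum.valuation_le_one _ a)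
  have hVC : ∀ c, RatFunc.C c ∈ V := fun c => RatFunc.algebraMap_C (K := BreveResidue K) c ▸ hV _
  have hXV : RatFunc.X ∈ V.nonunits := by
    rw [ValuationSubring.mem_nonunits_iff_or]
    right
    rw [Valuation.mem_valuationSubring_iff, map_inv₀, not_le, ← RatFunc.algebraMap_X]
    have h1 : v (algebraMap _ _ (Polynomial.X : (BreveResidue K)[X])) < 1 := by
      rw [IsDedekindDomain.HeightOneSpectrum.valuation_lt_one_iff_mem, Polynomial.idealX_span]
      exact Ideal.mem_span_singleton_self _
    refine (one_lt_inv₀ ?_).mpr h1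
    rw [zero_lt_iff, Ne, map_eq_zero, RatFunc.algebraMap_X]
    exact RatFunc.X_ne_zero
  have hle : chartAlgebra ϖ RatFunc.X ≤ gaussPreimage V.toSubring := by
    obtain ⟨h1, h2⟩ := pow_sub_one_of_mem_nonunits hXV hn
    exact chartAlgebra_le_gaussPreimage hVC (Unimodular.refl _)
      (by rw [red_X]; exact V.nonunits_le hXV) (by rwa [red_X]) (by rwa [red_X])
  have hnc : nodeAlgebra ϖ ≤ chartAlgebra ϖ RatFunc.X :=
    nodeAlgebra_le (fun c hc => Subring.subset_closure (Or.inl ⟨c, hc, rfl⟩))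
      (self_mem_chartAlgebra _) (const_div_mem_chartAlgebra _)
  obtain ⟨B, hB, hBR, hBinv⟩ := exists_isLocalizationOf (hnc.trans hle) fun f hf =>
    gaussPreimage_local V hf
  have hXB : RatFunc.X ∈ B.toSubring := hB.1 X_mem_nodeAlgebra
  have hcB : ϖ.const / RatFunc.X ∈ B.toSubring := hB.1 const_div_X_mem_nodeAlgebra
  have hcB' : chartAlgebra ϖ RatFunc.X ≤ B.toSubring := by
    refine mem_chartAlgebra_le (fun c hc => hB.1 (C_mem_nodeAlgebra hc)) hXB hcB ?_ ?_
    · exact hBinv _ (sub_mem (pow_mem hXB _) (one_mem _))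
        (pow_sub_one_ne_zero transcendental_X hn) (hle (inv_mem_chartAlgebra _))
    · exact hBinv _ (sub_mem (pow_mem hcB _) (one_mem _))
        (pow_sub_one_ne_zero (transcendental_const_div transcendental_X) hn)
        (hle (inv_mem_chartAlgebra' _))
  have hBg := hBR.trans (gaussPreimage_le _)
  let x : Point ϖ :=
    { localRing := B
      exists_chart := by
        refine ⟨1, ?_⟩
        rw [edgeAlgebra_map_act, act_one, RingHom.id_apply]
        refine ⟨hcB', fun b hb => ?_⟩
        obtain ⟨a, ha, s, hs, h⟩ := hB.2 b hb
        exact ⟨a, hnc ha, s, hnc hs, h⟩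
      special := special_of_le_gauss hBg ϖ }
  have hx : x ∈ component ϖ 1 := mem_component_one.mpr hBg
  refine ⟨x, hx, hB, ?_, const_div_mem_maxAt hx (Unimodular.refl _) hcB⟩
  refine mem_maxAt_of_inv_notMem hXB fun h => ?_
  obtain ⟨h1, h2⟩ := mem_gaussPreimage.mp (hBR h)
  have h0 : red ⟨RatFunc.X, X_mem_gauss (K := K)⟩ ≠ 0 := by
    rw [red_X]; exact RatFunc.X_ne_zero
  have h3 : red ⟨_, h1⟩ = RatFunc.X⁻¹ := by rw [← red_X (K := K), ← red_inv h0]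
  rw [h3] at h2
  exact ((ValuationSubring.mem_nonunits_iff_or (A := V)).mp hXV).elim RatFunc.X_ne_zero fun h => h h2

/-! ### Values of sections -/

section

variable {ν : ℕ∞}

/-- The function `f` on `X_ν` takes at `x` the value of the rational function `F`. -/
def HasValue {U : Opens (Point ϖ)} (f : sections ν U) (x : Point ϖ) (F : FunctionField K) : Prop :=
  ∃ (hx : x ∈ U) (hF : F ∈ x.ring), value ν x hx f = IsLocalRing.residue x.ring ⟨F, hF⟩

theorem mem_of_isOpen_of_ring_le {U : Set (Point ϖ)} (hU : IsOpen U) {x y : Point ϖ}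
    (hx : x ∈ U) (h : x.ring ≤ y.ring) : y ∈ U := by
  induction hU with
  | basic S hS => obtain ⟨f, rfl⟩ := hS; exact h hx
  | univ => trivial
  | inter S T _ _ ihS ihT => exact ⟨ihS hx.1, ihT hx.2⟩
  | sUnion S _ ih => obtain ⟨T, hT, hxT⟩ := hx; exact ⟨T, hT, ih T hT hxT⟩

theorem genericPoint_mem_of_mem {U : Opens (Point ϖ)} {x : Point ϖ} {g : G K} (hx : x ∈ U)
    (h : x ∈ component ϖ g) : genericPoint ϖ g ∈ U :=
  mem_of_isOpen_of_ring_le U.2 hx h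

/-- A section takes at a point and at a generization of it the values of one rational function. -/
theorem exists_hasValue {U : Opens (Point ϖ)} (f : sections ν U) {x y : Point ϖ} (hx : x ∈ U)
    (h : x.ring ≤ y.ring) : ∃ F, HasValue f x F ∧ HasValue f y F := by
  obtain ⟨V, hxV, hVU, F, hF⟩ := f.2 ⟨x, hx⟩ ⟨0, zero_le⟩
  have key : ∀ z ∈ V, HasValue f z F := by
    intro z hz
    obtain ⟨hFz, hm⟩ := hF ⟨z, hz⟩
    refine ⟨hVU hz, hFz, ?_⟩
    change Ideal.Quotient.factor (thickening_le_maximalIdeal z 0)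
      (f.1 ⟨z, hVU hz⟩ ⟨0, zero_le⟩) = _
    rw [hm ⟨0, zero_le⟩ le_rfl]
    rfl
  exact ⟨F, key x hxV, key y (mem_of_isOpen_of_ring_le V.2 hxV h)⟩

section

variable {U V : Opens (Point ϖ)} {f f' : sections ν U} {x : Point ϖ} {F F' : FunctionField K}

theorem HasValue.mem (h : HasValue f x F) : F ∈ x.ring := h.2.1

theorem HasValue.sub_mem (h : HasValue f x F) (h' : HasValue f x F') : F - F' ∈ maxAt x := by
  obtain ⟨hx, hF, h⟩ := h
  obtain ⟨_, hF', h'⟩ := h'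
  rw [← residue_eq_iff hF hF', ← h, ← h']

theorem HasValue.of_sub_mem (h : HasValue f x F) (h' : F' - F ∈ maxAt x) : HasValue f x F' := by
  obtain ⟨hx, hF, h⟩ := h
  have hF' : F' ∈ x.ring := by
    have := add_mem (maxAt_le h') hF
    rwa [sub_add_cancel] at this
  exact ⟨hx, hF', by rw [h, eq_comm, residue_eq_iff hF' hF]; exact h'⟩

theorem HasValue.isUnitAt (h : HasValue f x F) (hf : IsUnit f) : IsUnitAt x F := by
  obtain ⟨hx, hF, h⟩ := h
  refine isUnitAt_iff.mpr ⟨hF, fun hm => ?_⟩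
  have h1 := (hf.map (value ν x hx)).ne_zero
  rw [h] at h1
  exact h1 ((residue_eq_zero_iff hF).mpr hm)

end

theorem germAct_value (g : G K) (x : Point ϖ) (s : Germ ν (g⁻¹ • x)) {F : FunctionField K}
    (hF : F ∈ (g⁻¹ • x).ring)
    (h : germValue ν (g⁻¹ • x) s = IsLocalRing.residue _ ⟨F, hF⟩) :
    germValue ν x (germAct ν g x s) = IsLocalRing.residue _ ⟨act g F, act_mem_of_mem hF⟩ := by
  obtain ⟨a, ha⟩ := Ideal.Quotient.mk_surjective (s ⟨0, zero_le⟩)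
  have h1 : germValue ν (g⁻¹ • x) s = IsLocalRing.residue _ a := by
    change Ideal.Quotient.factor (thickening_le_maximalIdeal (g⁻¹ • x) 0) (s ⟨0, zero_le⟩) = _
    rw [← ha]
    rfl
  have h2 : germValue ν x (germAct ν g x s) =
      IsLocalRing.residue _ ⟨act g a, act_mem_of_mem a.2⟩ := by
    change Ideal.Quotient.factor (thickening_le_maximalIdeal x 0)
      (germAct ν g x s ⟨0, zero_le⟩) = _
    rw [germAct_toGerm ν g x a ⟨0, zero_le⟩ s ha.symm]
    rfl
  rw [h2, residue_eq_iff]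
  rw [h1, residue_eq_iff a.2 hF, ← act_mem_maxAt_iff g, smul_inv_smul, map_sub] at h
  exact h

theorem HasValue.sectionsAct {U V : Opens (Point ϖ)} {f : sections ν V} {x : Point ϖ}
    {F : FunctionField K} {g : G K} (h : ∀ x, x ∈ U ↔ g⁻¹ • x ∈ V) (hf : HasValue f (g⁻¹ • x) F) :
    HasValue (sectionsAct ν g h f) x (act g F) := by
  obtain ⟨hx, hF, hv⟩ := hf
  exact ⟨(h x).mpr hx, act_mem_of_mem hF, germAct_value g x _ hF hv⟩

theorem germAct_injective (g : G K) (x : Point ϖ) : Function.Injective (germAct ν g x) := by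
  intro s t hst
  funext m
  have h1 : Ideal.quotientMap (thickening x m) (ringAct g x) (thickening_le_comap g x m) (s m) =
      Ideal.quotientMap (thickening x m) (ringAct g x) (thickening_le_comap g x m) (t m) :=
    congrFun hst m
  refine Ideal.quotientMap_injective' ?_ h1
  intro a ha
  rw [Ideal.mem_comap, thickening, Ideal.mem_span_singleton] at ha
  obtain ⟨b, hb⟩ := ha
  have hb' : act g⁻¹ b ∈ (g⁻¹ • x).ring := (act_mem_iff g⁻¹).mpr b.2
  rw [thickening, Ideal.mem_span_singleton]
  refine ⟨⟨_, hb'⟩, Subtype.ext ?_⟩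
  have h2 : act g a = ϖ.const ^ ((m : ℕ) + 1) * (b : FunctionField K) := congrArg Subtype.val hb
  apply act_injective g
  change act g a = act g (ϖ.const ^ ((m : ℕ) + 1) * act g⁻¹ b)
  rw [h2, map_mul, map_pow, act_const, act_act_inv]

theorem sectionsAct_injective {U V : Opens (Point ϖ)} {g : G K}
    (h : ∀ x, x ∈ U ↔ g⁻¹ • x ∈ V) : Function.Injective (sectionsAct ν g h) := by
  intro s t hst
  apply Subtype.ext
  funext ⟨y, hy⟩
  obtain ⟨x, rfl⟩ := MulAction.surjective g⁻¹ y
  exact germAct_injective g x (congrFun (congrArg Subtype.val hst) ⟨x, (h x).mpr hy⟩)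

/-! ### Local generators -/

variable {L : Modules ϖ ν}

theorem res_res {U V W : Opens (Point ϖ)} (h : V ≤ U) (h' : W ≤ V) (r : Sec L U) :
    res L h' (res L h r) = res L (h'.trans h) r := by
  have h1 : (homOfLE (h'.trans h)).op = (homOfLE h).op ≫ (homOfLE h').op := rfl
  rw [res, res, res, h1, Functor.map_comp]
  rfl

theorem res_self {U : Opens (Point ϖ)} (h : U ≤ U) (r : Sec L U) : res L h r = r := by
  have h1 : (homOfLE h).op = 𝟙 (op U) := rfl
  rw [res, h1, CategoryTheory.Functor.map_id]
  rfl

section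

variable {U V : Opens (Point ϖ)} {e e' : Sec L U}

theorem IsGenerator.of_le (he : IsGenerator L e) (h : V ≤ U) : IsGenerator L (res L h e) := by
  intro W hW
  rw [res_res]
  exact he W (hW.trans h)

theorem IsGenerator.exists_smul (he : IsGenerator L e) (h : V ≤ U) (r : Sec L V) :
    ∃ f : sections ν V, f • res L h e = r := (he V h).2 r

theorem IsGenerator.cancel (he : IsGenerator L e) (h : V ≤ U) {f f' : sections ν V}
    (hf : f • res L h e = f' • res L h e) : f = f' := (he V h).1 hf

theorem IsGenerator.exists_unit (he : IsGenerator L e) (he' : IsGenerator L e') :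
    ∃ s : sections ν U, IsUnit s ∧ s • e = e' := by
  obtain ⟨s, hs⟩ := he.exists_smul le_rfl e'
  obtain ⟨t, ht⟩ := he'.exists_smul le_rfl e
  rw [res_self] at hs ht
  refine ⟨s, isUnit_iff_exists_inv.mpr ⟨t, he.cancel le_rfl ?_⟩, hs⟩
  rw [res_self, one_smul, mul_comm, mul_smul, hs, ht]

end

section

variable {H : Subgroup (G K)} (E : EquivariantStructure H L)

theorem EquivariantStructure.ρ_congr {g g' : G K} (hgg' : g = g') (hg : g ∈ H) (hg' : g' ∈ H)
    {V U : Opens (Point ϖ)} (h : ∀ x, x ∈ U ↔ g⁻¹ • x ∈ V) (h' : ∀ x, x ∈ U ↔ g'⁻¹ • x ∈ V)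
    (r : Sec L V) : E.ρ g hg h r = E.ρ g' hg' h' r := by
  subst hgg'
  rfl

theorem EquivariantStructure.ρ_inv_ρ {g : G K} (hg : g ∈ H) (hg' : g⁻¹ ∈ H)
    {V U : Opens (Point ϖ)} (h : ∀ x, x ∈ U ↔ g⁻¹ • x ∈ V) (h' : ∀ x, x ∈ V ↔ g⁻¹⁻¹ • x ∈ U)
    (r : Sec L V) : E.ρ g⁻¹ hg' h' (E.ρ g hg h r) = r := by
  have h1 : ∀ x, x ∈ V ↔ (g⁻¹ * g)⁻¹ • x ∈ V := fun x => by simp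
  rw [← E.ρ_mul g⁻¹ hg' g hg h' h h1,
    E.ρ_congr (inv_mul_cancel g) _ H.one_mem h1 (fun x => by simp), E.ρ_one]

theorem EquivariantStructure.ρ_ρ_inv {g : G K} (hg : g ∈ H) (hg' : g⁻¹ ∈ H)
    {V U : Opens (Point ϖ)} (h : ∀ x, x ∈ U ↔ g⁻¹ • x ∈ V) (h' : ∀ x, x ∈ V ↔ g⁻¹⁻¹ • x ∈ U)
    (r : Sec L U) : E.ρ g hg h (E.ρ g⁻¹ hg' h' r) = r := by
  have h1 : ∀ x, x ∈ U ↔ (g * g⁻¹)⁻¹ • x ∈ U := fun x => by simp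
  rw [← E.ρ_mul g hg g⁻¹ hg' h h' h1,
    E.ρ_congr (mul_inv_cancel g) _ H.one_mem h1 (fun x => by simp), E.ρ_one]

/-- The open set `g U`. -/
def translate (g : G K) (U : Opens (Point ϖ)) : Opens (Point ϖ) :=
  ⟨_, U.2.preimage (continuous_smul_point g)⟩

theorem mem_translate (g : G K) (U : Opens (Point ϖ)) (x : Point ϖ) :
    x ∈ translate g U ↔ g⁻¹ • x ∈ U := Iff.rfl

theorem mem_translate_inv {g : G K} {U : Opens (Point ϖ)} (x : Point ϖ) :
    x ∈ U ↔ g⁻¹ • x ∈ translate g⁻¹ U := by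
  rw [mem_translate, inv_inv, smul_inv_smul]

theorem EquivariantStructure.bijective_smul_ρ {g : G K} (hg : g ∈ H) {V U : Opens (Point ϖ)}
    (h : ∀ x, x ∈ U ↔ g⁻¹ • x ∈ V) (h' : ∀ x, x ∈ V ↔ g⁻¹⁻¹ • x ∈ U) {e : Sec L V}
    (he : Function.Bijective fun f : sections ν V => f • e) :
    Function.Bijective fun f : sections ν U => f • E.ρ g hg h e := by
  have hg' := H.inv_mem hg
  constructor
  · intro f f' hf
    have h2 : E.ρ g⁻¹ hg' h' (f • E.ρ g hg h e) = E.ρ g⁻¹ hg' h' (f' • E.ρ g hg h e) :=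
      congrArg (E.ρ g⁻¹ hg' h') hf
    rw [E.ρ_smul, E.ρ_smul, E.ρ_inv_ρ hg hg' h h'] at h2
    exact sectionsAct_injective h' (he.1 h2)
  · intro r
    obtain ⟨f, hf⟩ := he.2 (E.ρ g⁻¹ hg' h' r)
    have hf' : f • e = E.ρ g⁻¹ hg' h' r := hf
    refine ⟨sectionsAct ν g h f, ?_⟩
    have h3 : sectionsAct ν g h f • E.ρ g hg h e = r := by
      rw [← E.ρ_smul, hf', E.ρ_ρ_inv hg hg' h h']
    exact h3

theorem IsGenerator.ρ {g : G K} (hg : g ∈ H) {V U : Opens (Point ϖ)}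
    (h : ∀ x, x ∈ U ↔ g⁻¹ • x ∈ V) {e : Sec L V} (he : IsGenerator L e) :
    IsGenerator L (E.ρ g hg h e) := by
  intro U' hU'
  have h' : ∀ x, x ∈ U' ↔ g⁻¹ • x ∈ translate g⁻¹ U' := mem_translate_inv
  have h'' : ∀ x, x ∈ translate g⁻¹ U' ↔ g⁻¹⁻¹ • x ∈ U' := mem_translate g⁻¹ U'
  have hV : translate g⁻¹ U' ≤ V := fun x hx => by
    have := (h _).mp (hU' hx)
    rwa [smul_smul, inv_inv, inv_mul_cancel, one_smul] at this
  rw [← E.ρ_res g hg h h' hV hU' e]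
  exact E.bijective_smul_ρ hg h' h'' (he _ hV)

end

end

/-! ### Restriction of line bundles to components -/

section

variable {ν : ℕ∞} {L : Modules ϖ ν}

/-- Two local generators at `x` differ by a unit, whose values at `x` and at a generization of `x`
are given by one rational function that is a unit at `x`. -/
theorem IsGenerator.exists_ratio {U U' : Opens (Point ϖ)} {e : Sec L U} {e' : Sec L U'}
    (he : IsGenerator L e) (he' : IsGenerator L e') {x y : Point ϖ} (hx : x ∈ U) (hx' : x ∈ U')
    (hxy : x.ring ≤ y.ring) :
    ∃ s : sections ν (U ⊓ U'), ∃ F, s • res L inf_le_left e = res L inf_le_right e' ∧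
      IsUnitAt x F ∧ HasValue s y F := by
  obtain ⟨s, hs, hse⟩ := (he.of_le (V := U ⊓ U') inf_le_left).exists_unit
    (he'.of_le (V := U ⊓ U') inf_le_right)
  obtain ⟨F, hFx, hFy⟩ := exists_hasValue s ⟨hx, hx'⟩ hxy
  exact ⟨s, F, hse, hFx.isUnitAt hs, hFy⟩

/-- The value at `x` of the coefficient of a section with respect to the generator `e`. -/
def coefficientValue {U₀ : Opens (Point ϖ)} {e : Sec L U₀} (he : IsGenerator L e) {x : Point ϖ}
    (hx : x ∈ U₀) {U : Opens (Point ϖ)} (hU : x ∈ U) (r : Sec L U) : ResidueField x :=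
  value ν x (U := U ⊓ U₀) ⟨hU, hx⟩
    (he.exists_smul (V := U ⊓ U₀) inf_le_right (res L inf_le_left r)).choose

section

variable {U₀ : Opens (Point ϖ)} {e : Sec L U₀} (he : IsGenerator L e) {x : Point ϖ} (hx : x ∈ U₀)
  {U V : Opens (Point ϖ)}

theorem coefficientValue_eq (hU : x ∈ U) {W : Opens (Point ϖ)} (hW : W ≤ U) (hW₀ : W ≤ U₀)
    (hxW : x ∈ W) (r : Sec L U) (f : sections ν W) (hf : f • res L hW₀ e = res L hW r) :
    coefficientValue he hx hU r = value ν x hxW f := by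
  have h0 := (he.exists_smul (V := U ⊓ U₀) inf_le_right (res L inf_le_left r)).choose_spec
  have h1 := congrArg (res L (le_inf hW hW₀)) h0
  rw [res_smul, res_res, res_res, ← hf] at h1
  have h2 := he.cancel hW₀ h1
  rw [← h2]
  rfl

theorem exists_coefficientValue (hU : x ∈ U) (r : Sec L U) : ∃ f : sections ν (U ⊓ U₀),
    f • res L inf_le_right e = res L inf_le_left r ∧
      coefficientValue he hx hU r = value ν x (U := U ⊓ U₀) ⟨hU, hx⟩ f :=
  ⟨_, (he.exists_smul (V := U ⊓ U₀) inf_le_right (res L inf_le_left r)).choose_spec, rfl⟩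

theorem coefficientValue_add (hU : x ∈ U) (r r' : Sec L U) : coefficientValue he hx hU (r + r') =
    coefficientValue he hx hU r + coefficientValue he hx hU r' := by
  obtain ⟨f, hf, h⟩ := exists_coefficientValue he hx hU r
  obtain ⟨f', hf', h'⟩ := exists_coefficientValue he hx hU r'
  rw [h, h', ← map_add]
  exact coefficientValue_eq he hx hU _ _ _ _ _ (by rw [add_smul, hf, hf', map_add])

theorem coefficientValue_smul (hU : x ∈ U) (a : sections ν U) (r : Sec L U) :
    coefficientValue he hx hU (a • r) = value ν x hU a * coefficientValue he hx hU r := by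
  obtain ⟨f, hf, h⟩ := exists_coefficientValue he hx hU r
  rw [h, coefficientValue_eq he hx hU inf_le_left inf_le_right ⟨hU, hx⟩ (a • r)
    (restrict ν inf_le_left a * f) (by rw [mul_smul, hf, res_smul]), map_mul]
  rfl

theorem coefficientValue_res (h : V ≤ U) (hU : x ∈ U) (hV : x ∈ V) (r : Sec L U) :
    coefficientValue he hx hV (res L h r) = coefficientValue he hx hU r := by
  obtain ⟨f, hf, h'⟩ := exists_coefficientValue he hx hV (res L h r)
  rw [h', coefficientValue_eq he hx hU (inf_le_left.trans h) inf_le_right ⟨hV, hx⟩ r f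
    (by rw [hf, res_res])]

end

/-- The exponent of the coordinate in the generator at `x` of the twisting sheaf `𝒪(k)`. -/
def twistExponent (g : G K) (k : ℤ) (x : Point ϖ) : ℤ :=
  open Classical in if coord g ∈ x.ring then 0 else k

theorem twistExponent_congr {g h : G K} {k : ℤ} {x y : Point ϖ}
    (hxy : coord g ∈ x.ring ↔ coord h ∈ y.ring) : twistExponent g k x = twistExponent h k y := by
  unfold twistExponent
  split_ifs <;> tauto

theorem mem_twistGenerators_iff {g : G K} {k : ℤ} {x : Point ϖ}
    {c : ResidueField (genericPoint ϖ g)} : c ∈ twistGenerators g k x ↔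
      ∃ u, IsUnitAt x u ∧ ∃ hu : u * coord g ^ twistExponent g k x ∈ (genericPoint ϖ g).ring,
        c = IsLocalRing.residue (genericPoint ϖ g).ring ⟨_, hu⟩ :=
  ⟨fun ⟨u, h1, h2, h3, hu⟩ => ⟨u, ⟨h1, h2, h3⟩, hu⟩,
    fun ⟨u, ⟨h1, h2, h3⟩, hu⟩ => ⟨u, h1, h2, h3, hu⟩⟩

/-- The restriction of a line bundle to a component is isomorphic to some `𝒪(k)`. A generator at the
generic point identifies the sections with rational functions on the component; the local generators
then form a divisor, which becomes a multiple of the point at infinity after multiplication by a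
rational function. -/
theorem exists_componentIso [Finite (IsLocalRing.ResidueField (integers K))]
    (hL : IsLineBundle L) (g : G K) : ∃ k : ℤ, Nonempty (ComponentIso L g k) := by
  obtain ⟨U₀, hη, e₀, he₀⟩ := hL (genericPoint ϖ g)
  -- `c x` represents the generator `e x` at `x`; on `U₀` it is a unit at `x`
  choose U hU e he using hL
  have hηU : ∀ x ∈ component ϖ g, genericPoint ϖ g ∈ U x := fun x hx =>
    genericPoint_mem_of_mem (hU x) hx
  have hc : ∀ x, ∃ c : FunctionField K, ∀ hx : x ∈ component ϖ g,
      ∃ hc : c ∈ (genericPoint ϖ g).ring,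
        coefficientValue he₀ hη (hηU x hx) (e x) = IsLocalRing.residue _ ⟨c, hc⟩ := by
    intro x
    by_cases hx : x ∈ component ϖ g
    · obtain ⟨c, hc⟩ := IsLocalRing.residue_surjective (coefficientValue he₀ hη (hηU x hx) (e x))
      exact ⟨c, fun _ => ⟨c.2, hc.symm⟩⟩
    · exact ⟨0, fun h => absurd h hx⟩
  choose c hc hcv using hc
  have hratio : ∀ x (_ : x ∈ component ϖ g) y, y.ring ≤ (genericPoint ϖ g).ring → y ∈ U₀ →
      y ∈ U x → ∃ u, IsUnitAt y u ∧ c x - u ∈ maxAt (genericPoint ϖ g) := by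
    intro x hx y hyx hy hyU
    obtain ⟨s, F, hs, hF, hsF⟩ := he₀.exists_ratio (he x) hy hyU hyx
    obtain ⟨h1, h2, h3⟩ := hsF
    refine ⟨F, hF, (residue_eq_iff (hc x hx) h2).mp ?_⟩
    rw [← hcv x hx, ← h3]
    exact coefficientValue_eq he₀ hη _ inf_le_right inf_le_left h1 _ s hs
  obtain ⟨h, hh, k, hk⟩ := exists_divisor_trivialization g c
    (fun x hx => by
      obtain ⟨u, hu, hcu⟩ := hratio x hx _ le_rfl hη (hηU x hx)
      simpa using hu.add_maxAt hcu)
    U₀.2 hη (fun x hx hxg => hratio x hxg x hxg hx (hU x))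
  refine ⟨k, ⟨{
    φ := fun hU => AddMonoidHom.mk' (fun r => IsLocalRing.residue _ ⟨h, hh.mem⟩ *
      coefficientValue he₀ hη hU r) fun r r' => by rw [coefficientValue_add, mul_add]
    φ_res := fun hVU hU hV r => by
      simp only [AddMonoidHom.mk'_apply, coefficientValue_res he₀ hη hVU hU hV]
    φ_smul := fun hU f r => by
      simp only [AddMonoidHom.mk'_apply, coefficientValue_smul he₀ hη hU]
      ring
    φ_generator := fun {U'} hU' e' he' x hxU' hx => ?_ }⟩⟩
  obtain ⟨s, F, hs, hF, h1, h2, h3⟩ := (he x).exists_ratio he' (hU x) hxU' hx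
  obtain ⟨u, hu, hun⟩ := hk x hx
  rw [← twistExponent] at hun
  rw [mem_twistGenerators_iff]
  have hval : coefficientValue he₀ hη hU' e' =
      IsLocalRing.residue _ ⟨F, h2⟩ * IsLocalRing.residue _ ⟨c x, hc x hx⟩ := by
    rw [← h3, ← hcv x hx, ← coefficientValue_res he₀ hη inf_le_right hU' h1, ← hs,
      coefficientValue_smul, coefficientValue_res he₀ hη inf_le_left (hηU x hx) h1]
  have hsub : h * (F * c x) - F * u * coord g ^ twistExponent g k x ∈
      maxAt (genericPoint ϖ g) := by
    have h4 := mul_mem_maxAt (hx hF.mem) hun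
    convert h4 using 1
    ring
  have hmem : F * u * coord g ^ twistExponent g k x ∈
      (genericPoint ϖ g).ring := by
    have h5 := sub_mem (mul_mem hh.mem (mul_mem h2 (hc x hx))) (maxAt_le hsub)
    rwa [sub_sub_cancel] at h5
  refine ⟨F * u, hF.mul hu, hmem, ?_⟩
  rw [AddMonoidHom.mk'_apply, hval, ← map_mul, ← map_mul]
  exact (residue_eq_iff (mul_mem hh.mem (mul_mem h2 (hc x hx))) hmem).mpr hsub

theorem nonempty_componentIso_ord [Finite (IsLocalRing.ResidueField (integers K))]
    (hL : IsLineBundle L) (g : G K) : Nonempty (ComponentIso L g (ord L g)) := by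
  have h := exists_componentIso hL g
  rw [ord, dif_pos h]
  exact h.choose_spec

end

/-! ### The action of a stabilizer on the fibres -/

section

variable {ν : ℕ∞} {L : Modules ϖ ν} {H : Subgroup (G K)} {g t : G K} {k : ℤ}

theorem act_mem_maxAt_iff_of_smul_eq {x y : Point ϖ} (h : t • x = y) {f : FunctionField K} :
    act t f ∈ maxAt y ↔ f ∈ maxAt x := by
  subst h
  exact act_mem_maxAt_iff t

theorem act_isUnitAt_iff_of_smul_eq {x y : Point ϖ} (h : t • x = y) {f : FunctionField K} :
    IsUnitAt y (act t f) ↔ IsUnitAt x f := by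
  subst h
  exact act_isUnitAt_iff t

namespace ComponentIso

variable (Φ : ComponentIso L g k) {U V : Opens (Point ϖ)}

/-- The rational function `a` represents the image of the section `r` in the function field of the
component. -/
def Represents (r : Sec L U) (a : FunctionField K) : Prop :=
  ∃ (hU : genericPoint ϖ g ∈ U) (ha : a ∈ (genericPoint ϖ g).ring),
    Φ.φ hU r = IsLocalRing.residue (genericPoint ϖ g).ring ⟨a, ha⟩

variable {Φ}

theorem exists_represents (Φ : ComponentIso L g k) (hU : genericPoint ϖ g ∈ U) (r : Sec L U) :
    ∃ a, Φ.Represents r a := by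
  obtain ⟨a, ha⟩ := IsLocalRing.residue_surjective (Φ.φ hU r)
  exact ⟨a, hU, a.2, ha.symm⟩

theorem Represents.sub_mem {r : Sec L U} {a b : FunctionField K} (ha : Φ.Represents r a)
    (hb : Φ.Represents r b) : a - b ∈ maxAt (genericPoint ϖ g) := by
  obtain ⟨hU, ha, h⟩ := ha
  obtain ⟨_, hb, h'⟩ := hb
  rw [← residue_eq_iff ha hb, ← h, ← h']

theorem Represents.smul {r : Sec L U} {a F : FunctionField K} {f : sections ν U}
    (ha : Φ.Represents r a) (hf : HasValue f (genericPoint ϖ g) F) :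
    Φ.Represents (f • r) (F * a) := by
  obtain ⟨hU, ha, h⟩ := ha
  obtain ⟨_, hF, h'⟩ := hf
  refine ⟨hU, mul_mem hF ha, ?_⟩
  rw [Φ.φ_smul, h, h', ← map_mul]
  rfl

theorem Represents.res {r : Sec L U} {a : FunctionField K} (ha : Φ.Represents r a) (h : V ≤ U)
    (hV : genericPoint ϖ g ∈ V) : Φ.Represents (res L h r) a := by
  obtain ⟨hU, ha, h'⟩ := ha
  exact ⟨hV, ha, by rw [Φ.φ_res h hU hV, h']⟩

theorem exists_represents_generator (Φ : ComponentIso L g k) {e : Sec L U} (he : IsGenerator L e)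
    {x : Point ϖ} (hxU : x ∈ U) (hx : x ∈ component ϖ g) :
    ∃ u, IsUnitAt x u ∧ Φ.Represents e (u * coord g ^ twistExponent g k x) := by
  have hU := genericPoint_mem_of_mem hxU hx
  obtain ⟨u, hu, hm, h⟩ := mem_twistGenerators_iff.mp (Φ.φ_generator hU e he x hxU hx)
  exact ⟨u, hu, hU, hm, h⟩

theorem exists_isUnitAt_represents (Φ : ComponentIso L g k) {e : Sec L U} (he : IsGenerator L e)
    (hU : genericPoint ϖ g ∈ U) :
    ∃ a, IsUnitAt (genericPoint ϖ g) a ∧ Φ.Represents e a := by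
  obtain ⟨u, hu, h⟩ := Φ.exists_represents_generator he hU (genericPoint_mem_component g)
  exact ⟨_, hu.mul ((isUnitAt_coord g).zpow _), h⟩

/-- At the generic point of a component which it fixes, `t` acts on `L` as its action on functions
times a unit. -/
theorem exists_multiplier (Φ : ComponentIso L g k) (hL : IsLineBundle L)
    (E : EquivariantStructure H L) (ht : t ∈ H) (htη : t • genericPoint ϖ g = genericPoint ϖ g) :
    ∃ l, IsUnitAt (genericPoint ϖ g) l ∧ ∀ {U V : Opens (Point ϖ)}
      (h : ∀ x, x ∈ U ↔ t⁻¹ • x ∈ V) (r : Sec L V) {a b : FunctionField K}, Φ.Represents r a →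
      Φ.Represents (E.ρ t ht h r) b → b - l * act t a ∈ maxAt (genericPoint ϖ g) := by
  have htη' : t⁻¹ • genericPoint ϖ g = genericPoint ϖ g := inv_smul_eq_iff.mpr htη.symm
  obtain ⟨U₀, hη, e₀, he₀⟩ := hL (genericPoint ϖ g)
  have hηt : genericPoint ϖ g ∈ translate t U₀ := by rwa [mem_translate, htη']
  obtain ⟨a₀, ha₀, hr₀⟩ := Φ.exists_isUnitAt_represents he₀ hη
  obtain ⟨b₀, hb₀, hs₀⟩ := Φ.exists_isUnitAt_represents
    (he₀.ρ E ht (mem_translate t U₀)) hηt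
  have hta₀ := (act_isUnitAt_iff_of_smul_eq htη).mpr ha₀
  refine ⟨b₀ / act t a₀, hb₀.div hta₀, fun {U V} h r a b ha hb => ?_⟩
  have hV := ha.1
  obtain ⟨f, hf⟩ := he₀.exists_smul (V := V ⊓ U₀) inf_le_right (res L inf_le_left r)
  obtain ⟨F, hF, -⟩ := exists_hasValue f (x := genericPoint ϖ g) ⟨hV, hη⟩ le_rfl
  have hηW : genericPoint ϖ g ∈ translate t (V ⊓ U₀) := by
    rw [mem_translate, htη']
    exact ⟨hV, hη⟩
  have h1 : a - F * a₀ ∈ maxAt (genericPoint ϖ g) :=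
    (ha.res inf_le_left ⟨hV, hη⟩).sub_mem (hf ▸ (hr₀.res inf_le_right ⟨hV, hη⟩).smul hF)
  have hWU : translate t (V ⊓ U₀) ≤ U := fun x hx => (h x).mpr hx.1
  have hWU₀ : translate t (V ⊓ U₀) ≤ translate t U₀ := fun x hx => hx.2
  have h2 : res L hWU (E.ρ t ht h r) = sectionsAct ν t (mem_translate t (V ⊓ U₀)) f •
      res L hWU₀ (E.ρ t ht (mem_translate t U₀) e₀) := by
    rw [← E.ρ_res t ht h (mem_translate t (V ⊓ U₀)) inf_le_left hWU,
      ← E.ρ_res t ht (mem_translate t U₀) (mem_translate t (V ⊓ U₀)) inf_le_right hWU₀,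
      ← E.ρ_smul, hf]
  have h3 : b - act t F * b₀ ∈ maxAt (genericPoint ϖ g) :=
    (hb.res hWU hηW).sub_mem (h2 ▸ (hs₀.res hWU₀ hηW).smul
      (HasValue.sectionsAct (mem_translate t (V ⊓ U₀)) (htη'.symm ▸ hF)))
  have h4 := mul_mem_maxAt (hb₀.div hta₀).mem ((act_mem_maxAt_iff_of_smul_eq htη).mpr h1)
  convert sub_mem h3 h4 using 1
  have := hta₀.ne_zero
  simp only [map_sub, map_mul]
  field_simp
  ring

/-- If `t` fixes the generic point of a component and multiplies the coordinate by a constant, the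
unit by which it acts there on `L` is constant: it has neither zeros nor poles on the component. -/
theorem exists_constant_multiplier [Finite (IsLocalRing.ResidueField (integers K))]
    (Φ : ComponentIso L g k) (hL : IsLineBundle L)
    (E : EquivariantStructure H L) (ht : t ∈ H) (htη : t • genericPoint ϖ g = genericPoint ϖ g)
    {z : integers K} (hz : IsUnit z) (htg : act t (coord g) = intC K z * coord g) :
    ∃ c : breveIntegers K, IsUnit c ∧ ∀ {U V : Opens (Point ϖ)}
      (h : ∀ x, x ∈ U ↔ t⁻¹ • x ∈ V) (r : Sec L V) {a b : FunctionField K}, Φ.Represents r a →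
      Φ.Represents (E.ρ t ht h r) b →
        b - RatFunc.C (c : Breve K) * act t a ∈ maxAt (genericPoint ϖ g) := by
  obtain ⟨l, hl, H⟩ := Φ.exists_multiplier hL E ht htη
  obtain ⟨c, hc⟩ := exists_C_sub_mem_maxAt g (f := l) fun y hy => by
    obtain ⟨x, rfl⟩ := MulAction.surjective t y
    have hx : x ∈ component ϖ g := by
      change x.ring ≤ _
      rw [← smul_ring_le_iff (g := t), htη]
      exact hy
    obtain ⟨U, hxU, e, he⟩ := hL x
    obtain ⟨u, hu, hr⟩ := Φ.exists_represents_generator he hxU hx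
    obtain ⟨u', hu', hs⟩ := Φ.exists_represents_generator
      (he.ρ E ht (mem_translate t U)) (x := t • x) (by rwa [mem_translate, inv_smul_smul]) hy
    have h1 := H _ e hr hs
    have hzu : IsUnitAt (t • x) (intC K z) := isUnitAt_intC _ hz
    have hexp : twistExponent g k (t • x) = twistExponent g k x := by
      refine twistExponent_congr ?_
      rw [← act_mem_iff t (x := x), htg]
      refine ⟨fun h => mul_mem hzu.mem h, fun h => ?_⟩
      have := mul_mem hzu.inv_mem h
      rwa [inv_mul_cancel_left₀ hzu.ne_zero] at this
    rw [hexp] at h1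
    set n := twistExponent g k x
    have hcn := (isUnitAt_coord (ϖ := ϖ) g).zpow n
    have htu := ((act_isUnitAt_iff t).mpr hu).mul (hzu.zpow n)
    -- the quotient of the units at `t • x` given by the two generators
    refine ⟨u' / (act t u * intC K z ^ n), (hu'.div htu).mem, ?_⟩
    have h2 := mul_mem_maxAt (((htu.of_le hy).mul hcn).inv.neg).mem h1
    convert h2 using 1
    have h3 := htu.ne_zero
    have h4 := hcn.ne_zero
    rw [map_mul, map_zpow₀, htg, mul_zpow]
    have h5 := left_ne_zero_of_mul h3
    have h6 := right_ne_zero_of_mul h3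
    field_simp
    ring
  have hcu : IsUnit c := (isUnitAt_iff_of_C_sub_mem hc).mp hl
  refine ⟨c, hcu, fun h r a b ha hb => ?_⟩
  have hta : act t a ∈ (genericPoint ϖ g).ring := by
    have := (act_mem_iff t).mpr ha.2.1
    rwa [htη] at this
  convert add_mem (H h r ha hb) (mul_mem_maxAt' hc hta) using 1
  ring

end ComponentIso

/-- The element `t` of `H` acts on the fibre of `L` at its fixed point `x` as multiplication by the
value at `x` of the rational function `F`: for each local generator `e` at `x`, the quotient of `t e`
by `e` takes this value. -/
def ActsOnFibreBy (E : EquivariantStructure H L) (ht : t ∈ H) (x : Point ϖ) (F : FunctionField K) :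
    Prop :=
  ∀ ⦃U W : Opens (Point ϖ)⦄ (e : Sec L U), IsGenerator L e → ∀ (hW : W ≤ U)
    (hWt : W ≤ translate t U) (f : sections ν W), x ∈ W →
    f • res L hW e = res L hWt (E.ρ t ht (mem_translate t U) e) → HasValue f x F

section

variable {E : EquivariantStructure H L} {ht : t ∈ H} {x : Point ϖ}

/-- At a fixed point, an element acts on the fibre by a single value. -/
theorem ActsOnFibreBy.sub_mem {F F' : FunctionField K} (h : ActsOnFibreBy E ht x F)
    (h' : ActsOnFibreBy E ht x F') (hL : IsLineBundle L) (hx : t • x = x) :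
    F - F' ∈ maxAt x := by
  obtain ⟨U, hxU, e, he⟩ := hL x
  have hxt : x ∈ translate t U := by rwa [mem_translate, inv_smul_eq_iff.mpr hx.symm]
  obtain ⟨f, hf⟩ := he.exists_smul (V := U ⊓ translate t U) inf_le_left
    (res L inf_le_right (E.ρ t ht (mem_translate t U) e))
  exact (h e he _ _ f ⟨hxU, hxt⟩ hf).sub_mem (h' e he _ _ f ⟨hxU, hxt⟩ hf)

/-- Transport of structure along `s`: the conjugate of `t` acts on the fibre at `s x` as `t` does on the
fibre at `x`. -/
theorem ActsOnFibreBy.conj {F : FunctionField K} (h : ActsOnFibreBy E ht x F)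
    {s : G K} (hs : s ∈ H) {t' : G K} (ht' : t' ∈ H) (hst : s * t = t' * s) {y : Point ϖ}
    (hxy : s • x = y) : ActsOnFibreBy E ht' y (act s F) := by
  subst hxy
  intro U W e he hW hWt f hxW hf
  have hs' := H.inv_mem hs
  have hst' : s⁻¹ * t' = t * s⁻¹ := by
    rw [inv_mul_eq_iff_eq_mul, ← mul_assoc, hst, mul_inv_cancel_right]
  have hW1 : translate s⁻¹ W ≤ translate s⁻¹ U := fun x hx => hW hx
  have hkey : ∀ x, x ∈ translate t (translate s⁻¹ U) ↔ s⁻¹⁻¹ • x ∈ translate t' U := fun x => by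
    have h1 : s⁻¹⁻¹ * t⁻¹ = t'⁻¹ * s⁻¹⁻¹ := by
      rw [← mul_inv_rev, ← mul_inv_rev, hst']
    rw [mem_translate, mem_translate, mem_translate, smul_smul, smul_smul, h1]
  have hW2 : translate s⁻¹ W ≤ translate t (translate s⁻¹ U) := fun x hx =>
    (hkey x).mpr (hWt hx)
  have hcomm : E.ρ s⁻¹ hs' hkey (E.ρ t' ht' (mem_translate t' U) e) =
      E.ρ t ht (mem_translate t (translate s⁻¹ U)) (E.ρ s⁻¹ hs' (mem_translate s⁻¹ U) e) := by
    have h2 : ∀ x, x ∈ translate t (translate s⁻¹ U) ↔ (s⁻¹ * t')⁻¹ • x ∈ U := fun x => by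
      rw [hkey, mem_translate, smul_smul, mul_inv_rev]
    have h3 : ∀ x, x ∈ translate t (translate s⁻¹ U) ↔ (t * s⁻¹)⁻¹ • x ∈ U := fun x => by
      rw [h2, hst']
    rw [← E.ρ_mul _ _ _ _ _ _ h2, ← E.ρ_mul _ _ _ _ _ _ h3]
    exact E.ρ_congr hst' _ _ _ _ _
  have hv := h (E.ρ s⁻¹ hs' (mem_translate s⁻¹ U) e) (he.ρ E hs' _) hW1 hW2
    (sectionsAct ν s⁻¹ (mem_translate s⁻¹ W) f) (by rwa [mem_translate, inv_inv]) (by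
      rw [← hcomm, ← E.ρ_res s⁻¹ hs' (mem_translate s⁻¹ U) (mem_translate s⁻¹ W) hW hW1,
        ← E.ρ_smul, hf, E.ρ_res s⁻¹ hs' hkey (mem_translate s⁻¹ W) hWt hW2])
  obtain ⟨F', hF, -⟩ := exists_hasValue f hxW le_rfl
  refine hF.of_sub_mem ?_
  have hF' : HasValue f (s⁻¹⁻¹ • x) F' := by rwa [inv_inv]
  have h4 := hv.sub_mem (HasValue.sectionsAct (mem_translate s⁻¹ W) hF')
  rw [← act_mem_maxAt_iff s, map_sub, act_act_inv] at h4
  exact h4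

end

/-- The action of `t` on the fibre at a fixed point on a component whose coordinate it multiplies by
the constant `z`: up to a constant `c` common to all these points it is trivial away from infinity
and equal to `z ^ k` at infinity, where the coordinate occurs with exponent `k` in the generator. -/
theorem ComponentIso.exists_actsOnFibreBy [Finite (IsLocalRing.ResidueField (integers K))]
    (Φ : ComponentIso L g k) (hL : IsLineBundle L)
    (E : EquivariantStructure H L) (ht : t ∈ H) (htη : t • genericPoint ϖ g = genericPoint ϖ g)
    {z : integers K} (hz : IsUnit z) (htg : act t (coord g) = intC K z * coord g) :
    ∃ c : breveIntegers K, IsUnit c ∧ ∀ x ∈ component ϖ g, t • x = x → HasConstantResidues x →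
      ActsOnFibreBy E ht x (RatFunc.C (c : Breve K) * intC K z ^ twistExponent g k x) := by
  obtain ⟨c, hcu, H⟩ := Φ.exists_constant_multiplier hL E ht htη hz htg
  refine ⟨c, hcu, fun x hx htx hxc U W e he hW hWt f hxW hf => ?_⟩
  obtain ⟨u, hu, hr⟩ := Φ.exists_represents_generator he (hW hxW) hx
  obtain ⟨F, hFx, hFη⟩ := exists_hasValue f hxW hx
  have hηW := genericPoint_mem_of_mem hxW hx
  obtain ⟨b, hb⟩ := Φ.exists_represents (hWt hηW) (E.ρ t ht (mem_translate t U) e)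
  have h1 := H _ e hr hb
  have h2 := (hb.res hWt hηW).sub_mem (hf ▸ (hr.res hW hηW).smul hFη)
  set n := twistExponent g k x
  have hcn := (isUnitAt_coord (ϖ := ϖ) g).zpow n
  have htu := (act_isUnitAt_iff_of_smul_eq htx).mpr hu
  have hcz := (isUnitAt_C x hcu).mul ((isUnitAt_intC x hz).zpow n)
  have h3 : F * u - RatFunc.C (c : Breve K) * intC K z ^ n * act t u ∈
      maxAt (genericPoint ϖ g) := by
    convert mul_mem_maxAt hcn.inv_mem (sub_mem h1 h2) using 1
    have h4 := hcn.ne_zero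
    rw [map_mul, map_zpow₀, htg, mul_zpow]
    field_simp
    ring
  have h4 := maxAt_of_le hx (sub_mem (mul_mem hFx.mem hu.mem) (mul_mem hcz.mem htu.mem)) h3
  obtain ⟨d, hd⟩ := hxc u hu.mem
  have hd' := (act_mem_maxAt_iff_of_smul_eq htx).mpr hd
  rw [map_sub, act_C] at hd'
  have h5 := mul_mem_maxAt hcz.mem (sub_mem hd' hd)
  refine hFx.of_sub_mem ?_
  convert mul_mem_maxAt hu.inv_mem (neg_mem (add_mem h4 h5)) using 1
  have := hu.ne_zero
  field_simp
  ring

end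

/-! ### Invariance of the order -/

section

variable {ν : ℕ∞} {L : Modules ϖ ν} {H : Subgroup (G K)} {g h : G K} {k : ℤ}

/-- The isomorphism of residue fields induced by `g`. -/
def residueMap {x y : Point ϖ} (h : g • x = y) : ResidueField x →+* ResidueField y :=
  let f : x.ring →+* y.ring :=
    ((act g).comp x.ring.subtype).codRestrict y.ring fun a => h ▸ (act_mem_iff g).mpr a.2
  have : IsLocalHom f := ⟨fun a ha => (isUnit_iff_isUnitAt a.2).mpr
    ((act_isUnitAt_iff_of_smul_eq h).mp ((isUnit_iff_isUnitAt (f a).2).mp ha))⟩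
  IsLocalRing.ResidueField.map f

theorem residueMap_residue {x y : Point ϖ} (h : g • x = y) {f : FunctionField K} (hf : f ∈ x.ring)
    (hf' : act g f ∈ y.ring) : residueMap h (IsLocalRing.residue _ ⟨f, hf⟩) =
      IsLocalRing.residue _ ⟨act g f, hf'⟩ := rfl

/-- Transport of an isomorphism of the restriction of `L` with `𝒪(k)` to a translated component. -/
def ComponentIso.smul (Φ : ComponentIso L g k) (E : EquivariantStructure H L) (hh : h ∈ H) :
    ComponentIso L (h * g) k :=
  have hη : h • genericPoint ϖ g = genericPoint ϖ (h * g) := (genericPoint_mul h g).symm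
  have hU : ∀ {U : Opens (Point ϖ)}, genericPoint ϖ (h * g) ∈ U →
      genericPoint ϖ g ∈ translate h⁻¹ U := fun hU => by rwa [mem_translate, inv_inv, hη]
  have hh' := H.inv_mem hh
  { φ := fun {U} hηU => (residueMap hη).toAddMonoidHom.comp
      ((Φ.φ (hU hηU)).comp (E.ρ h⁻¹ hh' (mem_translate h⁻¹ U)))
    φ_res := fun {U V} hVU hηU hηV r => by
      have h1 : translate h⁻¹ V ≤ translate h⁻¹ U := fun x hx => hVU hx
      simp only [AddMonoidHom.comp_apply]
      rw [E.ρ_res h⁻¹ hh' (mem_translate h⁻¹ U) (mem_translate h⁻¹ V) hVU h1,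
        Φ.φ_res h1 (hU hηU) (hU hηV)]
    φ_smul := fun {U} hηU f r => by
      obtain ⟨F, hF, -⟩ := exists_hasValue f hηU le_rfl
      have h1 : HasValue f (h⁻¹⁻¹ • genericPoint ϖ g) F := by rwa [inv_inv, hη]
      obtain ⟨h2, h3, h4⟩ := HasValue.sectionsAct (mem_translate h⁻¹ U) h1
      obtain ⟨h5, h6, h7⟩ := hF
      have h8 : act h (act h⁻¹ F) ∈ (genericPoint ϖ (h * g)).ring := by rwa [act_act_inv]
      simp only [AddMonoidHom.comp_apply]
      rw [E.ρ_smul, Φ.φ_smul, h4, h7]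
      simp only [RingHom.toAddMonoidHom_eq_coe, AddMonoidHom.coe_coe, map_mul,
        residueMap_residue hη h3 h8, act_act_inv]
    φ_generator := fun {U} hηU e he x hxU hx => by
      have hx' : h⁻¹ • x ∈ component ϖ g := by
        rwa [← smul_mem_component_iff h, smul_inv_smul]
      obtain ⟨u, hu, hm, h1⟩ := mem_twistGenerators_iff.mp
        (Φ.φ_generator (hU hηU) _ (he.ρ E hh' (mem_translate h⁻¹ U)) (h⁻¹ • x)
          (by rwa [mem_translate, inv_inv, smul_inv_smul]) hx')
      have hc : twistExponent g k (h⁻¹ • x) = twistExponent (h * g) k x := by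
        refine twistExponent_congr ?_
        rw [← act_mem_iff h, smul_inv_smul, coord, coord, act_mul]
        rfl
      have h2 : act h (u * coord g ^ twistExponent g k (h⁻¹ • x)) =
          act h u * coord (h * g) ^ twistExponent (h * g) k x := by
        rw [map_mul, map_zpow₀, hc, coord, coord, act_mul, RingHom.comp_apply]
      have h3 : act h u * coord (h * g) ^ twistExponent (h * g) k x ∈
          (genericPoint ϖ (h * g)).ring := by
        rw [← h2, ← hη]
        exact (act_mem_iff h).mpr hm
      refine mem_twistGenerators_iff.mpr
        ⟨act h u, (act_isUnitAt_iff_of_smul_eq (smul_inv_smul h x)).mpr hu, h3, ?_⟩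
      simp only [AddMonoidHom.comp_apply, h1]
      refine (residueMap_residue hη hm (by rw [h2]; exact h3)).trans ?_
      congr 1
      exact Subtype.ext h2 }

/-- Elements of the group permute the components, and transport isomorphisms with `𝒪(k)`. -/
theorem ord_mul_eq (E : EquivariantStructure H L) (hh : h ∈ H) (g : G K) :
    ord L (h * g) = ord L g := by
  have key : (fun k => Nonempty (ComponentIso L (h * g) k)) =
      fun k => Nonempty (ComponentIso L g k) := by
    funext k
    refine propext ⟨fun ⟨Φ⟩ => ⟨?_⟩, fun ⟨Φ⟩ => ⟨Φ.smul E hh⟩⟩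
    have := Φ.smul E (H.inv_mem hh)
    rwa [inv_mul_cancel_left] at this
  have hord : ∀ P Q : ℤ → Prop, P = Q → (open Classical in if h : ∃ k, P k then h.choose else 0) =
      open Classical in if h : ∃ k, Q k then h.choose else 0 := by
    rintro P _ rfl
    rfl
  exact hord _ _ key

end

/-! ### Comparison of the characters of the torus -/

section

variable {ν : ℕ∞} {L : Modules ϖ ν} {H : Subgroup (G K)} {x : Point ϖ}

theorem IsNode.weyl_smul_hasConstantResidues (hn : IsNode x) : HasConstantResidues (weyl K • x) :=
  hn.hasConstantResidues.smul _

/-- The action of the torus on the fibre at the node, computed on `ℙ_{s₁}`. There the Weyl element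
exchanges the fixed points `0` and `∞` of the torus, and conjugates `diag z 1` to `diag 1 z`; hence
`diag 1 z` acts at `0` as `diag z 1` does at `∞`. -/
theorem exists_actsOnFibreBy_ordOne [Finite (IsLocalRing.ResidueField (integers K))]
    (hL : IsLineBundle L) (E : EquivariantStructure H L) (hw : weyl K ∈ H) {z : (integers K)ˣ}
    (hd : diag z 1 ∈ H) (hd' : diag 1 z ∈ H) (hx : x ∈ component ϖ 1) (hn : IsNode x) :
    ∃ c : breveIntegers K, IsUnit c ∧ ActsOnFibreBy E hd x (RatFunc.C (c : Breve K)) ∧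
      ActsOnFibreBy E hd' x (RatFunc.C (c : Breve K) * intC K z ^ ordOne L) := by
  obtain ⟨Φ⟩ := nonempty_componentIso_ord hL 1
  obtain ⟨c, hcu, hc⟩ := Φ.exists_actsOnFibreBy hL E hd (diag_smul_genericPoint z 1) z.isUnit (by
    rw [coord, act_one, RingHom.id_apply, act_diag_X, inv_one, Units.val_one, mul_one])
  have hwx : diag z 1 • weyl K • x = weyl K • x := by
    rw [smul_smul, ← weyl_mul_diag, ← smul_smul, hn.diag_smul]
  have h0 := hc x hx (hn.diag_smul _ _) hn.hasConstantResidues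
  have h1 := hc _ (weyl_smul_mem_component hx) hwx hn.weyl_smul_hasConstantResidues
  rw [twistExponent, coord, act_one, RingHom.id_apply, if_pos (maxAt_le hn.X_mem), zpow_zero,
    mul_one] at h0
  rw [twistExponent, coord, act_one, RingHom.id_apply, if_neg hn.X_notMem_weyl_smul] at h1
  have h2 := h1.conj hw hd' (weyl_mul_diag z 1) (y := x) (by
    rw [smul_smul, weyl_mul_weyl, one_smul])
  rw [map_mul, map_zpow₀, act_C, act_intC] at h2
  exact ⟨c, hcu, h0, h2⟩

/-- The action of the torus on the fibre at the node, computed on `ℙ_{s₀}`. Here the node is the point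
`∞`, and the point `0` is its image under `α`; the two are exchanged by `α w α⁻¹`, where `w` is the
Weyl element. -/
theorem exists_actsOnFibreBy_ordZero [Finite (IsLocalRing.ResidueField (integers K))]
    (hL : IsLineBundle L) (E : EquivariantStructure H L)
    (hw : alpha ϖ * weyl K * (alpha ϖ)⁻¹ ∈ H) {z : (integers K)ˣ}
    (hd : diag z 1 ∈ H) (hd' : diag 1 z ∈ H) (hx : x ∈ component ϖ 1) (hn : IsNode x) :
    ∃ c : breveIntegers K,
      ActsOnFibreBy E hd x (RatFunc.C (c : Breve K) * intC K z ^ ordZero L) ∧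
      ActsOnFibreBy E hd' x (RatFunc.C (c : Breve K)) := by
  obtain ⟨Φ⟩ := nonempty_componentIso_ord hL (alpha ϖ)
  obtain ⟨c, -, hc⟩ := Φ.exists_actsOnFibreBy hL E hd
    (by rw [genericPoint_eq_smul, smul_smul, ← alpha_mul_diag, ← smul_smul, diag_smul_genericPoint])
    z.isUnit (by
      rw [coord, ← RingHom.comp_apply, ← act_mul, ← alpha_mul_diag, act_mul, RingHom.comp_apply,
        act_diag_X, map_mul, act_intC, inv_one, Units.val_one, mul_one])
  have hαx : diag z 1 • alpha ϖ • x = alpha ϖ • x := by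
    rw [smul_smul, ← alpha_mul_diag, ← smul_smul, hn.diag_smul]
  have hα : (alpha ϖ)⁻¹ * diag z 1 = diag z 1 * (alpha ϖ)⁻¹ := by
    rw [inv_mul_eq_iff_eq_mul, ← mul_assoc, alpha_mul_diag, mul_inv_cancel_right]
  have hαw : alpha ϖ • weyl K • x = x := by rw [smul_smul, hn.alpha_weyl_smul]
  have hxα : x ∈ component ϖ (alpha ϖ) := by
    rw [← hαw, smul_mem_component_iff']
    exact weyl_smul_mem_component hx
  have h0 := hc _ ((smul_mem_component_iff' _).mpr hx) hαx (hn.hasConstantResidues.smul _)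
  have h1 := hc x hxα (hn.diag_smul _ _) hn.hasConstantResidues
  have hX : coord (alpha ϖ) ∉ x.ring := by
    have := hn.X_notMem_weyl_smul
    rwa [← coord_mem_smul_iff (alpha ϖ), hαw] at this
  rw [twistExponent, if_pos ((coord_mem_smul_iff _).mpr (maxAt_le hn.X_mem)), zpow_zero,
    mul_one] at h0
  rw [twistExponent, if_neg hX] at h1
  have h2 := h0.conj hw hd' (by
    rw [mul_assoc, hα, ← mul_assoc, mul_assoc (alpha ϖ), weyl_mul_diag, ← mul_assoc,
      alpha_mul_diag, mul_assoc (diag 1 z), mul_assoc (diag 1 z)]) (y := x) (by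
      rw [smul_smul, inv_mul_cancel_right, hn.alpha_weyl_smul])
  rw [act_C] at h2
  exact ⟨c, h1, h2⟩

/-- If `z ^ n` reduces to `1` for all units `z` of `𝒪_K`, then `q - 1 ∣ n`, because `𝔽_q^*` is cyclic of
order `q - 1`. -/
theorem residueCard_sub_one_dvd [Finite (IsLocalRing.ResidueField (integers K))] {n : ℤ}
    (h : ∀ z : (integers K)ˣ, intC K z ^ n - 1 ∈ maxAt x) : (residueCard K : ℤ) - 1 ∣ n := by
  obtain ⟨y, hy⟩ := IsCyclic.exists_generator (α := (IsLocalRing.ResidueField (integers K))ˣ)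
  obtain ⟨z, rfl⟩ := IsLocalRing.surjective_units_map_of_local_ringHom
    (IsLocalRing.residue (integers K)) IsLocalRing.residue_surjective inferInstance y
  have h1 : intC K ((z ^ n : (integers K)ˣ) : integers K) = intC K z ^ n := by
    have := congrArg Units.val (map_zpow (Units.map (intC K).toMonoidHom) z n)
    rwa [Units.val_zpow_eq_zpow_val] at this
  have h2 : intC K ((z ^ n : (integers K)ˣ) - 1 : integers K) ∈ maxAt x := by
    rw [map_sub, map_one, h1]
    exact h z
  rw [intC_mem_maxAt_iff, map_sub, sub_eq_zero, resO_eq_iff] at h2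
  have h3 : Units.map (IsLocalRing.residue (integers K)).toMonoidHom z ^ n = 1 := by
    rw [← map_zpow]
    exact Units.ext h2
  rw [← orderOf_dvd_iff_zpow_eq_one, orderOf_eq_card_of_forall_mem_zpowers hy, Nat.card_units] at h3
  rwa [residueCard, ← Nat.cast_pred Nat.card_pos]

theorem diag_mem_evenSubgroup (a d : (integers K)ˣ) : diag a d ∈ evenSubgroup ϖ :=
  ⟨0, a * d, by simp [diag, Matrix.GeneralLinearGroup.mkOfDetNeZero]⟩

theorem weyl_mem_evenSubgroup : weyl K ∈ evenSubgroup ϖ :=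
  ⟨0, -1, by simp [weyl, Matrix.GeneralLinearGroup.mkOfDetNeZero]⟩

theorem conj_mem_evenSubgroup {g : G K} (hg : g ∈ evenSubgroup ϖ) (h : G K) :
    h * g * h⁻¹ ∈ evenSubgroup ϖ := by
  obtain ⟨n, u, hu⟩ := hg
  refine ⟨n, u, ?_⟩
  rw [map_mul, map_mul, mul_right_comm, ← map_mul, mul_inv_cancel, map_one, one_mul, hu]

end

/-! ### Congruences for the orders -/

section

variable {ν : ℕ∞} {L : Modules ϖ ν} {H : Subgroup (G K)}

theorem residueCard_sub_one_dvd_ordZero_add_ordOne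
    [Finite (IsLocalRing.ResidueField (integers K))] (hL : IsLineBundle L)
    (E : EquivariantStructure H L) (hH : evenSubgroup ϖ ≤ H) :
    (residueCard K : ℤ) - 1 ∣ ordZero L + ordOne L := by
  obtain ⟨x, hx, hn⟩ := exists_isNode ϖ
  refine residueCard_sub_one_dvd (x := x) fun z => ?_
  have hd := hH (diag_mem_evenSubgroup (ϖ := ϖ) z 1)
  have hd' := hH (diag_mem_evenSubgroup (ϖ := ϖ) 1 z)
  obtain ⟨c, hcu, h1, h2⟩ :=
    exists_actsOnFibreBy_ordOne hL E (hH weyl_mem_evenSubgroup) hd hd' hx hn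
  obtain ⟨c', h1', h2'⟩ := exists_actsOnFibreBy_ordZero hL E
    (hH (conj_mem_evenSubgroup weyl_mem_evenSubgroup (alpha ϖ))) hd hd' hx hn
  -- The characters of the two factors of the torus have been computed on both components:
  -- `c = c' z ^ ord_{s₀}` and `c' = c z ^ ord_{s₁}` in the residue field.
  have h3 := h1'.sub_mem h1 hL (hn.diag_smul _ _)
  have h4 := h2.sub_mem h2' hL (hn.diag_smul _ _)
  have hz := isUnitAt_intC x z.isUnit
  have hc := isUnitAt_C x hcu
  convert mul_mem_maxAt hc.inv_mem (add_mem (mul_mem_maxAt' h4 (hz.zpow (ordZero L)).mem) h3)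
    using 1
  have := hc.ne_zero
  rw [zpow_add₀ hz.ne_zero]
  field_simp
  ring

theorem residueCard_sub_one_dvd_ordOne [Finite (IsLocalRing.ResidueField (integers K))]
    (hL : IsLineBundle L) (E : EquivariantStructure (⊤ : Subgroup (G K)) L) :
    (residueCard K : ℤ) - 1 ∣ ordOne L := by
  obtain ⟨x, hx, hn⟩ := exists_isNode ϖ
  refine residueCard_sub_one_dvd (x := x) fun z => ?_
  have hd : diag z 1 ∈ (⊤ : Subgroup (G K)) := trivial
  have hd' : diag 1 z ∈ (⊤ : Subgroup (G K)) := trivial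
  obtain ⟨c, hcu, h1, h2⟩ := exists_actsOnFibreBy_ordOne hL E trivial hd hd' hx hn
  -- `α w` fixes the node and exchanges the two factors of the torus.
  have h3 := h1.conj (s := alpha ϖ * weyl K) trivial hd'
    (by rw [mul_assoc, weyl_mul_diag, ← mul_assoc, alpha_mul_diag, mul_assoc]) hn.alpha_weyl_smul
  rw [act_C] at h3
  have hc := isUnitAt_C x hcu
  convert mul_mem_maxAt hc.inv_mem (h2.sub_mem h3 hL (hn.diag_smul _ _)) using 1
  have := hc.ne_zero
  field_simp

theorem ordZero_eq_ordOne (E : EquivariantStructure (⊤ : Subgroup (G K)) L) :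
    ordZero L = ordOne L := by
  have := ord_mul_eq E (h := alpha ϖ) trivial 1
  rwa [mul_one] at this

theorem weight_eq_of_add_eq [Finite (IsLocalRing.ResidueField (integers K))] {n : ℤ}
    (h : ordZero L + ordOne L = ((residueCard K : ℤ) - 1) * n) : weight L = -n := by
  have hq : (residueCard K : ℚ) - 1 ≠ 0 := by
    rw [sub_ne_zero, Ne, Nat.cast_eq_one]
    intro h1
    exact residueCard_sub_one_ne_zero (K := K) (by rw [h1])
  rw [weight, h]
  push_cast
  field_simp

end

end DrinfeldPlane

end

theorem mainTheorem6 (p : ℕ) [Fact p.Prime] (hp : p ≠ 2)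
    (K : IntermediateField ℚ_[p] ℂ_[p]) [FiniteDimensional ℚ_[p] K]
    (ϖ : DrinfeldPlane.Uniformizer K)
    (ν : ℕ∞) (hν : ν = DrinfeldPlane.HHat ∨ ν = DrinfeldPlane.HBar)
    (L : DrinfeldPlane.Modules ϖ ν) (hL : DrinfeldPlane.IsLineBundle L) :
    (∀ _ : DrinfeldPlane.EquivariantStructure (DrinfeldPlane.evenSubgroup ϖ) L,
      (∃ n : ℤ, DrinfeldPlane.weight L = n) ∧
      ((DrinfeldPlane.residueCard K : ℤ) - 1) ∣
        DrinfeldPlane.ordZero L + DrinfeldPlane.ordOne L) ∧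
    (∀ _ : DrinfeldPlane.EquivariantStructure (⊤ : Subgroup (DrinfeldPlane.G K)) L,
      (∃ n : ℤ, DrinfeldPlane.weight L = 2 * n) ∧
      ((DrinfeldPlane.residueCard K : ℤ) - 1) ∣ DrinfeldPlane.ordZero L ∧
      ((DrinfeldPlane.residueCard K : ℤ) - 1) ∣ DrinfeldPlane.ordOne L) := by
  have := DrinfeldPlane.finite_residueField (K := K)
  refine ⟨fun E => ?_, fun E => ?_⟩
  · have h := DrinfeldPlane.residueCard_sub_one_dvd_ordZero_add_ordOne hL E le_rfl
    obtain ⟨n, hn⟩ := id h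
    exact ⟨⟨-n, by rw [DrinfeldPlane.weight_eq_of_add_eq hn, Int.cast_neg]⟩, h⟩
  · have h1 := DrinfeldPlane.residueCard_sub_one_dvd_ordOne hL E
    have h0 := DrinfeldPlane.ordZero_eq_ordOne E
    obtain ⟨n, hn⟩ := id h1
    refine ⟨⟨-n, ?_⟩, h0 ▸ h1, h1⟩
    rw [DrinfeldPlane.weight_eq_of_add_eq (n := 2 * n) (by rw [h0, hn]; ring)]
    push_cast
    ring
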